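/- Let $\mathfrak{hc}$ be the Heisenberg–Clifford superalgebra: the complex Lie superalgebra with even basis elements $H_i$ ($i\in\mathbb Z$), $\mathbf c_3$ and odd basis elements $F_{i+\frac12}$ ($i\in\mathbb Z$), with brackets $$[H_i,H_j]=i\,\delta_{i+j,0}\,\mathbf c_3,\qquad [F_p,F_q]=\delta_{p+q,0}\,\mathbf c_3,\qquad [H_i,F_p]=0,\qquad \mathbf c_3 \text{ central}.$$ It is $\frac12\mathbb Z$-graded by $\deg H_i=i$, $\deg F_p=p$, $\deg\mathbf c_3=0$. Let $\mathfrak h=\mathrm{span}\{H_i,\mathbf c_3\mid i\in\mathbb Z\}$ and $\mathfrak f=\mathrm{span}\{F_{i+\frac12},\mathbf c_3\mid i\in\mathbb Z\}$, and for an integer $m\ge 1$ let $$\mathfrak{hc}^{(-m)}=\mathrm{span}\{H_i,\,F_{i+\frac12},\,\mathbf c_3\mid i\ge -m\},\qquad \mathfrak{hc}_{[m]}=\mathrm{span}\{H_i,\,F_{j+\frac12},\,\mathbf c_3\mid -m\le i\le m,\ -m\le j\le m-1\}.$$ Modules are $\mathbb Z/2$-graded, simple means having no graded submodules other than $0$ and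 the (nonzero) module itself, and isomorphisms are even. A module over $\mathfrak{hc}$, $\mathfrak h$ or $\mathfrak f$ is smooth if each of its vectors is annihilated by all homogeneous elements of sufficiently large degree. An $\mathfrak{hc}_{[m]}$-module $B$ is regarded as an $\mathfrak{hc}^{(-m)}$-module by letting $H_i$ ($i>m$) and $F_{j+\frac12}$ ($j\ge m$) act as zero, and $\mathrm{Ind}_{\mathfrak{hc}^{(-m)}}^{\mathfrak{hc}}B=U(\mathfrak{hc})\otimes_{U(\mathfrak{hc}^{(-m)})}B$. **Theorem.** Let $m\ge1$, and let $B$, $B'$ be simple $\mathfrak{hc}_{[m]}$-modules on which $\mathbf c_3$ acts nonzero. (a) The $\mathfrak{hc}$-module $\mathrm{Ind}_{\mathfrak{hc}^{(-m)}}^{\mathfrak{hc}}B$ is simple. Moreover, every simple smooth $\mathfrak{hc}$-module on which $\mathbf c_3$ acts nonzero is isomorphic to such an induced module, for some $m\ge1$ and some simple $\mathfrak{hc}_{[m]}$-module $B$ on which $\mathbf c_3$ acts nonzero. (b) $\mathrm{Ind}_{\mathfrak{hc}^{(-m)}}^{\mathfrak{hc}}B\cong\mathrm{Ind}_{\mathfrak{hc}^{(-m)}}^{\mathfrak{hc}}B'$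 as $\mathfrak{hc}$-modules if and only if $B\cong B'$ as $\mathfrak{hc}_{[m]}$-modules. (c) Let $V$ be a simple smooth $\mathfrak{hc}$-module on which $\mathbf c_3$ acts nonzero. Then $V\cong H\otimes K$ for some simple smooth $\mathfrak h$-module $H$ and some simple smooth $\mathfrak f$-module $K$, where $x(u\otimes w)=xu\otimes w$ for $x\in\mathfrak h$ and $x(u\otimes w)=u\otimes xw$ for $x\in\mathfrak f$. -/

import Mathlib

open scoped TensorProduct

universe u v w

/-! ### Super vector spaces -/

/-- A super vector space over `ℂ`: a space `V` together with a decomposition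
`V = V₀ ⊕ V₁`, where `grade i` is the component `V_i`. -/
class SuperSpace (V : Type v) [AddCommGroup V] [Module ℂ V] where
  grade : ZMod 2 → Submodule ℂ V
  isCompl : IsCompl (grade 0) (grade 1)

/-- The sign `(-1)^{ij}`. -/
noncomputable def superSign (i j : ZMod 2) : ℂ := if i = 1 ∧ j = 1 then -1 else 1

namespace SuperSpace

/-- A subspace `W` is graded if `W = (W ∩ V₀) + (W ∩ V₁)`. -/
def IsGraded {V : Type v} [AddCommGroup V] [Module ℂ V] [SuperSpace V]
    (W : Submodule ℂ V) : Prop :=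
  W ≤ (W ⊓ grade 0) ⊔ (W ⊓ grade 1)

/-- A graded subspace is itself a super vector space. -/
theorem isCompl_comap {V : Type v} [AddCommGroup V] [Module ℂ V] [SuperSpace V]
    {W : Submodule ℂ V} (hW : IsGraded W) :
    IsCompl ((grade (V := V) 0).comap W.subtype) ((grade (V := V) 1).comap W.subtype) := by
  constructor
  · rw [Submodule.disjoint_def]
    intro x h0 h1
    have := (Submodule.disjoint_def.1 (isCompl (V := V)).disjoint) _ h0 h1
    exact Subtype.ext this
  · rw [codisjoint_iff_le_sup]
    rintro ⟨x, hx⟩ -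
    obtain ⟨a, ha, b, hb, hab⟩ := Submodule.mem_sup.1 (hW hx)
    exact Submodule.mem_sup.2
      ⟨⟨a, ha.1⟩, ha.2, ⟨b, hb.1⟩, hb.2, Subtype.ext hab⟩

/-- The parity involution: `v ↦ (-1)^i v` on `V_i`. -/
noncomputable def parity (V : Type v) [AddCommGroup V] [Module ℂ V] [SuperSpace V] :
    V →ₗ[ℂ] V :=
  (grade 0).projection (grade 1) isCompl - (grade 1).projection (grade 0) isCompl.symm

theorem parity_even {V : Type v} [AddCommGroup V] [Module ℂ V] [SuperSpace V] {x : V}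
    (hx : x ∈ grade (V := V) 0) : parity V x = x := by
  simp [parity, Submodule.projection_apply_of_mem_left isCompl hx,
    (Submodule.projection_apply_eq_zero_iff (isCompl (V := V)).symm).2 hx]

theorem parity_odd {V : Type v} [AddCommGroup V] [Module ℂ V] [SuperSpace V] {x : V}
    (hx : x ∈ grade (V := V) 1) : parity V x = -x := by
  simp [parity, Submodule.projection_apply_of_mem_left isCompl.symm hx,
    (Submodule.projection_apply_eq_zero_iff (isCompl (V := V))).2 hx]

/-- Two linear maps that agree on even and on odd vectors are equal. -/
theorem hom_ext {V : Type v} [AddCommGroup V] [Module ℂ V] [SuperSpace V]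
    {M : Type w} [AddCommGroup M] [Module ℂ M] {f g : V →ₗ[ℂ] M}
    (h : ∀ i, ∀ x ∈ grade (V := V) i, f x = g x) : f = g := by
  ext x
  have hx : x ∈ grade (V := V) 0 ⊔ grade 1 := by
    rw [(isCompl (V := V)).sup_eq_top]; trivial
  obtain ⟨a, ha, b, hb, rfl⟩ := Submodule.mem_sup.1 hx
  rw [map_add, map_add, h 0 a ha, h 1 b hb]

theorem parity_parity (V : Type v) [AddCommGroup V] [Module ℂ V] [SuperSpace V] :
    parity V ∘ₗ parity V = LinearMap.id := by
  apply hom_ext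
  intro i x hx
  fin_cases i
  · simp [parity_even hx]
  · simp [parity_odd hx]

/-- The eigenspaces `{v | σ v = (-1)^i v}` of an involution. -/
def eigen {V : Type v} [AddCommGroup V] [Module ℂ V] (σ : V →ₗ[ℂ] V) (i : ZMod 2) :
    Submodule ℂ V :=
  if i = 0 then LinearMap.eqLocus σ LinearMap.id else LinearMap.eqLocus σ (-LinearMap.id)

theorem mem_eigen_zero {V : Type v} [AddCommGroup V] [Module ℂ V] {σ : V →ₗ[ℂ] V} {x : V} :
    x ∈ eigen σ 0 ↔ σ x = x := by
  simp [eigen, LinearMap.mem_eqLocus]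

theorem mem_eigen_one {V : Type v} [AddCommGroup V] [Module ℂ V] {σ : V →ₗ[ℂ] V} {x : V} :
    x ∈ eigen σ 1 ↔ σ x = -x := by
  simp [eigen, LinearMap.mem_eqLocus]

/-- The super vector space structure with a given parity involution. -/
@[reducible] def ofInvolution {V : Type v} [AddCommGroup V] [Module ℂ V] (σ : V →ₗ[ℂ] V)
    (hσ : σ ∘ₗ σ = LinearMap.id) : SuperSpace V where
  grade := eigen σ
  isCompl := by
    have hs : ∀ x, σ (σ x) = x := fun x => LinearMap.congr_fun hσ x
    constructor
    · rw [Submodule.disjoint_def]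
      intro x h0 h1
      rw [mem_eigen_zero] at h0
      rw [mem_eigen_one] at h1
      have h2 : (2 : ℂ) • x = 0 := by
        rw [two_smul]; nth_rewrite 1 [← h0]; rw [h1]; simp
      exact (smul_eq_zero.1 h2).resolve_left two_ne_zero
    · rw [codisjoint_iff_le_sup]
      intro x _
      refine Submodule.mem_sup.2 ⟨(2⁻¹ : ℂ) • (x + σ x), ?_, (2⁻¹ : ℂ) • (x - σ x), ?_, ?_⟩
      · rw [mem_eigen_zero, map_smul, map_add, hs, add_comm]
      · rw [mem_eigen_one, map_smul, map_sub, hs, ← smul_neg, neg_sub]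
      · rw [← smul_add, add_add_sub_cancel, ← two_smul ℂ x, smul_smul]; simp

end SuperSpace

open SuperSpace (grade)

/-! ### Lie superalgebras, subalgebras, homomorphisms -/

/-- A Lie superalgebra over `ℂ`. -/
class LieSuperalgebra (L : Type v) [AddCommGroup L] [Module ℂ L] extends SuperSpace L where
  bracket : L →ₗ[ℂ] L →ₗ[ℂ] L
  bracket_mem : ∀ {i j : ZMod 2} {x y : L},
    x ∈ grade i → y ∈ grade j → bracket x y ∈ grade (i + j)
  bracket_skew : ∀ {i j : ZMod 2} {x y : L},
    x ∈ grade i → y ∈ grade j → bracket x y = -(superSign i j • bracket y x)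
  bracket_jacobi : ∀ {i j : ZMod 2} {x y : L}, x ∈ grade i → y ∈ grade j → ∀ z : L,
    bracket x (bracket y z) = bracket (bracket x y) z + superSign i j • bracket y (bracket x z)

/-- A (graded) subalgebra of a Lie superalgebra. -/
structure LieSubSuperalgebra (L : Type v) [AddCommGroup L] [Module ℂ L] [LieSuperalgebra L]
    extends Submodule ℂ L where
  isGraded : SuperSpace.IsGraded toSubmodule
  bracket_mem : ∀ {x y : L}, x ∈ toSubmodule → y ∈ toSubmodule →
    LieSuperalgebra.bracket x y ∈ toSubmodule

instance (L : Type v) [AddCommGroup L] [Module ℂ L] [LieSuperalgebra L] :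
    CoeSort (LieSubSuperalgebra L) (Type v) := ⟨fun S => S.toSubmodule⟩

/-- A subalgebra, with the induced grading and bracket, is a Lie superalgebra. -/
noncomputable instance (L : Type v) [AddCommGroup L] [Module ℂ L] [LieSuperalgebra L]
    (S : LieSubSuperalgebra L) : LieSuperalgebra S where
  grade i := (grade (V := L) i).comap S.toSubmodule.subtype
  isCompl := SuperSpace.isCompl_comap S.isGraded
  bracket := LinearMap.mk₂ ℂ
    (fun x y => ⟨LieSuperalgebra.bracket (x : L) (y : L), S.bracket_mem x.2 y.2⟩)
    (fun x y z => Subtype.ext (by simp)) (fun c x y => Subtype.ext (by simp))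
    (fun x y z => Subtype.ext (by simp)) (fun c x y => Subtype.ext (by simp))
  bracket_mem hx hy := LieSuperalgebra.bracket_mem (L := L) hx hy
  bracket_skew hx hy := Subtype.ext (LieSuperalgebra.bracket_skew (L := L) hx hy)
  bracket_jacobi hx hy z := Subtype.ext (LieSuperalgebra.bracket_jacobi (L := L) hx hy z)

/-- A homomorphism of Lie superalgebras: an even linear map compatible with the brackets. -/
structure LieSuperHom (L : Type v) [AddCommGroup L] [Module ℂ L] [LieSuperalgebra L]
    (M : Type w) [AddCommGroup M] [Module ℂ M] [LieSuperalgebra M] extends L →ₗ[ℂ] M where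
  map_grade : ∀ (i : ZMod 2) (x : L), x ∈ grade i → toLinearMap x ∈ grade i
  map_bracket : ∀ x y : L, toLinearMap (LieSuperalgebra.bracket x y) =
    LieSuperalgebra.bracket (toLinearMap x) (toLinearMap y)

/-! ### Modules over Lie superalgebras -/

/-- A structure of (`ℤ/2`-graded) `L`-module on the super vector space `V`;
`act x v` is `x v`. -/
structure LieSuperModule (L : Type v) [AddCommGroup L] [Module ℂ L] [LieSuperalgebra L]
    (V : Type w) [AddCommGroup V] [Module ℂ V] [SuperSpace V] where
  act : L →ₗ[ℂ] V →ₗ[ℂ] V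
  act_mem : ∀ {i j : ZMod 2} {x : L} {a : V},
    x ∈ grade i → a ∈ grade j → act x a ∈ grade (i + j)
  act_bracket : ∀ {i j : ZMod 2} {x y : L}, x ∈ grade i → y ∈ grade j → ∀ a : V,
    act (LieSuperalgebra.bracket x y) a = act x (act y a) - superSign i j • act y (act x a)

namespace LieSuperModule

variable {L : Type u} [AddCommGroup L] [Module ℂ L] [LieSuperalgebra L]
variable {V : Type v} [AddCommGroup V] [Module ℂ V] [SuperSpace V]
variable {W : Type w} [AddCommGroup W] [Module ℂ W] [SuperSpace W]

/-- `V ≠ 0` has no graded submodules besides `0` and `V`. -/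
def IsSimple (ρ : LieSuperModule L V) : Prop :=
  Nontrivial V ∧ ∀ N : Submodule ℂ V, SuperSpace.IsGraded N →
    (∀ x, ∀ a ∈ N, ρ.act x a ∈ N) → N = ⊥ ∨ N = ⊤

/-- Isomorphism of graded modules: an even linear bijection commuting with the action. -/
def Iso (ρ : LieSuperModule L V) (τ : LieSuperModule L W) : Prop :=
  ∃ e : V ≃ₗ[ℂ] W, (∀ i, ∀ a ∈ grade (V := V) i, e a ∈ grade (V := W) i) ∧
    ∀ x a, e (ρ.act x a) = τ.act x (e a)

/-- Let `L` be `½ℤ`-graded, `deg k` being the component of degree `k/2`. The module is smooth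
if every vector is annihilated by all components of sufficiently large degree. -/
def IsSmooth (deg : ℤ → Submodule ℂ L) (ρ : LieSuperModule L V) : Prop :=
  ∀ a : V, ∃ n : ℕ, ∀ k : ℤ, (n : ℤ) < k → ∀ x ∈ deg k, ρ.act x a = 0

/-- Pullback of a module along a homomorphism of Lie superalgebras. -/
def pullback {M : Type w} [AddCommGroup M] [Module ℂ M] [LieSuperalgebra M]
    (ρ : LieSuperModule L V) (f : LieSuperHom M L) : LieSuperModule M V where
  act := ρ.act ∘ₗ f.toLinearMap
  act_mem hx ha := ρ.act_mem (f.map_grade _ _ hx) ha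
  act_bracket {i j x y} hx hy a := by
    simp only [LinearMap.comp_apply, f.map_bracket]
    exact ρ.act_bracket (f.map_grade _ _ hx) (f.map_grade _ _ hy) a

end LieSuperModule

/-! ### Universal enveloping algebra -/

/-- The relations `x y = (-1)^{ij} y x + [x, y]` for `x ∈ L_i`, `y ∈ L_j`. -/
inductive SuperEnveloping.Rel (L : Type v) [AddCommGroup L] [Module ℂ L] [LieSuperalgebra L] :
    TensorAlgebra ℂ L → TensorAlgebra ℂ L → Prop
  | bracket {i j : ZMod 2} {x y : L} (hx : x ∈ grade i) (hy : y ∈ grade j) :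
    SuperEnveloping.Rel L (TensorAlgebra.ι ℂ x * TensorAlgebra.ι ℂ y)
      (superSign i j • (TensorAlgebra.ι ℂ y * TensorAlgebra.ι ℂ x) +
        TensorAlgebra.ι ℂ (LieSuperalgebra.bracket x y))

/-- The universal enveloping algebra `U(L)` of a Lie superalgebra. -/
def SuperEnveloping (L : Type v) [AddCommGroup L] [Module ℂ L] [LieSuperalgebra L] : Type v :=
  RingQuot (SuperEnveloping.Rel L)

namespace SuperEnveloping

variable (L : Type v) [AddCommGroup L] [Module ℂ L] [LieSuperalgebra L]

noncomputable instance : Ring (SuperEnveloping L) :=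
  inferInstanceAs (Ring (RingQuot (SuperEnveloping.Rel L)))

noncomputable instance : Algebra ℂ (SuperEnveloping L) :=
  inferInstanceAs (Algebra ℂ (RingQuot (SuperEnveloping.Rel L)))

/-- The canonical map `L → U(L)`. -/
noncomputable def ι : L →ₗ[ℂ] SuperEnveloping L :=
  (RingQuot.mkAlgHom ℂ (SuperEnveloping.Rel L)).toLinearMap ∘ₗ TensorAlgebra.ι ℂ

variable {L}

theorem ι_mul_ι {i j : ZMod 2} {x y : L} (hx : x ∈ grade i) (hy : y ∈ grade j) :
    ι L x * ι L y = superSign i j • (ι L y * ι L x) + ι L (LieSuperalgebra.bracket x y) := by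
  have h := RingQuot.mkAlgHom_rel ℂ (SuperEnveloping.Rel.bracket hx hy)
  rw [map_add, map_smul, map_mul, map_mul] at h
  exact h

/-- The universal property of `U(L)`. -/
noncomputable def lift {A : Type w} [Ring A] [Algebra ℂ A] (f : L →ₗ[ℂ] A)
    (hf : ∀ {i j : ZMod 2} {x y : L}, x ∈ grade i → y ∈ grade j →
      f x * f y = superSign i j • (f y * f x) + f (LieSuperalgebra.bracket x y)) :
    SuperEnveloping L →ₐ[ℂ] A :=
  RingQuot.liftAlgHom ℂ ⟨TensorAlgebra.lift ℂ f, by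
    rintro _ _ ⟨hx, hy⟩
    simpa using hf hx hy⟩

theorem lift_ι {A : Type w} [Ring A] [Algebra ℂ A] (f : L →ₗ[ℂ] A)
    (hf : ∀ {i j : ZMod 2} {x y : L}, x ∈ grade i → y ∈ grade j →
      f x * f y = superSign i j • (f y * f x) + f (LieSuperalgebra.bracket x y)) (x : L) :
    lift f hf (ι L x) = f x :=
  (RingQuot.liftAlgHom_mkAlgHom_apply ℂ _ _ _).trans (TensorAlgebra.lift_ι_apply f x)

theorem hom_ext {A : Type w} [Ring A] [Algebra ℂ A] {f g : SuperEnveloping L →ₐ[ℂ] A}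
    (h : ∀ x, f (ι L x) = g (ι L x)) : f = g := by
  apply RingQuot.ringQuot_ext'
  apply TensorAlgebra.hom_ext
  ext x
  exact h x

theorem parity_bracket {i j : ZMod 2} {x y : L} (hx : x ∈ grade i) (hy : y ∈ grade j) :
    LieSuperalgebra.bracket (SuperSpace.parity L x) (SuperSpace.parity L y) =
      SuperSpace.parity L (LieSuperalgebra.bracket x y) := by
  have hxy := LieSuperalgebra.bracket_mem hx hy
  fin_cases i <;> fin_cases j
  · rw [SuperSpace.parity_even hx, SuperSpace.parity_even hy, SuperSpace.parity_even hxy]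
  · rw [SuperSpace.parity_even hx, SuperSpace.parity_odd hy, SuperSpace.parity_odd hxy, map_neg]
  · rw [SuperSpace.parity_odd hx, SuperSpace.parity_even hy, SuperSpace.parity_odd hxy, map_neg,
      LinearMap.neg_apply]
  · rw [SuperSpace.parity_odd hx, SuperSpace.parity_odd hy, SuperSpace.parity_even hxy, map_neg,
      map_neg, LinearMap.neg_apply, neg_neg]

theorem parity_mem {i : ZMod 2} {x : L} (hx : x ∈ grade i) :
    SuperSpace.parity L x ∈ grade i := by
  fin_cases i
  · rw [SuperSpace.parity_even hx]; exact hx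
  · rw [SuperSpace.parity_odd hx]; exact Submodule.neg_mem _ hx

theorem parity_rel {i j : ZMod 2} {x y : L} (hx : x ∈ grade i) (hy : y ∈ grade j) :
    (ι L ∘ₗ SuperSpace.parity L) x * (ι L ∘ₗ SuperSpace.parity L) y =
      superSign i j • ((ι L ∘ₗ SuperSpace.parity L) y * (ι L ∘ₗ SuperSpace.parity L) x) +
        (ι L ∘ₗ SuperSpace.parity L) (LieSuperalgebra.bracket x y) := by
  simp only [LinearMap.comp_apply]
  rw [ι_mul_ι (parity_mem hx) (parity_mem hy), parity_bracket hx hy]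

/-- The parity automorphism of `U(L)`: the algebra automorphism that is `x ↦ (-1)^i x`
for `x ∈ L_i`. -/
noncomputable def parity (L : Type v) [AddCommGroup L] [Module ℂ L] [LieSuperalgebra L] :
    SuperEnveloping L →ₐ[ℂ] SuperEnveloping L :=
  lift (ι L ∘ₗ SuperSpace.parity L) parity_rel

theorem parity_ι (x : L) : parity L (ι L x) = ι L (SuperSpace.parity L x) := 
  lift_ι _ parity_rel x

theorem parity_parity (z : SuperEnveloping L) : parity L (parity L z) = z := by
  have : (parity L).comp (parity L) = AlgHom.id ℂ _ := by
    apply hom_ext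
    intro x
    simp only [AlgHom.comp_apply, parity_ι, AlgHom.id_apply]
    exact congrArg _ (LinearMap.congr_fun (SuperSpace.parity_parity L) x)
  exact DFunLike.congr_fun this z

end SuperEnveloping

/-! ### Induced modules -/

section Induced

variable {L : Type u} [AddCommGroup L] [Module ℂ L] [LieSuperalgebra L]
  {S : LieSubSuperalgebra L} {B : Type v} [AddCommGroup B] [Module ℂ B] [SuperSpace B]

namespace LieSuperModule

open SuperEnveloping (ι)

/-- The relations `u s ⊗ b = u ⊗ s b` (`u ∈ U(L)`, `s ∈ S`, `b ∈ B`). As `U(S)` is generated by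
`S`, the quotient of `U(L) ⊗_ℂ B` by them is `U(L) ⊗_{U(S)} B`. -/
noncomputable def indRel (ρ : LieSuperModule S B) : Submodule ℂ (SuperEnveloping L ⊗[ℂ] B) :=
  Submodule.span ℂ {t | ∃ (z : SuperEnveloping L) (s : S) (b : B),
    t = (z * ι L (s : L)) ⊗ₜ[ℂ] b - z ⊗ₜ[ℂ] (ρ.act s b)}

/-- The underlying space `U(L) ⊗_{U(S)} B` of the induced module. -/
def Ind (ρ : LieSuperModule S B) : Type max u v :=
  (SuperEnveloping L ⊗[ℂ] B) ⧸ indRel ρ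

noncomputable instance (ρ : LieSuperModule S B) : AddCommGroup (Ind ρ) :=
  inferInstanceAs (AddCommGroup ((SuperEnveloping L ⊗[ℂ] B) ⧸ indRel ρ))

noncomputable instance (ρ : LieSuperModule S B) : Module ℂ (Ind ρ) :=
  inferInstanceAs (Module ℂ ((SuperEnveloping L ⊗[ℂ] B) ⧸ indRel ρ))

/-- The class of a tensor in the induced module. -/
noncomputable def indMk (ρ : LieSuperModule S B) : SuperEnveloping L ⊗[ℂ] B →ₗ[ℂ] Ind ρ :=
  (indRel ρ).mkQ

theorem indMk_surjective (ρ : LieSuperModule S B) : Function.Surjective (indMk ρ) :=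
  (indRel ρ).mkQ_surjective

theorem ind_ext (ρ : LieSuperModule S B) {M : Type w} [AddCommGroup M] [Module ℂ M]
    {f g : Ind ρ →ₗ[ℂ] M} (h : ∀ z b, f (indMk ρ (z ⊗ₜ b)) = g (indMk ρ (z ⊗ₜ b))) : f = g := by
  have : f ∘ₗ indMk ρ = g ∘ₗ indMk ρ := TensorProduct.ext' h
  ext t
  obtain ⟨t, rfl⟩ := indMk_surjective ρ t
  exact LinearMap.congr_fun this t

theorem act_parity (ρ : LieSuperModule S B) (s : S) (b : B) :
    ρ.act (SuperSpace.parity S s) (SuperSpace.parity B b) = SuperSpace.parity B (ρ.act s b) := by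
  have : (ρ.act ∘ₗ SuperSpace.parity S).compl₂ (SuperSpace.parity B) =
      ρ.act.compr₂ (SuperSpace.parity B) := by
    apply SuperSpace.hom_ext
    intro i x hx
    apply SuperSpace.hom_ext
    intro j a ha
    have hxa := ρ.act_mem hx ha
    simp only [LinearMap.compl₂_apply, LinearMap.comp_apply, LinearMap.compr₂_apply]
    fin_cases i <;> fin_cases j
    · rw [SuperSpace.parity_even hx, SuperSpace.parity_even ha, SuperSpace.parity_even hxa]
    · rw [SuperSpace.parity_even hx, SuperSpace.parity_odd ha, SuperSpace.parity_odd hxa, map_neg]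
    · rw [SuperSpace.parity_odd hx, SuperSpace.parity_even ha, SuperSpace.parity_odd hxa, map_neg,
        LinearMap.neg_apply]
    · rw [SuperSpace.parity_odd hx, SuperSpace.parity_odd ha, SuperSpace.parity_even hxa, map_neg,
        map_neg, LinearMap.neg_apply, neg_neg]
  exact LinearMap.congr_fun (LinearMap.congr_fun this s) b

theorem coe_parity (s : S) : ((SuperSpace.parity S s : S) : L) = SuperSpace.parity L (s : L) := by
  have : S.toSubmodule.subtype ∘ₗ SuperSpace.parity S =
      SuperSpace.parity L ∘ₗ S.toSubmodule.subtype := by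
    apply SuperSpace.hom_ext
    intro i x hx
    have hx' : (x : L) ∈ grade (V := L) i := hx
    simp only [LinearMap.comp_apply, Submodule.subtype_apply]
    fin_cases i
    · rw [SuperSpace.parity_even hx, SuperSpace.parity_even hx']
    · rw [SuperSpace.parity_odd hx, SuperSpace.parity_odd hx']; rfl
  exact LinearMap.congr_fun this s

/-- The parity involution of the induced module: `u ⊗ b ↦ (-1)^{i+j} u ⊗ b` for `u` of parity `i`
and `b` of parity `j`. -/
noncomputable def indParity (ρ : LieSuperModule S B) : Ind ρ →ₗ[ℂ] Ind ρ :=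
  (indRel ρ).mapQ (indRel ρ)
    (TensorProduct.map (SuperEnveloping.parity L).toLinearMap (SuperSpace.parity B)) <| by
    rw [indRel, Submodule.span_le]
    rintro _ ⟨z, s, b, rfl⟩
    refine Submodule.subset_span
      ⟨SuperEnveloping.parity L z, SuperSpace.parity S s, SuperSpace.parity B b, ?_⟩
    simp only [map_sub, TensorProduct.map_tmul, AlgHom.toLinearMap_apply, map_mul,
      SuperEnveloping.parity_ι, act_parity, coe_parity]

theorem indParity_mk (ρ : LieSuperModule S B) (z : SuperEnveloping L) (b : B) :
    indParity ρ (indMk ρ (z ⊗ₜ b)) =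
      indMk ρ (SuperEnveloping.parity L z ⊗ₜ SuperSpace.parity B b) := rfl

/-- The grading of the induced module, induced from those of `U(L)` and `B`. -/
noncomputable instance (ρ : LieSuperModule S B) : SuperSpace (Ind ρ) :=
  SuperSpace.ofInvolution (indParity ρ) <| by
    apply ind_ext
    intro z b
    simp only [LinearMap.comp_apply, indParity_mk, SuperEnveloping.parity_parity,
      LinearMap.id_apply]
    rw [show SuperSpace.parity B (SuperSpace.parity B b) = b from
      LinearMap.congr_fun (SuperSpace.parity_parity B) b]

/-- Left multiplication by `a ∈ U(L)` on the induced module: `a (u ⊗ b) = a u ⊗ b`. -/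
noncomputable def indMul (ρ : LieSuperModule S B) (a : SuperEnveloping L) :
    Ind ρ →ₗ[ℂ] Ind ρ :=
  (indRel ρ).mapQ (indRel ρ) (LinearMap.rTensor B (LinearMap.mulLeft ℂ a)) <| by
    rw [indRel, Submodule.span_le]
    rintro _ ⟨z, s, b, rfl⟩
    exact Submodule.subset_span ⟨a * z, s, b, by simp [mul_assoc]⟩

theorem indMul_mk (ρ : LieSuperModule S B) (a z : SuperEnveloping L) (b : B) :
    indMul ρ a (indMk ρ (z ⊗ₜ b)) = indMk ρ ((a * z) ⊗ₜ b) := rfl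

theorem indMul_mul (ρ : LieSuperModule S B) (a a' : SuperEnveloping L) :
    indMul ρ (a * a') = indMul ρ a ∘ₗ indMul ρ a' :=
  ind_ext ρ fun z b => by simp [indMul_mk, mul_assoc]

theorem indMul_add (ρ : LieSuperModule S B) (a a' : SuperEnveloping L) :
    indMul ρ (a + a') = indMul ρ a + indMul ρ a' :=
  ind_ext ρ fun z b => by simp [indMul_mk, add_mul, TensorProduct.add_tmul]

theorem indMul_smul (ρ : LieSuperModule S B) (c : ℂ) (a : SuperEnveloping L) :
    indMul ρ (c • a) = c • indMul ρ a :=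
  ind_ext ρ fun z b => by
    rw [LinearMap.smul_apply, indMul_mk, indMul_mk, smul_mul_assoc, ← TensorProduct.smul_tmul',
      map_smul]

theorem indParity_indMul (ρ : LieSuperModule S B) (a : SuperEnveloping L) (t : Ind ρ) :
    indParity ρ (indMul ρ a t) = indMul ρ (SuperEnveloping.parity L a) (indParity ρ t) := by
  have : indParity ρ ∘ₗ indMul ρ a = indMul ρ (SuperEnveloping.parity L a) ∘ₗ indParity ρ :=
    ind_ext ρ fun z b => by simp [indMul_mk, indParity_mk]
  exact LinearMap.congr_fun this t

/-- The induced module `Ind_S^L B = U(L) ⊗_{U(S)} B`. -/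
noncomputable def ind (ρ : LieSuperModule S B) : LieSuperModule L (Ind ρ) where
  act :=
    { toFun := fun x => indMul ρ (ι L x)
      map_add' := fun x y => by rw [map_add, indMul_add]
      map_smul' := fun c x => by rw [map_smul, indMul_smul]; rfl }
  act_mem {i j x t} hx ht := by
    have key : indParity ρ (indMul ρ (ι L x) t) =
        indMul ρ (ι L (SuperSpace.parity L x)) (indParity ρ t) := by
      rw [indParity_indMul, SuperEnveloping.parity_ι]
    change t ∈ SuperSpace.eigen (indParity ρ) j at ht
    change indMul ρ (ι L x) t ∈ SuperSpace.eigen (indParity ρ) (i + j)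
    fin_cases i <;> fin_cases j
    · refine SuperSpace.mem_eigen_zero.2 ?_
      rw [key, SuperSpace.parity_even hx, SuperSpace.mem_eigen_zero.1 ht]
    · refine SuperSpace.mem_eigen_one.2 ?_
      rw [key, SuperSpace.parity_even hx, SuperSpace.mem_eigen_one.1 ht, map_neg]
    · refine SuperSpace.mem_eigen_one.2 ?_
      have hneg : indMul ρ (-ι L x) t = -indMul ρ (ι L x) t := by
        rw [← neg_one_smul ℂ, indMul_smul]; simp
      rw [key, SuperSpace.parity_odd hx, SuperSpace.mem_eigen_zero.1 ht, map_neg, hneg]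
    · refine SuperSpace.mem_eigen_zero.2 ?_
      have hneg : indMul ρ (-ι L x) t = -indMul ρ (ι L x) t := by
        rw [← neg_one_smul ℂ, indMul_smul]; simp
      rw [key, SuperSpace.parity_odd hx, SuperSpace.mem_eigen_one.1 ht, map_neg, map_neg, hneg,
        neg_neg]
  act_bracket {i j x y} hx hy t := by
    change indMul ρ (ι L (LieSuperalgebra.bracket x y)) t =
      (indMul ρ (ι L x) ∘ₗ indMul ρ (ι L y)) t -
        superSign i j • (indMul ρ (ι L y) ∘ₗ indMul ρ (ι L x)) t
    rw [← indMul_mul, ← indMul_mul, SuperEnveloping.ι_mul_ι hx hy, indMul_add, indMul_smul]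
    simp

end LieSuperModule

end Induced

/-! ### The Heisenberg-Clifford superalgebra -/

/-- Labels of the basis `H_n`, `F_{n+1/2}` (`n ∈ ℤ`), `c₃`; `F n` stands for `F_{n+1/2}`. -/
inductive HCIdx : Type
  | H (n : ℤ)
  | F (n : ℤ)
  | c

namespace HCIdx

/-- `H_n` and `c₃` are even, `F_{n+1/2}` is odd. -/
def parity : HCIdx → ZMod 2
  | H _ => 0
  | F _ => 1
  | c => 0

/-- Twice the degree: `H_n` has degree `n`, `F_{n+1/2}` degree `n + 1/2`, `c₃` degree `0`. -/
def twiceDeg : HCIdx → ℤ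
  | H n => 2 * n
  | F n => 2 * n + 1
  | c => 0

/-- The coefficient of `c₃` in the bracket of two basis vectors: `[H_m, H_n] = m δ_{m+n,0} c₃`,
`[F_p, F_q] = δ_{p+q,0} c₃`, and all other brackets vanish. -/
def form : HCIdx → HCIdx → ℂ
  | H m, H n => if m + n = 0 then (m : ℂ) else 0
  | F m, F n => if m + n + 1 = 0 then 1 else 0
  | _, _ => 0

end HCIdx

/-- The underlying space of the Heisenberg-Clifford superalgebra, with basis indexed by `HCIdx`. -/
abbrev HC : Type := HCIdx →₀ ℂ

namespace HC

/-- The basis vector with label `k`. -/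
noncomputable def e (k : HCIdx) : HC := Finsupp.single k 1

/-- The central element `c₃`. -/
noncomputable def c₃ : HC := e HCIdx.c

/-- The bilinear extension of `HCIdx.form`. -/
noncomputable def form : HC →ₗ[ℂ] HC →ₗ[ℂ] ℂ :=
  Finsupp.linearCombination ℂ fun k => Finsupp.linearCombination ℂ fun l => HCIdx.form k l

theorem form_e (k l : HCIdx) : form (e k) (e l) = HCIdx.form k l := by
  simp [form, e, Finsupp.linearCombination_single]

theorem form_c_left (x : HC) : form c₃ x = 0 := by
  have : form c₃ = 0 := by
    ext l
    simpa [e, c₃, HCIdx.form] using form_e HCIdx.c l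
  rw [this]; rfl

theorem form_c_right (x : HC) : form x c₃ = 0 := by
  have : form.flip c₃ = 0 := by
    ext k
    have h := form_e k HCIdx.c
    have h0 : HCIdx.form k HCIdx.c = 0 := by cases k <;> rfl
    rw [h0] at h
    simpa [e, c₃] using h
  exact LinearMap.congr_fun this x

/-- The bracket `[x, y] = form x y • c₃`. -/
noncomputable def bracket : HC →ₗ[ℂ] HC →ₗ[ℂ] HC :=
  form.compr₂ (LinearMap.toSpanSingleton ℂ HC c₃)

theorem bracket_apply (x y : HC) : bracket x y = form x y • c₃ := rfl

/-- The span of the basis vectors with labels in `T`. -/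
noncomputable def spanOf (T : Set HCIdx) : Submodule ℂ HC := Finsupp.supported ℂ ℂ T

theorem spanOf_eq (T : Set HCIdx) : spanOf T = Submodule.span ℂ (e '' T) :=
  Finsupp.supported_eq_span_single ℂ T

theorem e_mem {T : Set HCIdx} {k : HCIdx} (h : k ∈ T) : e k ∈ spanOf T :=
  Finsupp.single_mem_supported ℂ 1 h

/-- Bilinear maps agree on `spanOf T × spanOf T'` if they do on basis vectors. -/
theorem bilin_ext {M : Type*} [AddCommGroup M] [Module ℂ M] {T T' : Set HCIdx}
    (f g : HC →ₗ[ℂ] HC →ₗ[ℂ] M)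
    (h : ∀ k ∈ T, ∀ l ∈ T', f (e k) (e l) = g (e k) (e l)) {x y : HC}
    (hx : x ∈ spanOf T) (hy : y ∈ spanOf T') : f x y = g x y := by
  rw [spanOf_eq] at hx hy
  induction hx using Submodule.span_induction with
  | mem x hx =>
    obtain ⟨k, hk, rfl⟩ := hx
    induction hy using Submodule.span_induction with
    | mem y hy => obtain ⟨l, hl, rfl⟩ := hy; exact h k hk l hl
    | zero => simp
    | add a b _ _ ha hb => simp [ha, hb]
    | smul c a _ ha => simp [ha]
  | zero => simp
  | add a b _ _ ha hb => simp [ha, hb]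
  | smul c a _ ha => simp [ha]

theorem form_skew {i j : ZMod 2} {x y : HC} (hx : x ∈ spanOf {k | k.parity = i})
    (hy : y ∈ spanOf {k | k.parity = j}) : form x y = -(superSign i j * form y x) := by
  refine bilin_ext form (-(superSign i j • form.flip)) ?_ hx hy
  rintro k rfl l rfl
  simp only [LinearMap.neg_apply, LinearMap.smul_apply, LinearMap.flip_apply, form_e, smul_eq_mul]
  rcases k with m | m | _ <;> rcases l with n | n | _ <;>
    simp [HCIdx.form, HCIdx.parity, superSign]
  · rw [add_comm n m]
    split_ifs with h
    · rw [← Int.cast_neg, Int.cast_inj]; omega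
    · simp
  · rw [add_comm n m]
    split_ifs <;> simp

theorem form_parity {i j : ZMod 2} {x y : HC} (hij : i + j ≠ 0)
    (hx : x ∈ spanOf {k | k.parity = i}) (hy : y ∈ spanOf {k | k.parity = j}) :
    form x y = 0 := by
  refine bilin_ext form 0 ?_ hx hy
  rintro k rfl l rfl
  rw [form_e]
  rcases k with m | m | _ <;> rcases l with n | n | _ <;>
    first
    | rfl
    | exact absurd (show (0 : ZMod 2) + 0 = 0 by decide) hij

end HC

/-- The Heisenberg-Clifford superalgebra `𝔥𝔠`. -/
noncomputable instance : LieSuperalgebra HC where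
  grade i := HC.spanOf {k | k.parity = i}
  isCompl := by
    constructor
    · refine Finsupp.disjoint_supported_supported (Set.disjoint_left.2 ?_)
      intro k h0 h1
      exact absurd (h0.symm.trans h1) (by decide)
    · refine Finsupp.codisjoint_supported_supported (codisjoint_iff_le_sup.2 ?_)
      rintro (n | n | _) -
      · exact Or.inl rfl
      · exact Or.inr rfl
      · exact Or.inl rfl
  bracket := HC.bracket
  bracket_mem {i j x y} hx hy := by
    rw [HC.bracket_apply]
    by_cases h : i + j = 0
    · rw [h]; exact Submodule.smul_mem _ _ (HC.e_mem rfl)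
    · rw [HC.form_parity h hx hy, zero_smul]; exact Submodule.zero_mem _
  bracket_skew {i j x y} hx hy := by
    rw [HC.bracket_apply, HC.bracket_apply, HC.form_skew hx hy, neg_smul, mul_smul]
  bracket_jacobi {i j x y} hx hy z := by
    simp [HC.bracket_apply, HC.form_c_left, HC.form_c_right]

namespace HC

/-- For a set `T` of labels containing that of `c₃`, the span of the corresponding basis vectors
is a subalgebra of `𝔥𝔠`. -/
noncomputable def subalgebra (T : Set HCIdx) (hT : HCIdx.c ∈ T) : LieSubSuperalgebra HC where
  toSubmodule := spanOf T
  isGraded := by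
    have h : ∀ i : ZMod 2, ∀ k ∈ T, k.parity = i →
        e k ∈ spanOf T ⊓ grade (V := HC) i := fun i k hk hi => ⟨e_mem hk, e_mem hi⟩
    rw [SuperSpace.IsGraded]
    conv_lhs => rw [spanOf_eq]
    rw [Submodule.span_le]
    rintro _ ⟨k, hk, rfl⟩
    rcases k with n | n | _
    · exact Submodule.mem_sup_left (h 0 _ hk rfl)
    · exact Submodule.mem_sup_right (h 1 _ hk rfl)
    · exact Submodule.mem_sup_left (h 0 _ hk rfl)
  bracket_mem {x y} _ _ := Submodule.smul_mem _ (form x y) (e_mem hT)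

/-- Labels of the basis of `𝔥𝔠^{(n)}`: `H_i`, `F_{i+1/2}` with `i ≥ n`, and `c₃`. -/
def geIdx (n : ℤ) : Set HCIdx :=
  {k | match k with
    | .H i => n ≤ i
    | .F i => n ≤ i
    | .c => True}

/-- Labels of the basis of `𝔥𝔠_{[m]}`: `H_i` with `-m ≤ i ≤ m`, `F_{j+1/2}` with
`-m ≤ j ≤ m - 1`, and `c₃`. -/
def finIdx (m : ℕ) : Set HCIdx :=
  {k | match k with
    | .H i => -(m : ℤ) ≤ i ∧ i ≤ m
    | .F j => -(m : ℤ) ≤ j ∧ j ≤ (m : ℤ) - 1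
    | .c => True}

/-- The subalgebra `𝔥𝔠^{(n)}`. -/
noncomputable def ge (n : ℤ) : LieSubSuperalgebra HC := subalgebra (geIdx n) trivial

/-- The subalgebra `𝔥𝔠_{[m]}`. -/
noncomputable def fin (m : ℕ) : LieSubSuperalgebra HC := subalgebra (finIdx m) trivial

/-- The Heisenberg algebra `𝔥`, spanned by the `H_n` and `c₃`. -/
noncomputable def heis : LieSubSuperalgebra HC :=
  subalgebra (Set.range HCIdx.H ∪ {HCIdx.c}) (Or.inr rfl)

/-- The fermion superalgebra `𝔣`, spanned by the `F_{n+1/2}` and `c₃`. -/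
noncomputable def ferm : LieSubSuperalgebra HC :=
  subalgebra (Set.range HCIdx.F ∪ {HCIdx.c}) (Or.inr rfl)

/-- The `½ℤ`-grading of `𝔥𝔠`: `deg k` is the component of degree `k/2`. -/
noncomputable def deg (k : ℤ) : Submodule ℂ HC := spanOf {l | l.twiceDeg = k}

/-- The `½ℤ`-grading induced on a subalgebra. -/
noncomputable def subDeg (S : LieSubSuperalgebra HC) (k : ℤ) : Submodule ℂ S :=
  (deg k).comap S.toSubmodule.subtype

/-- The element `c₃` of `𝔥𝔠_{[m]}`. -/
noncomputable def fin_c₃ (m : ℕ) : fin m := ⟨c₃, e_mem (T := finIdx m) trivial⟩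

open Classical in
/-- The projection of `𝔥𝔠` onto the span of the basis vectors of `𝔥𝔠_{[m]}` that kills all other
basis vectors. -/
noncomputable def truncLin (m : ℕ) : HC →ₗ[ℂ] fin m := Finsupp.restrictDom ℂ ℂ (finIdx m)

theorem truncLin_of_mem {m : ℕ} {k : HCIdx} (hk : k ∈ finIdx m) :
    (truncLin m (e k) : HC) = e k := by
  classical
  exact Finsupp.filter_single_of_pos (· ∈ finIdx m) hk

theorem truncLin_of_not_mem {m : ℕ} {k : HCIdx} (hk : k ∉ finIdx m) :
    (truncLin m (e k) : HC) = 0 := by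
  classical
  exact Finsupp.filter_single_of_neg (· ∈ finIdx m) hk

theorem form_eq_zero {m : ℕ} {k l : HCIdx} (hk : k ∈ geIdx (-m)) (hl : l ∈ geIdx (-m))
    (h : k ∉ finIdx m ∨ l ∉ finIdx m) : HCIdx.form k l = 0 := by
  rcases k with i | i | _ <;> rcases l with j | j | _ <;>
    simp only [HCIdx.form, geIdx, finIdx, Set.mem_ofPred_eq, ite_eq_right_iff] at * <;>
    intro _ <;> exfalso <;> omega

theorem form_trunc {m : ℕ} {x y : HC} (hx : x ∈ spanOf (geIdx (-m)))
    (hy : y ∈ spanOf (geIdx (-m))) :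
    form (truncLin m x) (truncLin m y) = form x y := by
  let p : HC →ₗ[ℂ] HC := (fin m).toSubmodule.subtype ∘ₗ truncLin m
  refine bilin_ext (form.compl₁₂ p p) form ?_ hx hy
  intro k hk l hl
  change form (truncLin m (e k)) (truncLin m (e l)) = _
  by_cases h1 : k ∈ finIdx m
  · by_cases h2 : l ∈ finIdx m
    · rw [truncLin_of_mem h1, truncLin_of_mem h2]
    · rw [truncLin_of_not_mem h2, map_zero, form_e, form_eq_zero hk hl (Or.inr h2)]
  · rw [truncLin_of_not_mem h1, map_zero, form_e, form_eq_zero hk hl (Or.inl h1)]; rfl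

/-- The homomorphism `𝔥𝔠^{(-m)} → 𝔥𝔠_{[m]}` that is the identity on `𝔥𝔠_{[m]}` and kills `H_i` for
`i > m` and `F_{j+1/2}` for `j ≥ m`. -/
noncomputable def trunc (m : ℕ) : LieSuperHom (ge (-m)) (fin m) where
  toLinearMap := truncLin m ∘ₗ (ge (-m)).toSubmodule.subtype
  map_grade i x hx := by
    classical
    have hx' : (x : HC) ∈ Finsupp.supported ℂ ℂ {k : HCIdx | k.parity = i} := hx
    change Finsupp.filter (· ∈ finIdx m) (x : HC) ∈
      Finsupp.supported ℂ ℂ {k : HCIdx | k.parity = i}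
    rw [Finsupp.mem_supported] at hx' ⊢
    intro k hk
    rw [Finset.mem_coe, Finsupp.support_filter, Finset.mem_filter] at hk
    exact hx' hk.1
  map_bracket x y := by
    apply Subtype.ext
    change (truncLin m (form (x : HC) (y : HC) • c₃) : HC) =
      form (truncLin m (x : HC)) (truncLin m (y : HC)) • c₃
    rw [form_trunc x.2 y.2, map_smul]
    exact congrArg (form (x : HC) (y : HC) • ·) (truncLin_of_mem (m := m) (k := HCIdx.c) trivial)

/-- The `𝔥𝔠`-module `Ind_{𝔥𝔠^{(-m)}}^{𝔥𝔠} B` induced from an `𝔥𝔠_{[m]}`-module `B`, regarded as an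
`𝔥𝔠^{(-m)}`-module by letting `H_i` (`i > m`) and `F_{j+1/2}` (`j ≥ m`) act as zero. -/
noncomputable def indModule (m : ℕ) {B : Type v} [AddCommGroup B] [Module ℂ B] [SuperSpace B]
    (ρ : LieSuperModule (fin m) B) : LieSuperModule HC (LieSuperModule.Ind (ρ.pullback (trunc m))) :=
  (ρ.pullback (trunc m)).ind

end HC

/-!
The theorem rests on the Stone–von Neumann principle for oscillators. Fix a set `I` of modes of
positive degree. On an `𝔥𝔠`-module on which `c₃` acts invertibly, the modes in `I` are
annihilation operators and the dual modes of negative degree are the corresponding creation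
operators; together they form an `OscillatorSystem`. Two facts hold for every subspace `W` of
vacuum vectors (those killed by `I`):

* creation operators yield no new vacuum vectors, that is, the vacuum vectors in the space
  generated by `W` are those in `W` (`OscillatorSystem.mem_of_mem_vacuum_of_mem_generated`). The
  number operator `∑ weight⁻¹ cen⁻¹ cre ann` kills vacuum vectors but acts by `k` on words of
  length `k` modulo shorter words;
* if `W` generates the module, each nonzero subspace stable under annihilation operators contains
  a nonzero vacuum vector (`OscillatorSystem.exists_mem_vacuum`), since annihilation operators
  shorten words.

Hence the vacuum space of a simple module is simple over the remaining modes
(`HC.eq_bot_or_eq_vacuum`).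

For the induced modules, `I` consists of the modes of positive degree outside `𝔥𝔠_{[m]}`. The
vacuum space of `Ind B` is then the image `1 ⊗ B` of `B` (`HC.vacuum_indModule`), so each nonzero
submodule of `Ind B` meets `1 ⊗ B`, and an isomorphism `Ind B ≅ Ind B'` restricts to the vacuum
spaces. That `B` embeds into `Ind B` (`HC.indModuleOne_injective`) does not require the
Poincaré–Birkhoff–Witt theorem: `Ind B` maps to an explicit module on the tensor product of `B`
with a polynomial ring and an exterior algebra. Conversely, a simple smooth module has nonzero
vacuum vectors if `m` is large, and they form a simple module `B` that induces it.

For the tensor product decomposition, `I` consists of all `F_p` with `p > 0`. The Heisenberg algebra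
acts on the vacuum space `H`, and the creation operators generate an exterior algebra `K`, the
fermionic Fock space. In `H ⊗ K` the element `c₃` can be moved from one factor to the other, so it
has to act by a scalar. This follows from Dixmier's form of Schur's lemma
(`HC.exists_act_c₃_eq_smul`): a simple module has countable dimension, and an endomorphism of a
space of countable dimension over `ℂ` has nonempty spectrum.
-/

/-! ### Super vector spaces through their parity involution -/

namespace SuperSpace

variable {V : Type v} [AddCommGroup V] [Module ℂ V] [SuperSpace V]
variable {W : Type w} [AddCommGroup W] [Module ℂ W] [SuperSpace W]

theorem parity_parity_apply (x : V) : parity V (parity V x) = x :=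
  LinearMap.congr_fun (parity_parity V) x

theorem zmod_two_cases (i : ZMod 2) : i = 0 ∨ i = 1 := by
  revert i; decide

theorem superSign_mul_self (i j : ZMod 2) : superSign i j * superSign i j = 1 := by
  unfold superSign; split_ifs <;> simp

/-- The sign `(-1)^i`. -/
noncomputable def paritySign (i : ZMod 2) : ℂ := superSign i 1

theorem paritySign_zero : paritySign 0 = 1 := by simp [paritySign, superSign]

theorem paritySign_one : paritySign 1 = -1 := by simp [paritySign, superSign]

theorem paritySign_add (i j : ZMod 2) : paritySign (i + j) = paritySign i * paritySign j := by
  have h : (1 : ZMod 2) + 1 = 0 := by decide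
  obtain rfl | rfl := zmod_two_cases i <;> obtain rfl | rfl := zmod_two_cases j <;>
    simp [paritySign_zero, paritySign_one, h]

/-- The components of a super vector space are the eigenspaces of its parity involution. -/
theorem mem_grade_iff {i : ZMod 2} {x : V} :
    x ∈ grade (V := V) i ↔ parity V x = paritySign i • x := by
  have hsum : ∃ a ∈ grade (V := V) 0, ∃ b ∈ grade (V := V) 1, a + b = x :=
    Submodule.mem_sup.1 (by rw [(isCompl (V := V)).sup_eq_top]; trivial)
  obtain ⟨a, ha, b, hb, rfl⟩ := hsum
  have hp : parity V (a + b) = a - b := by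
    rw [map_add, parity_even ha, parity_odd hb, sub_eq_add_neg]
  rw [hp]
  have h2 : ∀ y : V, y = -y → y = 0 := fun y hy => by
    have h : (2 : ℂ) • y = 0 := by
      rw [two_smul]; nth_rewrite 1 [hy]; exact neg_add_cancel y
    exact (smul_eq_zero.1 h).resolve_left two_ne_zero
  obtain rfl | rfl := zmod_two_cases i
  · rw [paritySign_zero, one_smul]
    constructor
    · intro h
      rw [← hp, parity_even h]
    · intro h
      have : b = 0 := h2 b (by rw [sub_eq_add_neg] at h; exact (add_left_cancel h).symm)
      rw [this, add_zero]; exact ha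
  · rw [paritySign_one, neg_one_smul]
    constructor
    · intro h
      rw [← hp, parity_odd h]
    · intro h
      have : a = 0 := h2 a (by
        rw [sub_eq_add_neg, neg_add] at h; exact add_right_cancel h)
      rw [this, zero_add]; exact hb

theorem mem_eigen_iff {M : Type*} [AddCommGroup M] [Module ℂ M] {σ : M →ₗ[ℂ] M} {i : ZMod 2}
    {x : M} : x ∈ eigen σ i ↔ σ x = paritySign i • x := by
  obtain rfl | rfl := zmod_two_cases i
  · rw [mem_eigen_zero, paritySign_zero, one_smul]
  · rw [mem_eigen_one, paritySign_one, neg_one_smul]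

/-- A space graded by the eigenspaces of an involution has that involution as parity. -/
theorem parity_eq_of_grade_eq_eigen {σ : V →ₗ[ℂ] V}
    (h : ∀ i, grade (V := V) i = eigen σ i) : parity V = σ := by
  apply hom_ext
  intro i x hx
  rw [mem_grade_iff.1 hx, mem_eigen_iff.1 (h i ▸ hx)]

/-- A subspace is graded as soon as it is stable under the parity involution. -/
theorem isGraded_of_parity {N : Submodule ℂ V} (h : ∀ x ∈ N, parity V x ∈ N) : IsGraded N := by
  intro x hx
  refine Submodule.mem_sup.2 ⟨(2⁻¹ : ℂ) • (x + parity V x), ⟨?_, ?_⟩,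
    (2⁻¹ : ℂ) • (x - parity V x), ⟨?_, ?_⟩, ?_⟩
  · exact N.smul_mem _ (N.add_mem hx (h x hx))
  · rw [SetLike.mem_coe, mem_grade_iff, map_smul, map_add, parity_parity_apply, paritySign_zero,
      one_smul, add_comm]
  · exact N.smul_mem _ (N.sub_mem hx (h x hx))
  · rw [SetLike.mem_coe, mem_grade_iff, map_smul, map_sub, parity_parity_apply, paritySign_one,
      neg_one_smul, ← smul_neg, neg_sub]
  · rw [← smul_add, add_add_sub_cancel, ← two_smul ℂ x, smul_smul]; simp

theorem IsGraded.parity_mem {N : Submodule ℂ V} (h : IsGraded N) {x : V} (hx : x ∈ N) :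
    parity V x ∈ N := by
  obtain ⟨a, ha, b, hb, rfl⟩ := Submodule.mem_sup.1 (h hx)
  rw [map_add, parity_even ha.2, parity_odd hb.2]
  exact N.add_mem ha.1 (N.neg_mem hb.1)

/-- A linear map is even if and only if it commutes with the parity involutions. -/
theorem even_iff {f : V →ₗ[ℂ] W} :
    (∀ i, ∀ x ∈ grade (V := V) i, f x ∈ grade (V := W) i) ↔
      ∀ x, f (parity V x) = parity W (f x) := by
  constructor
  · intro h x
    have : f ∘ₗ parity V = parity W ∘ₗ f := by
      apply hom_ext
      intro i x hx
      simp only [LinearMap.comp_apply]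
      rw [mem_grade_iff.1 hx, mem_grade_iff.1 (h i x hx), map_smul]
    exact LinearMap.congr_fun this x
  · intro h i x hx
    rw [mem_grade_iff, ← h, mem_grade_iff.1 hx, map_smul]

/-- A graded subspace as a super vector space. -/
@[reducible] noncomputable def ofGraded {N : Submodule ℂ V} (hN : IsGraded N) : SuperSpace N where
  grade i := (grade (V := V) i).comap N.subtype
  isCompl := isCompl_comap hN

theorem coe_parity_ofGraded {N : Submodule ℂ V} (hN : IsGraded N) (x : N) :
    ((@parity N _ _ (ofGraded hN) x : N) : V) = parity V (x : V) :=
  letI := ofGraded hN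
  (even_iff (f := N.subtype)).1 (fun _ _ hx => hx) x

end SuperSpace

namespace LieSuperModule

variable {L : Type u} [AddCommGroup L] [Module ℂ L] [LieSuperalgebra L]
variable {V : Type v} [AddCommGroup V] [Module ℂ V] [SuperSpace V]

theorem act_parity_of_mem (ρ : LieSuperModule L V) {i : ZMod 2} {x : L} (hx : x ∈ grade i)
    (a : V) : ρ.act x (SuperSpace.parity V a) =
      SuperSpace.paritySign i • SuperSpace.parity V (ρ.act x a) := by
  have : ρ.act x ∘ₗ SuperSpace.parity V =
      SuperSpace.paritySign i • SuperSpace.parity V ∘ₗ ρ.act x := by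
    apply SuperSpace.hom_ext
    intro j a ha
    have h := SuperSpace.mem_grade_iff.1 (ρ.act_mem hx ha)
    simp only [LinearMap.comp_apply, LinearMap.smul_apply]
    rw [h, SuperSpace.mem_grade_iff.1 ha, map_smul, SuperSpace.paritySign_add, smul_smul,
      ← mul_assoc, show SuperSpace.paritySign i * SuperSpace.paritySign i = 1 from
        SuperSpace.superSign_mul_self _ _, one_mul]
  exact LinearMap.congr_fun this a

/-- The module structure on a graded subspace stable under a subalgebra `S`. -/
noncomputable def restrict (ρ : LieSuperModule L V) (S : LieSubSuperalgebra L)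
    {N : Submodule ℂ V} (hN : SuperSpace.IsGraded N)
    (hS : ∀ x ∈ S.toSubmodule, ∀ a ∈ N, ρ.act x a ∈ N) :
    @LieSuperModule S _ _ _ N _ _ (SuperSpace.ofGraded hN) :=
  letI := SuperSpace.ofGraded hN
  { act := LinearMap.mk₂ ℂ (fun x a => ⟨ρ.act (x : L) (a : V), hS x x.2 a a.2⟩)
      (fun x y z => Subtype.ext (by simp)) (fun c x y => Subtype.ext (by simp))
      (fun x y z => Subtype.ext (by simp)) (fun c x y => Subtype.ext (by simp))
    act_mem := fun {i j x a} hx ha => ρ.act_mem (i := i) (j := j) (x := (x : L)) hx ha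
    act_bracket := fun {i j x y} hx hy a =>
      Subtype.ext (ρ.act_bracket (i := i) (j := j) (x := (x : L)) (y := (y : L)) hx hy (a : V)) }

/-- Schur's lemma: an even endomorphism of a simple module is zero or bijective. -/
theorem IsSimple.eq_zero_or_bijective {ρ : LieSuperModule L V} (h : ρ.IsSimple)
    {f : Module.End ℂ V} (hf : ∀ x a, f (ρ.act x a) = ρ.act x (f a))
    (hp : ∀ a, f (SuperSpace.parity V a) = SuperSpace.parity V (f a)) :
    f = 0 ∨ Function.Bijective f := by
  have hker := h.2 (LinearMap.ker f)
    (SuperSpace.isGraded_of_parity fun x hx => by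
      rw [LinearMap.mem_ker] at hx ⊢; rw [hp, hx, map_zero])
    (fun x a ha => by rw [LinearMap.mem_ker] at ha ⊢; rw [hf, ha, map_zero])
  have hran := h.2 (LinearMap.range f)
    (SuperSpace.isGraded_of_parity fun x hx => by
      obtain ⟨y, rfl⟩ := hx; exact ⟨_, hp y⟩)
    (fun x a ha => by obtain ⟨y, rfl⟩ := ha; exact ⟨_, hf x y⟩)
  rcases hker with hk | hk
  · rcases hran with hr | hr
    · left; exact LinearMap.range_eq_bot.1 hr
    · right; exact ⟨LinearMap.ker_eq_bot.1 hk, LinearMap.range_eq_top.1 hr⟩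
  · left; exact LinearMap.ker_eq_top.1 hk

theorem superSign_zero_left (j : ZMod 2) : superSign 0 j = 1 :=
  if_neg fun h => zero_ne_one h.1

theorem act_act_of_central (ρ : LieSuperModule L V) {z : L} (hz : z ∈ grade 0)
    (hz' : ∀ x, LieSuperalgebra.bracket z x = 0) (x : L) (a : V) :
    ρ.act z (ρ.act x a) = ρ.act x (ρ.act z a) := by
  have : ρ.act z ∘ₗ ρ.act.flip a = ρ.act.flip (ρ.act z a) := by
    refine SuperSpace.hom_ext fun i y hy => ?_
    have := ρ.act_bracket hz hy a
    rw [hz', map_zero, LinearMap.zero_apply, superSign_zero_left, one_smul] at this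
    exact sub_eq_zero.1 this.symm
  exact LinearMap.congr_fun this x

theorem act_parity_of_even (ρ : LieSuperModule L V) {z : L} (hz : z ∈ grade 0) (a : V) :
    ρ.act z (SuperSpace.parity V a) = SuperSpace.parity V (ρ.act z a) := by
  rw [ρ.act_parity_of_mem hz, SuperSpace.paritySign_zero, one_smul]

/-- An even central element acts on a simple module either as zero or invertibly. -/
theorem IsSimple.isUnit_act_of_central {ρ : LieSuperModule L V} (h : ρ.IsSimple) {z : L}
    (hz : z ∈ grade 0) (hz' : ∀ x, LieSuperalgebra.bracket z x = 0) (h0 : ρ.act z ≠ 0) :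
    IsUnit (ρ.act z : Module.End ℂ V) :=
  (Module.End.isUnit_iff _).2 ((h.eq_zero_or_bijective (ρ.act_act_of_central hz hz')
    (ρ.act_parity_of_even hz)).resolve_left h0)

theorem act_act_of_coe_central {S : LieSubSuperalgebra L} {B : Type w} [AddCommGroup B]
    [Module ℂ B] [SuperSpace B] (ρ : LieSuperModule S B) {z : S} (hz : (z : L) ∈ grade (V := L) 0)
    (hz' : ∀ x : L, LieSuperalgebra.bracket (z : L) x = 0) (x : S) (b : B) :
    ρ.act z (ρ.act x b) = ρ.act x (ρ.act z b) :=
  ρ.act_act_of_central (z := z) hz (fun y => Subtype.ext (hz' y)) x b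

theorem IsSimple.isUnit_act_of_coe_central {S : LieSubSuperalgebra L} {B : Type w}
    [AddCommGroup B] [Module ℂ B] [SuperSpace B] {ρ : LieSuperModule S B} (h : ρ.IsSimple)
    {z : S} (hz : (z : L) ∈ grade (V := L) 0)
    (hz' : ∀ x : L, LieSuperalgebra.bracket (z : L) x = 0) (h0 : ρ.act z ≠ 0) :
    IsUnit (ρ.act z : Module.End ℂ B) :=
  h.isUnit_act_of_central (z := z) hz (fun y => Subtype.ext (hz' y)) h0

end LieSuperModule

/-! ### Systems of oscillators and their vacuum vectors -/

/-- A family of (bosonic or fermionic) oscillators on `V`: annihilation operators `ann i` and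
creation operators `cre i` with `[ann i, cre j] = δ_{ij} weight i • cen`, where `cen` is an
invertible operator commuting with the creation operators. Supercommutators are encoded by the
signs `sign i j`, equal to `-1` if `i` and `j` are both fermionic; then the
relation `cre_cre` for `i = j` says that the square of a fermionic creation operator is zero.
The annihilation operators need not supercommute. -/
structure OscillatorSystem (ι : Type w) (V : Type v) [AddCommGroup V] [Module ℂ V] where
  ann : ι → Module.End ℂ V
  cre : ι → Module.End ℂ V
  cen : (Module.End ℂ V)ˣ
  sign : ι → ι → ℂ
  weight : ι → ℂ
  weight_ne_zero : ∀ i, weight i ≠ 0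
  sign_mul_self : ∀ i j, sign i j * sign i j = 1
  cen_cre : ∀ i, Commute (cen : Module.End ℂ V) (cre i)
  ann_cre_of_ne : ∀ i j, i ≠ j → ann i * cre j = sign i j • (cre j * ann i)
  ann_cre_self : ∀ i, ann i * cre i =
    sign i i • (cre i * ann i) + weight i • (cen : Module.End ℂ V)
  cre_cre : ∀ i j, cre i * cre j = sign i j • (cre j * cre i)

namespace OscillatorSystem

variable {ι : Type w} {V : Type v} [AddCommGroup V] [Module ℂ V] (O : OscillatorSystem ι V)

/-- The vacuum vectors: those killed by all annihilation operators. -/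
noncomputable def vacuum : Submodule ℂ V := ⨅ i, LinearMap.ker (O.ann i)

theorem mem_vacuum {x : V} : x ∈ O.vacuum ↔ ∀ i, O.ann i x = 0 := by
  simp [vacuum, Submodule.mem_iInf]

/-- The smallest subspace that contains `W` and is stable under the creation operators. -/
noncomputable def generated (W : Submodule ℂ V) : Submodule ℂ V :=
  sInf {p | W ≤ p ∧ ∀ i, ∀ x ∈ p, O.cre i x ∈ p}

theorem le_generated (W : Submodule ℂ V) : W ≤ O.generated W :=
  le_sInf fun _ hp => hp.1

theorem cre_mem_generated {W : Submodule ℂ V} (i : ι) {x : V} (hx : x ∈ O.generated W) :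
    O.cre i x ∈ O.generated W :=
  (Submodule.mem_sInf).2 fun p hp => hp.2 i x ((Submodule.mem_sInf).1 hx p hp)

theorem generated_le {W p : Submodule ℂ V} (h : W ≤ p) (h' : ∀ i, ∀ x ∈ p, O.cre i x ∈ p) :
    O.generated W ≤ p :=
  sInf_le ⟨h, h'⟩

/-- An operator `f` that preserves `W` also preserves `O.generated W`, if it can be moved past each
creation operator, up to a scalar factor and a multiple of `cen`. -/
theorem map_mem_generated {W : Submodule ℂ V} (hc : ∀ x ∈ W, (O.cen : Module.End ℂ V) x ∈ W)
    {f : Module.End ℂ V} (hf : ∀ x ∈ W, f x ∈ W)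
    (h : ∀ i, ∃ s t : ℂ, f * O.cre i = s • (O.cre i * f) + t • (O.cen : Module.End ℂ V))
    {x : V} (hx : x ∈ O.generated W) : f x ∈ O.generated W := by
  have hcen : O.generated W ≤ (O.generated W).comap (O.cen : Module.End ℂ V) := by
    have : O.generated W ≤ O.generated W ⊓ (O.generated W).comap (O.cen : Module.End ℂ V) := by
      refine O.generated_le (fun y hy => ⟨O.le_generated W hy, O.le_generated W (hc y hy)⟩) ?_
      rintro i y ⟨hy, hy'⟩
      refine ⟨O.cre_mem_generated i hy, ?_⟩
      have := LinearMap.congr_fun (O.cen_cre i).eq y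
      simp only [Module.End.mul_apply] at this
      rw [SetLike.mem_coe, Submodule.mem_comap, this]
      exact O.cre_mem_generated i hy'
    exact this.trans inf_le_right
  have : O.generated W ≤ O.generated W ⊓ (O.generated W).comap f := by
    refine O.generated_le (fun y hy => ⟨O.le_generated W hy, O.le_generated W (hf y hy)⟩) ?_
    rintro i y ⟨hy, hy'⟩
    refine ⟨O.cre_mem_generated i hy, ?_⟩
    obtain ⟨s, t, hst⟩ := h i
    have := LinearMap.congr_fun hst y
    simp only [Module.End.mul_apply, LinearMap.add_apply, LinearMap.smul_apply] at this
    rw [SetLike.mem_coe, Submodule.mem_comap, this]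
    exact Submodule.add_mem _ (Submodule.smul_mem _ _ (O.cre_mem_generated i hy'))
      (Submodule.smul_mem _ _ (hcen hy))
  exact (this hx).2

/-- The span of the vectors obtained from `W` by at most `k` creation operators with indices
in the finite set `S`. -/
noncomputable def layer (W : Submodule ℂ V) (S : Finset ι) : ℕ → Submodule ℂ V
  | 0 => W
  | k + 1 => layer W S k ⊔ ⨆ i : S, (layer W S k).map (O.cre i)

variable {O}

theorem layer_le_succ {W : Submodule ℂ V} {S : Finset ι} {k : ℕ} :
    O.layer W S k ≤ O.layer W S (k + 1) := le_sup_left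

theorem cre_mem_layer {W : Submodule ℂ V} {S : Finset ι} {k : ℕ} {i : ι} (hi : i ∈ S) {x : V}
    (hx : x ∈ O.layer W S k) : O.cre i x ∈ O.layer W S (k + 1) :=
  Submodule.mem_sup_right (Submodule.mem_iSup_of_mem ⟨i, hi⟩ ⟨x, hx, rfl⟩)

theorem layer_succ_le {W p : Submodule ℂ V} {S : Finset ι} {k : ℕ} (h : O.layer W S k ≤ p)
    (h' : ∀ i ∈ S, ∀ x ∈ O.layer W S k, O.cre i x ∈ p) : O.layer W S (k + 1) ≤ p :=
  sup_le h (iSup_le fun i => Submodule.map_le_iff_le_comap.2 fun x hx => h' i i.2 x hx)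

theorem layer_mono_right {W : Submodule ℂ V} {S : Finset ι} : Monotone (O.layer W S) :=
  monotone_nat_of_le_succ fun _ => layer_le_succ

theorem layer_mono_left {W : Submodule ℂ V} {S T : Finset ι} (h : S ⊆ T) (k : ℕ) :
    O.layer W S k ≤ O.layer W T k := by
  induction k with
  | zero => exact le_rfl
  | succ k ih =>
    exact layer_succ_le (ih.trans layer_le_succ) fun i hi x hx => cre_mem_layer (h hi) (ih hx)

theorem exists_mem_layer {W : Submodule ℂ V} {x : V} (hx : x ∈ O.generated W) :
    ∃ S k, x ∈ O.layer W S k := by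
  classical
  let p : Submodule ℂ V :=
    { carrier := {x | ∃ S k, x ∈ O.layer W S k}
      zero_mem' := ⟨∅, 0, Submodule.zero_mem _⟩
      add_mem' := by
        rintro x y ⟨S, k, hx⟩ ⟨T, l, hy⟩
        exact ⟨S ∪ T, max k l, Submodule.add_mem _
          (layer_mono_left Finset.subset_union_left _ (layer_mono_right (le_max_left k l) hx))
          (layer_mono_left Finset.subset_union_right _ (layer_mono_right (le_max_right k l) hy))⟩
      smul_mem' := by
        rintro c x ⟨S, k, hx⟩
        exact ⟨S, k, Submodule.smul_mem _ _ hx⟩ }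
  have : O.generated W ≤ p := O.generated_le (fun x hx => ⟨∅, 0, hx⟩) <| by
    rintro i x ⟨S, k, hx⟩
    exact ⟨insert i S, k + 1, cre_mem_layer (Finset.mem_insert_self i S)
      (layer_mono_left (Finset.subset_insert i S) k hx)⟩
  exact this hx

theorem cen_mem_layer {W : Submodule ℂ V} (hc : ∀ x ∈ W, (O.cen : Module.End ℂ V) x ∈ W)
    {S : Finset ι} {k : ℕ} : ∀ {x : V}, x ∈ O.layer W S k →
      (O.cen : Module.End ℂ V) x ∈ O.layer W S k := by
  induction k with
  | zero => exact fun {x} => hc x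
  | succ k ih =>
    suffices h : O.layer W S (k + 1) ≤ (O.layer W S (k + 1)).comap (O.cen : Module.End ℂ V) from
      fun {x} hx => h hx
    refine layer_succ_le (fun x hx => layer_le_succ (ih hx)) fun i hi x hx => ?_
    have := LinearMap.congr_fun (O.cen_cre i).eq x
    simp only [Module.End.mul_apply] at this
    rw [Submodule.mem_comap, this]
    exact cre_mem_layer hi (ih hx)

/-- Annihilation operators kill `W` and lower the layers over `W`. -/
theorem ann_mem_layer {W : Submodule ℂ V} (hW : W ≤ O.vacuum)
    (hc : ∀ x ∈ W, (O.cen : Module.End ℂ V) x ∈ W) {S : Finset ι} {k : ℕ} (i : ι) :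
    ∀ {x : V}, x ∈ O.layer W S (k + 1) → O.ann i x ∈ O.layer W S k := by
  have hW0 : ∀ x ∈ W, O.ann i x = 0 := fun x hx => O.mem_vacuum.1 (hW hx) i
  have key : ∀ k, (∀ x ∈ O.layer W S k, ∀ j ∈ S, O.cre j (O.ann i x) ∈ O.layer W S k) →
      (∀ x ∈ O.layer W S k, O.ann i x ∈ O.layer W S k) →
      O.layer W S (k + 1) ≤ (O.layer W S k).comap (O.ann i) := by
    intro k h1 h2
    refine layer_succ_le h2 fun j hj x hx => ?_
    rw [Submodule.mem_comap]
    by_cases hij : i = j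
    · subst hij
      have := LinearMap.congr_fun (O.ann_cre_self i) x
      simp only [Module.End.mul_apply, LinearMap.add_apply, LinearMap.smul_apply] at this
      rw [this]
      exact Submodule.add_mem _ (Submodule.smul_mem _ _ (h1 x hx i hj))
        (Submodule.smul_mem _ _ (cen_mem_layer hc hx))
    · have := LinearMap.congr_fun (O.ann_cre_of_ne i j hij) x
      simp only [Module.End.mul_apply, LinearMap.smul_apply] at this
      rw [this]
      exact Submodule.smul_mem _ _ (h1 x hx j hj)
  suffices h : O.layer W S (k + 1) ≤ (O.layer W S k).comap (O.ann i) from fun {x} hx => h hx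
  induction k with
  | zero =>
    refine key 0 (fun x hx j _ => ?_) (fun x hx => ?_)
    · rw [hW0 x hx, map_zero]; exact Submodule.zero_mem _
    · rw [hW0 x hx]; exact Submodule.zero_mem _
  | succ k ih =>
    exact key (k + 1) (fun x hx j hj => cre_mem_layer hj (ih hx))
      (fun x hx => layer_le_succ (ih hx))

/-- If vacuum vectors generate `V`, every nonzero subspace stable under the annihilation operators
contains a nonzero vacuum vector. -/
theorem exists_mem_vacuum {W : Submodule ℂ V} (hW : W ≤ O.vacuum)
    (hc : ∀ x ∈ W, (O.cen : Module.End ℂ V) x ∈ W) (hgen : O.generated W = ⊤)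
    {N : Submodule ℂ V} (hN : N ≠ ⊥) (hann : ∀ i, ∀ x ∈ N, O.ann i x ∈ N) :
    ∃ x ∈ N, x ∈ O.vacuum ∧ x ≠ 0 := by
  obtain ⟨y, hy, hy0⟩ := Submodule.exists_mem_ne_zero_of_ne_bot hN
  obtain ⟨S, k, hyk⟩ := exists_mem_layer (O := O) (W := W) (x := y) (by rw [hgen]; trivial)
  induction k generalizing y with
  | zero => exact ⟨y, hy, hW hyk, hy0⟩
  | succ k ih =>
    by_cases h : ∀ i, O.ann i y = 0
    · exact ⟨y, hy, O.mem_vacuum.2 h, hy0⟩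
    · obtain ⟨i, hi⟩ := not_forall.1 h
      exact ih (O.ann i y) (hann i y hy) hi (ann_mem_layer hW hc i hyk)

variable (O) in
/-- The number operator `∑_{i ∈ S} (weight i)⁻¹ cen⁻¹ cre i ann i` of the oscillators in `S`. -/
noncomputable def number (S : Finset ι) : Module.End ℂ V :=
  ∑ i ∈ S, (O.weight i)⁻¹ • ((↑O.cen⁻¹ : Module.End ℂ V) * (O.cre i * O.ann i))

theorem number_apply_of_mem_vacuum {S : Finset ι} {x : V} (hx : x ∈ O.vacuum) :
    O.number S x = 0 := by
  simp [number, LinearMap.sum_apply, O.mem_vacuum.1 hx]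

/-- The number operator counts creation operators. -/
theorem number_mul_cre {S : Finset ι} {i : ι} (hi : i ∈ S) :
    O.number S * O.cre i = O.cre i * O.number S + O.cre i := by
  classical
  have hcen : (↑O.cen⁻¹ : Module.End ℂ V) * O.cre i = O.cre i * ↑O.cen⁻¹ :=
    (O.cen_cre i).units_inv_left.eq
  have hterm : ∀ j, (O.weight j)⁻¹ • ((↑O.cen⁻¹ : Module.End ℂ V) * (O.cre j * O.ann j)) * O.cre i =
      O.cre i * ((O.weight j)⁻¹ • ((↑O.cen⁻¹ : Module.End ℂ V) * (O.cre j * O.ann j))) +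
        if j = i then O.cre i else 0 := by
    intro j
    have hswap : O.sign j i • (O.cre j * (O.cre i * O.ann j)) = O.cre i * (O.cre j * O.ann j) := by
      rw [← mul_assoc, O.cre_cre j i, smul_mul_assoc, smul_smul, O.sign_mul_self, one_smul,
        mul_assoc]
    have hcomm : O.cre i * ((↑O.cen⁻¹ : Module.End ℂ V) * (O.cre j * O.ann j)) =
        ↑O.cen⁻¹ * (O.cre i * (O.cre j * O.ann j)) := by
      rw [← mul_assoc, ← hcen, mul_assoc]
    rw [smul_mul_assoc, mul_smul_comm, hcomm, mul_assoc, mul_assoc]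
    by_cases hji : j = i
    · subst hji
      rw [if_pos rfl, O.ann_cre_self j, mul_add, mul_smul_comm, hswap, mul_add, smul_add,
        mul_smul_comm, mul_smul_comm, smul_smul, inv_mul_cancel₀ (O.weight_ne_zero j), one_smul,
        ← mul_assoc (↑O.cen⁻¹ : Module.End ℂ V) (O.cre j) (O.cen : Module.End ℂ V), hcen,
        mul_assoc (O.cre j), Units.inv_mul, mul_one]
    · rw [if_neg hji, add_zero, O.ann_cre_of_ne j i hji, mul_smul_comm, hswap]
  rw [number, Finset.sum_mul, Finset.mul_sum, Finset.sum_congr rfl fun j _ => hterm j,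
    Finset.sum_add_distrib, Finset.sum_ite_eq' S i, if_pos hi]

/-- On layer `k` the number operator is `k` modulo layer `k - 1`. -/
theorem number_sub_mem_layer {W : Submodule ℂ V} (hW : W ≤ O.vacuum) {S : Finset ι} {k : ℕ} :
    ∀ {x : V}, x ∈ O.layer W S (k + 1) →
      O.number S x - ((k + 1 : ℕ) : ℂ) • x ∈ O.layer W S k := by
  have key : ∀ k, (∀ x ∈ O.layer W S k, O.number S x ∈ O.layer W S k) →
      (∀ x ∈ O.layer W S k, ∀ i ∈ S, O.cre i (O.number S x - (k : ℂ) • x) ∈ O.layer W S k) →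
      O.layer W S (k + 1) ≤
        (O.layer W S k).comap (O.number S - ((k + 1 : ℕ) : ℂ) • LinearMap.id) := by
    intro k h1 h2
    refine layer_succ_le (fun x hx => ?_) fun i hi x hx => ?_
    · exact Submodule.sub_mem _ (h1 x hx) (Submodule.smul_mem _ _ hx)
    · have h := h2 x hx i hi
      have hn := LinearMap.congr_fun (number_mul_cre (O := O) hi) x
      simp only [Module.End.mul_apply, LinearMap.add_apply] at hn
      rw [Submodule.mem_comap, LinearMap.sub_apply, LinearMap.smul_apply, LinearMap.id_apply, hn]
      convert h using 1
      rw [map_sub, map_smul]; push_cast; rw [add_smul, one_smul]; abel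
  suffices h : O.layer W S (k + 1) ≤
      (O.layer W S k).comap (O.number S - ((k + 1 : ℕ) : ℂ) • LinearMap.id) from
    fun {x} hx => h hx
  induction k with
  | zero =>
    refine key 0 (fun x hx => ?_) (fun x hx i _ => ?_)
    · rw [number_apply_of_mem_vacuum (hW hx)]; exact Submodule.zero_mem _
    · rw [number_apply_of_mem_vacuum (hW hx)]; simp
  | succ k ih =>
    have ih' : ∀ x ∈ O.layer W S (k + 1),
        O.number S x - ((k + 1 : ℕ) : ℂ) • x ∈ O.layer W S k := fun x hx => ih hx
    refine key (k + 1) (fun x hx => ?_) (fun x hx i hi => cre_mem_layer hi (ih' x hx))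
    rw [← sub_add_cancel (O.number S x) (((k + 1 : ℕ) : ℂ) • x)]
    exact Submodule.add_mem _ (layer_le_succ (ih' x hx)) (Submodule.smul_mem _ _ hx)

/-- Creation operators yield no new vacuum vectors: the number operator kills vacuum vectors, but
is invertible on layer `k` modulo layer `k - 1` if `k ≠ 0`. -/
theorem mem_of_mem_vacuum_of_mem_generated {W : Submodule ℂ V} (hW : W ≤ O.vacuum) {x : V}
    (hx : x ∈ O.vacuum) (hgen : x ∈ O.generated W) : x ∈ W := by
  obtain ⟨S, k, hk⟩ := exists_mem_layer hgen
  induction k with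
  | zero => exact hk
  | succ k ih =>
    have h := number_sub_mem_layer hW hk
    rw [number_apply_of_mem_vacuum hx, zero_sub, Submodule.neg_mem_iff] at h
    exact ih ((Submodule.smul_mem_iff _ (by exact_mod_cast k.succ_ne_zero)).1 h)

end OscillatorSystem

/-! ### Oscillators in the Heisenberg-Clifford superalgebra -/

namespace HCIdx

/-- The label of the basis vector that pairs nontrivially with the one labelled `k`: the modes of
degrees `p` and `-p` are dual to each other. -/
def dual : HCIdx → HCIdx
  | H n => H (-n)
  | F n => F (-n - 1)
  | c => c

theorem dual_dual (k : HCIdx) : k.dual.dual = k := by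
  cases k <;> simp [dual]

theorem parity_dual (k : HCIdx) : k.dual.parity = k.parity := by
  cases k <;> rfl

/-- The labels of positive degree. -/
def pos : Set HCIdx := {k | 0 < k.twiceDeg}

theorem mem_pos {k : HCIdx} : k ∈ pos ↔ 0 < k.twiceDeg := Iff.rfl

theorem c_not_mem_pos : c ∉ pos := fun h => lt_irrefl _ (mem_pos.1 h)

theorem form_dual (l k : HCIdx) [Decidable (l = k)] :
    form l k.dual = if l = k then form k k.dual else 0 := by
  split_ifs with h
  · rw [h]
  · rcases l with m | m | _ <;> rcases k with n | n | _ <;> simp only [form, dual]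
    · exact if_neg fun h' => h (congrArg H (by omega))
    · exact if_neg fun h' => h (congrArg F (by omega))

theorem form_dual_ne_zero {k : HCIdx} (hk : k ∈ pos) : form k k.dual ≠ 0 := by
  rcases k with n | n | _
  · have : n ≠ 0 := by rintro rfl; exact lt_irrefl _ (mem_pos.1 hk)
    simpa [form, dual] using this
  · simp only [form, dual]
    rw [if_pos (by ring)]
    exact one_ne_zero
  · exact absurd hk c_not_mem_pos

theorem form_dual_dual {k l : HCIdx} (hk : k ∈ pos) (hl : l ∈ pos) : form k.dual l.dual = 0 := by
  rcases k with m | m | _ <;> rcases l with n | n | _ <;>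
    simp only [form, dual, pos, twiceDeg, Set.mem_ofPred_eq, ite_eq_right_iff] at * <;>
    intro _ <;> exfalso <;> omega

theorem form_c_left (k : HCIdx) : form c k = 0 := rfl

end HCIdx

namespace HC

open SuperSpace (paritySign)

variable {V : Type v} [AddCommGroup V] [Module ℂ V]

/-- The operators `A k` satisfy the relations of `𝔥𝔠` for the labels `k` in `T`. -/
def SatisfiesRelations (T : Set HCIdx) (A : HCIdx → Module.End ℂ V) : Prop :=
  ∀ k ∈ T, ∀ l ∈ T,
    A k * A l = superSign k.parity l.parity • (A l * A k) + HCIdx.form k l • A HCIdx.c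

theorem SatisfiesRelations.commute_c {T : Set HCIdx} {A : HCIdx → Module.End ℂ V}
    (h : SatisfiesRelations T A) (hc : HCIdx.c ∈ T) {k : HCIdx} (hk : k ∈ T) :
    Commute (A HCIdx.c) (A k) := by
  have := h _ hc k hk
  rwa [HCIdx.form_c_left, zero_smul, add_zero, show superSign HCIdx.c.parity k.parity = 1 from
    if_neg fun h => absurd h.1 (by decide), one_smul] at this

theorem e_mem_grade (k : HCIdx) : e k ∈ grade (V := HC) k.parity :=
  e_mem (T := {l | l.parity = k.parity}) rfl

theorem c₃_mem_grade : c₃ ∈ grade (V := HC) 0 := e_mem_grade .c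

theorem bracket_c₃ (x : HC) : LieSuperalgebra.bracket c₃ x = 0 :=
  (congrArg (· • c₃) (form_c_left x)).trans (zero_smul _ _)

theorem bracket_e (k l : HCIdx) :
    LieSuperalgebra.bracket (e k) (e l) = HCIdx.form k l • e HCIdx.c := by
  change form (e k) (e l) • c₃ = _
  rw [form_e]; rfl

theorem satisfiesRelations_act [SuperSpace V] (τ : LieSuperModule HC V) :
    SatisfiesRelations Set.univ (fun k => τ.act (e k)) := by
  intro k _ l _
  have h := τ.act_bracket (e_mem_grade k) (e_mem_grade l)
  ext a
  have ha := h a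
  rw [bracket_e, map_smul, LinearMap.smul_apply] at ha
  rw [LinearMap.add_apply, LinearMap.smul_apply, LinearMap.smul_apply, ha]
  simp only [Module.End.mul_apply]
  abel

/-- The oscillators with annihilation operators `A k`, `k ∈ I`, where `I` is a set of labels of
positive degree. -/
noncomputable def oscillators {T : Set HCIdx} {A : HCIdx → Module.End ℂ V}
    (hA : SatisfiesRelations T A) (hc : HCIdx.c ∈ T) (I : Set HCIdx) (hI : I ⊆ HCIdx.pos)
    (hIT : I ⊆ T) (hIT' : ∀ k ∈ I, k.dual ∈ T) (hu : IsUnit (A HCIdx.c)) :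
    OscillatorSystem I V where
  ann k := A k
  cre k := A (k : HCIdx).dual
  cen := hu.unit
  sign k l := superSign (k : HCIdx).parity (l : HCIdx).parity
  weight k := HCIdx.form k (k : HCIdx).dual
  weight_ne_zero k := HCIdx.form_dual_ne_zero (hI k.2)
  sign_mul_self _ _ := SuperSpace.superSign_mul_self _ _
  cen_cre k := hA.commute_c hc (hIT' k k.2)
  ann_cre_of_ne k l hkl := by
    classical
    have := hA k (hIT k.2) _ (hIT' l l.2)
    rwa [HCIdx.form_dual, if_neg (fun h => hkl (Subtype.ext h)), zero_smul, add_zero,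
      HCIdx.parity_dual] at this
  ann_cre_self k := by
    have := hA k (hIT k.2) _ (hIT' k k.2)
    rwa [HCIdx.parity_dual] at this
  cre_cre k l := by
    have := hA _ (hIT' k k.2) _ (hIT' l l.2)
    rwa [HCIdx.form_dual_dual (hI k.2) (hI l.2), zero_smul, add_zero, HCIdx.parity_dual,
      HCIdx.parity_dual] at this

section

variable {T : Set HCIdx} {A : HCIdx → Module.End ℂ V}
  {hA : SatisfiesRelations T A} {hc : HCIdx.c ∈ T} {I : Set HCIdx} {hI : I ⊆ HCIdx.pos}
  {hIT : I ⊆ T} {hIT' : ∀ k ∈ I, k.dual ∈ T} {hu : IsUnit (A HCIdx.c)}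

theorem mem_vacuum_oscillators {a : V} :
    a ∈ (oscillators hA hc I hI hIT hIT' hu).vacuum ↔ ∀ k ∈ I, A k a = 0 := by
  rw [OscillatorSystem.mem_vacuum]
  exact ⟨fun h k hk => h ⟨k, hk⟩, fun h k => h k k.2⟩

/-- If `W` consists of vacuum vectors and is stable under the operators that are neither creation
nor annihilation operators, then `W` generates a subspace stable under all operators. -/
theorem act_mem_generated {W : Submodule ℂ V}
    (hW : W ≤ (oscillators hA hc I hI hIT hIT' hu).vacuum)
    (hl : ∀ l ∈ T, l ∉ I → l.dual ∉ I → ∀ a ∈ W, A l a ∈ W) {l : HCIdx} (hlT : l ∈ T) {a : V}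
    (ha : a ∈ (oscillators hA hc I hI hIT hIT' hu).generated W) :
    A l a ∈ (oscillators hA hc I hI hIT hIT' hu).generated W := by
  classical
  by_cases hd : l.dual ∈ I
  · have := (oscillators hA hc I hI hIT hIT' hu).cre_mem_generated ⟨l.dual, hd⟩ ha
    change A l.dual.dual a ∈ _ at this
    rwa [HCIdx.dual_dual] at this
  · have hcI : HCIdx.c ∉ I := fun h => HCIdx.c_not_mem_pos (hI h)
    refine (oscillators hA hc I hI hIT hIT' hu).map_mem_generated (f := A l)
      (fun b hb => hl _ hc hcI hcI b hb) (fun b hb => ?_)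
      (fun k => ⟨superSign l.parity (k : HCIdx).parity,
        HCIdx.form l (k : HCIdx).dual, ?_⟩) ha
    · by_cases hlI : l ∈ I
      · rw [mem_vacuum_oscillators.1 (hW hb) l hlI]; exact W.zero_mem
      · exact hl l hlT hlI hd b hb
    · have := hA l hlT _ (hIT' k k.2)
      rwa [HCIdx.parity_dual] at this

/-- The space of vacuum vectors is stable under the operators that are neither creation nor
annihilation operators. -/
theorem act_mem_vacuum {l : HCIdx} (hlT : l ∈ T) (hd : l.dual ∉ I) {a : V}
    (ha : a ∈ (oscillators hA hc I hI hIT hIT' hu).vacuum) :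
    A l a ∈ (oscillators hA hc I hI hIT hIT' hu).vacuum := by
  classical
  rw [mem_vacuum_oscillators] at ha ⊢
  intro k hk
  have h := LinearMap.congr_fun (hA k (hIT hk) l hlT) a
  have h0 : HCIdx.form k l = 0 := by
    rw [← HCIdx.dual_dual l, HCIdx.form_dual, if_neg]
    rintro rfl; exact hd hk
  simpa [h0, ha k hk] using h

end

/-- A property of the basis vectors with labels in `T` extends to their span. -/
theorem act_mem_of_basis {T : Set HCIdx} {N N' : Submodule ℂ V} {f : HC →ₗ[ℂ] Module.End ℂ V}
    (h : ∀ k ∈ T, ∀ a ∈ N, f (e k) a ∈ N') {x : HC} (hx : x ∈ spanOf T) {a : V} (ha : a ∈ N) :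
    f x a ∈ N' := by
  rw [spanOf_eq] at hx
  induction hx using Submodule.span_induction with
  | mem x hx => obtain ⟨k, hk, rfl⟩ := hx; exact h k hk a ha
  | zero => simp
  | add x y _ _ hx hy => rw [map_add]; exact N'.add_mem hx hy
  | smul c x _ hx => rw [map_smul]; exact N'.smul_mem _ hx

theorem mem_spanOf_univ (x : HC) : x ∈ spanOf Set.univ := by
  simp [spanOf]

theorem parity_act_e [SuperSpace V] (τ : LieSuperModule HC V) (k : HCIdx) (a : V) :
    SuperSpace.parity V (τ.act (e k) a) =
      paritySign k.parity • τ.act (e k) (SuperSpace.parity V a) := by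
  rw [τ.act_parity_of_mem (e_mem_grade k), smul_smul,
    show paritySign k.parity * paritySign k.parity = 1 from SuperSpace.superSign_mul_self _ _,
    one_smul]

section

variable [SuperSpace V] (τ : LieSuperModule HC V)

/-- The oscillators with annihilation operators labelled by `I` in an `𝔥𝔠`-module. -/
noncomputable def moduleOscillators (I : Set HCIdx) (hI : I ⊆ HCIdx.pos)
    (hu : IsUnit (τ.act c₃ : Module.End ℂ V)) : OscillatorSystem I V :=
  oscillators (satisfiesRelations_act τ) trivial I hI (fun _ _ => trivial) (fun _ _ => trivial) hu

variable {τ} {I : Set HCIdx} {hI : I ⊆ HCIdx.pos} {hu : IsUnit (τ.act c₃ : Module.End ℂ V)}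

theorem mem_vacuum {a : V} :
    a ∈ (moduleOscillators τ I hI hu).vacuum ↔ ∀ k ∈ I, τ.act (e k) a = 0 :=
  mem_vacuum_oscillators

theorem isGraded_vacuum : SuperSpace.IsGraded (moduleOscillators τ I hI hu).vacuum := by
  refine SuperSpace.isGraded_of_parity fun a ha => ?_
  rw [mem_vacuum] at ha ⊢
  intro k hk
  rw [τ.act_parity_of_mem (e_mem_grade k), ha k hk, map_zero, smul_zero]

theorem isGraded_generated {W : Submodule ℂ V} (hW : SuperSpace.IsGraded W)
    (hc : ∀ a ∈ W, τ.act c₃ a ∈ W) :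
    SuperSpace.IsGraded ((moduleOscillators τ I hI hu).generated W) := by
  refine SuperSpace.isGraded_of_parity fun a ha => ?_
  refine (moduleOscillators τ I hI hu).map_mem_generated (f := SuperSpace.parity V) hc
    (fun b hb => hW.parity_mem hb) (fun k => ⟨paritySign (k : HCIdx).parity, 0, ?_⟩) ha
  rw [zero_smul, add_zero]
  refine LinearMap.ext fun b => ?_
  have := parity_act_e τ (k : HCIdx).dual b
  rwa [HCIdx.parity_dual] at this

theorem generated_eq_top (hτ : τ.IsSimple) {W : Submodule ℂ V} (hW : SuperSpace.IsGraded W)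
    (hW0 : W ≠ ⊥) (hWv : W ≤ (moduleOscillators τ I hI hu).vacuum)
    (hl : ∀ l, l ∉ I → l.dual ∉ I → ∀ a ∈ W, τ.act (e l) a ∈ W) :
    (moduleOscillators τ I hI hu).generated W = ⊤ := by
  have hcI : HCIdx.c ∉ I := fun h => HCIdx.c_not_mem_pos (hI h)
  refine (hτ.2 _ (isGraded_generated hW (hl _ hcI hcI)) fun x a ha => ?_).resolve_left fun h =>
    hW0 (le_bot_iff.1 (h ▸ OscillatorSystem.le_generated _ W))
  exact act_mem_of_basis (f := τ.act) (fun l _ b hb => act_mem_generated hWv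
    (fun l _ => hl l) trivial hb) (mem_spanOf_univ x) ha

/-- In a simple `𝔥𝔠`-module, the space of vacuum vectors is simple under the operators that are
neither creation nor annihilation operators. -/
theorem eq_bot_or_eq_vacuum (hτ : τ.IsSimple) {W : Submodule ℂ V} (hW : SuperSpace.IsGraded W)
    (hWv : W ≤ (moduleOscillators τ I hI hu).vacuum)
    (hl : ∀ l, l ∉ I → l.dual ∉ I → ∀ a ∈ W, τ.act (e l) a ∈ W) :
    W = ⊥ ∨ W = (moduleOscillators τ I hI hu).vacuum := by
  refine or_iff_not_imp_left.2 fun hW0 => le_antisymm hWv fun a ha => ?_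
  refine OscillatorSystem.mem_of_mem_vacuum_of_mem_generated hWv ha ?_
  rw [generated_eq_top hτ hW hW0 hWv hl]; trivial

end

theorem coe_fin_c₃_mem_grade (m : ℕ) : ((fin_c₃ m : fin m) : HC) ∈ grade (V := HC) 0 :=
  c₃_mem_grade

theorem bracket_coe_fin_c₃ (m : ℕ) (x : HC) :
    LieSuperalgebra.bracket ((fin_c₃ m : fin m) : HC) x = 0 :=
  bracket_c₃ x

theorem fin_c₃_act {m : ℕ} {B : Type w} [AddCommGroup B] [Module ℂ B] [SuperSpace B]
    (ρ : LieSuperModule (fin m) B) (x : fin m) (b : B) :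
    ρ.act (fin_c₃ m) (ρ.act x b) = ρ.act x (ρ.act (fin_c₃ m) b) :=
  ρ.act_act_of_coe_central (coe_fin_c₃_mem_grade m) (bracket_coe_fin_c₃ m) x b

theorem isUnit_fin_c₃ {m : ℕ} {B : Type w} [AddCommGroup B] [Module ℂ B] [SuperSpace B]
    {ρ : LieSuperModule (fin m) B} (h : ρ.IsSimple) (h0 : ρ.act (fin_c₃ m) ≠ 0) :
    IsUnit (ρ.act (fin_c₃ m) : Module.End ℂ B) :=
  h.isUnit_act_of_coe_central (coe_fin_c₃_mem_grade m) (bracket_coe_fin_c₃ m) h0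

/-- The relations for basis vectors imply those for all homogeneous elements. -/
theorem SatisfiesRelations.mul_eq {T : Set HCIdx} {f : HC →ₗ[ℂ] Module.End ℂ V}
    (h : SatisfiesRelations T fun k => f (e k)) {i j : ZMod 2} {x y : HC}
    (hxT : x ∈ spanOf T) (hyT : y ∈ spanOf T) (hx : x ∈ grade (V := HC) i)
    (hy : y ∈ grade (V := HC) j) :
    f x * f y = superSign i j • (f y * f x) + f (LieSuperalgebra.bracket x y) := by
  have hx' : x ∈ spanOf (T ∩ {k | k.parity = i}) := by
    rw [spanOf, Finsupp.supported_inter]; exact ⟨hxT, hx⟩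
  have hy' : y ∈ spanOf (T ∩ {k | k.parity = j}) := by
    rw [spanOf, Finsupp.supported_inter]; exact ⟨hyT, hy⟩
  let μ := LinearMap.mul ℂ (Module.End ℂ V)
  refine bilin_ext (μ.compl₁₂ f f)
    (superSign i j • (μ.flip.compl₁₂ f f) + bracket.compr₂ f) ?_ hx' hy'
  rintro k ⟨hk, rfl⟩ l ⟨hl, rfl⟩
  have hb : f (bracket (e k) (e l)) = HCIdx.form k l • f (e .c) :=
    (congrArg f (bracket_e k l)).trans (map_smul _ _ _)
  have := h k hk l hl
  rw [← hb] at this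
  exact this

end HC

/-! ### Induced modules: universal property and vacuum vectors -/

theorem SuperEnveloping.adjoin_range_ι (L : Type v) [AddCommGroup L] [Module ℂ L]
    [LieSuperalgebra L] :
    Algebra.adjoin ℂ (Set.range (SuperEnveloping.ι L)) = ⊤ := by
  let S := Algebra.adjoin ℂ (Set.range (SuperEnveloping.ι L))
  let f : L →ₗ[ℂ] S := (SuperEnveloping.ι L).codRestrict (Subalgebra.toSubmodule S)
    fun x => Algebra.subset_adjoin ⟨x, rfl⟩
  have hf : ∀ {i j : ZMod 2} {x y : L}, x ∈ grade i → y ∈ grade j →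
      f x * f y = superSign i j • (f y * f x) + f (LieSuperalgebra.bracket x y) :=
    fun hx hy => Subtype.ext (SuperEnveloping.ι_mul_ι hx hy)
  have : S.val.comp (SuperEnveloping.lift f hf) = AlgHom.id ℂ _ :=
    SuperEnveloping.hom_ext fun x => congrArg Subtype.val (SuperEnveloping.lift_ι f hf x)
  refine eq_top_iff.2 fun z _ => ?_
  rw [← AlgHom.id_apply (R := ℂ) z, ← this]
  exact (SuperEnveloping.lift f hf z).2

namespace LieSuperModule

variable {L : Type u} [AddCommGroup L] [Module ℂ L] [LieSuperalgebra L]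

theorem act_mul_act {V : Type v} [AddCommGroup V] [Module ℂ V] [SuperSpace V]
    (τ : LieSuperModule L V) {i j : ZMod 2} {x y : L} (hx : x ∈ grade i) (hy : y ∈ grade j) :
    (τ.act x * τ.act y : Module.End ℂ V) =
      superSign i j • (τ.act y * τ.act x : Module.End ℂ V) +
        τ.act (LieSuperalgebra.bracket x y) := by
  refine LinearMap.ext fun a => ?_
  rw [LinearMap.add_apply, τ.act_bracket hx hy a]
  exact (add_sub_cancel _ _).symm

theorem act_mul_act_of_coe {S : LieSubSuperalgebra L} {B : Type v} [AddCommGroup B] [Module ℂ B]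
    [SuperSpace B] (ρ : LieSuperModule S B) {i j : ZMod 2} {x y z : S}
    (hx : (x : L) ∈ grade (V := L) i) (hy : (y : L) ∈ grade (V := L) j)
    (hz : LieSuperalgebra.bracket (x : L) (y : L) = (z : L)) :
    (ρ.act x * ρ.act y : Module.End ℂ B) =
      superSign i j • (ρ.act y * ρ.act x : Module.End ℂ B) + ρ.act z := by
  rw [ρ.act_mul_act (x := x) (y := y) hx hy,
    show LieSuperalgebra.bracket x y = z from Subtype.ext hz]

variable {S : LieSubSuperalgebra L} {B : Type v} [AddCommGroup B] [Module ℂ B] [SuperSpace B]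
  (ρ : LieSuperModule S B) {M : Type w} [AddCommGroup M] [Module ℂ M]

/-- The canonical map `b ↦ 1 ⊗ b` from `B` to the induced module. -/
noncomputable def indOne : B →ₗ[ℂ] Ind ρ := indMk ρ ∘ₗ TensorProduct.mk ℂ (SuperEnveloping L) B 1

theorem parity_ind : SuperSpace.parity (Ind ρ) = indParity ρ :=
  SuperSpace.parity_eq_of_grade_eq_eigen fun _ => rfl

theorem parity_indOne (b : B) :
    SuperSpace.parity (Ind ρ) (indOne ρ b) = indOne ρ (SuperSpace.parity B b) := by
  rw [parity_ind]
  change indMk ρ (SuperEnveloping.parity L 1 ⊗ₜ SuperSpace.parity B b) = _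
  rw [map_one]; rfl

theorem ind_act_indOne (s : S) (b : B) : ρ.ind.act (s : L) (indOne ρ b) = indOne ρ (ρ.act s b) := by
  change indMk ρ ((SuperEnveloping.ι L (s : L) * 1) ⊗ₜ b) = indMk ρ (1 ⊗ₜ ρ.act s b)
  rw [mul_one, ← sub_eq_zero, ← map_sub]
  refine (Submodule.Quotient.mk_eq_zero _).2 (Submodule.subset_span ⟨1, s, b, ?_⟩)
  rw [one_mul]

variable {ρ} in
/-- The induced module is generated by the vectors `1 ⊗ b`. -/
theorem ind_eq_top {N : Submodule ℂ (Ind ρ)} (h1 : ∀ b, indOne ρ b ∈ N)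
    (h : ∀ x, ∀ t ∈ N, ρ.ind.act x t ∈ N) : N = ⊤ := by
  let A : Subalgebra ℂ (SuperEnveloping L) :=
    { carrier := {z | ∀ t ∈ N, indMul ρ z t ∈ N}
      mul_mem' := fun {y z} hy hz t ht => by
        rw [indMul_mul]; exact hy _ (hz t ht)
      add_mem' := fun {y z} hy hz t ht => by
        rw [indMul_add]; exact N.add_mem (hy t ht) (hz t ht)
      algebraMap_mem' := fun c t ht => by
        have h1 : indMul ρ 1 = LinearMap.id := ind_ext ρ fun z b => by rw [indMul_mk, one_mul]; rfl
        rw [Algebra.algebraMap_eq_smul_one, indMul_smul, h1]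
        exact N.smul_mem c ht }
  have hA : A = ⊤ := by
    rw [eq_top_iff, ← SuperEnveloping.adjoin_range_ι L]
    refine Algebra.adjoin_le ?_
    rintro _ ⟨x, rfl⟩
    exact h x
  rw [Submodule.eq_top_iff']
  intro t
  obtain ⟨t, rfl⟩ := indMk_surjective ρ t
  induction t using TensorProduct.induction_on with
  | zero => rw [map_zero]; exact N.zero_mem
  | add x y hx hy => rw [map_add]; exact N.add_mem hx hy
  | tmul z b =>
    have hz : z ∈ A := by rw [hA]; trivial
    have := hz _ (h1 b)
    change indMk ρ ((z * 1) ⊗ₜ b) ∈ N at this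
    rwa [mul_one] at this

/-- Linear maps out of the induced module that are compatible with the action of `L` agree if they
agree on the vectors `1 ⊗ b`. -/
theorem indHom_ext {f : L → Module.End ℂ M} {g g' : Ind ρ →ₗ[ℂ] M}
    (h1 : ∀ b, g (indOne ρ b) = g' (indOne ρ b))
    (hg : ∀ x t, g (ρ.ind.act x t) = f x (g t)) (hg' : ∀ x t, g' (ρ.ind.act x t) = f x (g' t)) :
    g = g' := by
  have := ind_eq_top (N := LinearMap.eqLocus g g') h1 fun x t ht => by
    rw [LinearMap.mem_eqLocus] at ht ⊢; rw [hg, hg', ht]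
  exact LinearMap.eqLocus_eq_top.1 this

section Lift

variable (f : L →ₗ[ℂ] Module.End ℂ M)
  (hf : ∀ {i j : ZMod 2} {x y : L}, x ∈ grade i → y ∈ grade j →
    f x * f y = superSign i j • (f y * f x) + f (LieSuperalgebra.bracket x y))
  (j : B →ₗ[ℂ] M) (hj : ∀ (s : S) (b : B), j (ρ.act s b) = f (s : L) (j b))

/-- The universal property of the induced module: an `S`-linear map `j` from `B` to a space `M`
on which `L` acts by `f` extends to the induced module. -/
noncomputable def indLift : Ind ρ →ₗ[ℂ] M :=
  (indRel ρ).liftQ (TensorProduct.lift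
    ((SuperEnveloping.lift f hf).toLinearMap.compl₂ j : SuperEnveloping L →ₗ[ℂ] B →ₗ[ℂ] M)) <| by
    rw [indRel, Submodule.span_le]
    rintro _ ⟨z, s, b, rfl⟩
    rw [SetLike.mem_coe, LinearMap.mem_ker, map_sub, TensorProduct.lift.tmul,
      TensorProduct.lift.tmul, sub_eq_zero]
    change SuperEnveloping.lift f hf (z * _) (j b) = SuperEnveloping.lift f hf z (j _)
    rw [map_mul, SuperEnveloping.lift_ι, hj]; rfl

theorem indLift_indOne (b : B) : indLift ρ f hf j hj (indOne ρ b) = j b := by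
  change SuperEnveloping.lift f hf 1 (j b) = j b
  rw [map_one]; rfl

theorem indLift_act (x : L) (t : Ind ρ) :
    indLift ρ f hf j hj (ρ.ind.act x t) = f x (indLift ρ f hf j hj t) := by
  have : indLift ρ f hf j hj ∘ₗ ρ.ind.act x = f x ∘ₗ indLift ρ f hf j hj := by
    refine ind_ext ρ fun z b => ?_
    change SuperEnveloping.lift f hf (SuperEnveloping.ι L x * z) (j b) =
      f x (SuperEnveloping.lift f hf z (j b))
    rw [map_mul, SuperEnveloping.lift_ι]; rfl
  exact LinearMap.congr_fun this t

end Lift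

section Hom

variable {V : Type w} [AddCommGroup V] [Module ℂ V] [SuperSpace V] (τ : LieSuperModule L V)
  (j : B →ₗ[ℂ] V) (hj : ∀ (s : S) (b : B), j (ρ.act s b) = τ.act (s : L) (j b))

/-- The homomorphism from an induced module to `V` that extends an `S`-linear map `B → V`. -/
noncomputable def indHom : Ind ρ →ₗ[ℂ] V := indLift ρ τ.act τ.act_mul_act j hj

theorem indHom_indOne (b : B) : indHom ρ τ j hj (indOne ρ b) = j b := indLift_indOne ..

theorem indHom_act (x : L) (t : Ind ρ) :
    indHom ρ τ j hj (ρ.ind.act x t) = τ.act x (indHom ρ τ j hj t) := indLift_act ..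

theorem indHom_parity (hp : ∀ b, j (SuperSpace.parity B b) = SuperSpace.parity V (j b))
    (t : Ind ρ) : indHom ρ τ j hj (SuperSpace.parity (Ind ρ) t) =
      SuperSpace.parity V (indHom ρ τ j hj t) := by
  let g := indHom ρ τ j hj
  have hpp : SuperSpace.parity V ∘ₗ g ∘ₗ SuperSpace.parity (Ind ρ) = g := by
    have hsign : ∀ i : ZMod 2, SuperSpace.paritySign i * SuperSpace.paritySign i = 1 :=
      fun i => SuperSpace.superSign_mul_self i 1
    have hact : ∀ x t, g (ρ.ind.act x t) = τ.act x (g t) := indHom_act ρ τ j hj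
    refine indHom_ext ρ (f := τ.act) (fun b => ?_) (fun x t => ?_) hact
    · simp only [LinearMap.comp_apply, parity_indOne]
      rw [show g (indOne ρ (SuperSpace.parity B b)) = j (SuperSpace.parity B b) from
        indHom_indOne ρ τ j hj _, hp, SuperSpace.parity_parity_apply]
      exact (indHom_indOne ρ τ j hj b).symm
    · have : SuperSpace.parity V ∘ₗ g ∘ₗ SuperSpace.parity (Ind ρ) ∘ₗ ρ.ind.act.flip t =
          τ.act.flip ((SuperSpace.parity V ∘ₗ g ∘ₗ SuperSpace.parity (Ind ρ)) t) := by
        refine SuperSpace.hom_ext fun i x hx => ?_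
        simp only [LinearMap.comp_apply, LinearMap.flip_apply]
        rw [τ.act_parity_of_mem hx, ← hact, ρ.ind.act_parity_of_mem hx, map_smul, map_smul,
          smul_smul, hsign, one_smul]
      exact LinearMap.congr_fun this x
  have := LinearMap.congr_fun hpp t
  simp only [LinearMap.comp_apply] at this
  change g _ = SuperSpace.parity V (g t)
  rw [← this, SuperSpace.parity_parity_apply]

end Hom

end LieSuperModule

namespace HC

open LieSuperModule

/-- The labels of positive degree that do not belong to `𝔥𝔠_{[m]}`: those of `H_i` with `i > m`
and of `F_{j+1/2}` with `j ≥ m`. -/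
def outerIdx (m : ℕ) : Set HCIdx := HCIdx.pos \ finIdx m

theorem outerIdx_subset_pos (m : ℕ) : outerIdx m ⊆ HCIdx.pos := Set.sdiff_subset

theorem mem_finIdx {m : ℕ} {k : HCIdx} (h : k ∉ outerIdx m) (h' : k.dual ∉ outerIdx m) :
    k ∈ finIdx m := by
  rcases k with n | n | _ <;>
    simp only [outerIdx, finIdx, HCIdx.dual, HCIdx.pos, HCIdx.twiceDeg, Set.mem_sdiff,
      Set.mem_ofPred_eq] at * <;> omega

theorem finIdx_subset_geIdx (m : ℕ) : finIdx m ⊆ geIdx (-m) := by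
  rintro (n | n | _) h
  · exact h.1
  · exact h.1
  · trivial

theorem mem_geIdx_of_mem_outerIdx {m : ℕ} {k : HCIdx} (h : k ∈ outerIdx m) : k ∈ geIdx (-m) := by
  rcases k with n | n | _ <;>
    simp only [outerIdx, finIdx, geIdx, HCIdx.pos, HCIdx.twiceDeg, Set.mem_sdiff,
      Set.mem_ofPred_eq] at * <;> omega

theorem mem_outerIdx_of_mem_geIdx {m : ℕ} {k : HCIdx} (h : k ∈ geIdx (-m)) (h' : k ∉ finIdx m) :
    k ∈ outerIdx m := by
  refine ⟨?_, h'⟩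
  rcases k with n | n | _
  · simp only [finIdx, geIdx, HCIdx.pos, HCIdx.twiceDeg, Set.mem_ofPred_eq] at *; omega
  · simp only [finIdx, geIdx, HCIdx.pos, HCIdx.twiceDeg, Set.mem_ofPred_eq] at *; omega
  · exact absurd trivial h'

theorem truncLin_coe {m : ℕ} (x : fin m) : truncLin m (x : HC) = x := by
  classical
  refine Subtype.ext (Finsupp.ext fun k => ?_)
  change Finsupp.filter (· ∈ finIdx m) (x : HC) k = _
  rw [Finsupp.filter_apply, ite_eq_left_iff]
  intro hk
  by_contra h
  exact hk (x.2 (Finsupp.mem_support_iff.2 fun h' => h h'.symm))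

variable {m : ℕ} {B : Type v} [AddCommGroup B] [Module ℂ B] [SuperSpace B]
  (ρ : LieSuperModule (fin m) B)

/-- The canonical map `b ↦ 1 ⊗ b` from `B` to `Ind B`. -/
noncomputable abbrev indModuleOne : B →ₗ[ℂ] Ind (ρ.pullback (trunc m)) :=
  indOne (ρ.pullback (trunc m))

theorem act_indModuleOne {x : HC} (hx : x ∈ spanOf (geIdx (-m))) (b : B) :
    (indModule m ρ).act x (indModuleOne ρ b) = indModuleOne ρ (ρ.act (truncLin m x) b) :=
  ind_act_indOne (ρ.pullback (trunc m)) ⟨x, hx⟩ b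

theorem act_indModuleOne_fin (x : fin m) (b : B) :
    (indModule m ρ).act (x : HC) (indModuleOne ρ b) = indModuleOne ρ (ρ.act x b) := by
  have hx : (x : HC) ∈ spanOf (geIdx (-m)) :=
    Finsupp.supported_mono (finIdx_subset_geIdx m) x.2
  rw [act_indModuleOne ρ hx, truncLin_coe]

theorem act_indModuleOne_outer {k : HCIdx} (hk : k ∈ outerIdx m) (b : B) :
    (indModule m ρ).act (e k) (indModuleOne ρ b) = 0 := by
  rw [act_indModuleOne ρ (e_mem (mem_geIdx_of_mem_outerIdx hk)),
    show truncLin m (e k) = 0 from Subtype.ext (truncLin_of_not_mem hk.2)]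
  simp

/-- If `c₃` acts bijectively on `B`, then also on the module induced from `B`. -/
theorem isUnit_indModule_act_c₃ (hu : IsUnit (ρ.act (fin_c₃ m) : Module.End ℂ B)) :
    IsUnit ((indModule m ρ).act c₃ : Module.End ℂ (Ind (ρ.pullback (trunc m)))) := by
  let I := indModule m ρ
  let d : B →ₗ[ℂ] B := (↑hu.unit⁻¹ : Module.End ℂ B)
  have hcd : ∀ b, ρ.act (fin_c₃ m) (d b) = b := fun b =>
    LinearMap.congr_fun hu.mul_val_inv b
  have hdc : ∀ b, d (ρ.act (fin_c₃ m) b) = b := fun b =>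
    LinearMap.congr_fun hu.val_inv_mul b
  have hone : ∀ b, I.act c₃ (indModuleOne ρ b) = indModuleOne ρ (ρ.act (fin_c₃ m) b) :=
    act_indModuleOne_fin ρ (fin_c₃ m)
  have hcen : ∀ (s : ge (-m)) b, ρ.act (fin_c₃ m) ((ρ.pullback (trunc m)).act s b) =
      (ρ.pullback (trunc m)).act s (ρ.act (fin_c₃ m) b) := fun s b =>
    fin_c₃_act ρ ((trunc m).toLinearMap s) b
  have hj : ∀ (s : ge (-m)) b, (indModuleOne ρ ∘ₗ d) ((ρ.pullback (trunc m)).act s b) =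
      I.act (s : HC) ((indModuleOne ρ ∘ₗ d) b) := by
    intro s b
    simp only [LinearMap.comp_apply]
    refine Eq.trans ?_ (ind_act_indOne (ρ.pullback (trunc m)) s (d b)).symm
    conv_lhs => rw [← hcd b, ← hcen, hdc]
  let g := indHom (ρ.pullback (trunc m)) I (indModuleOne ρ ∘ₗ d) hj
  have hg1 : ∀ b, g (indModuleOne ρ b) = indModuleOne ρ (d b) := indHom_indOne _ I _ hj
  have hg : ∀ x t, g (I.act x t) = I.act x (g t) := indHom_act _ I _ hj
  refine (Module.End.isUnit_iff _).2 (Function.bijective_iff_has_inverse.2 ⟨g, ?_, ?_⟩)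
  · refine LinearMap.congr_fun (f := g ∘ₗ I.act c₃) (g := LinearMap.id)
      (indHom_ext _ (f := I.act) (fun b => ?_) (fun x t => ?_) fun _ _ => rfl)
    · rw [LinearMap.comp_apply, hone, hg1, hdc]; rfl
    · change g (I.act c₃ (I.act x t)) = I.act x (g (I.act c₃ t))
      rw [I.act_act_of_central c₃_mem_grade bracket_c₃, hg]
  · refine LinearMap.congr_fun (f := I.act c₃ ∘ₗ g) (g := LinearMap.id)
      (indHom_ext _ (f := I.act) (fun b => ?_) (fun x t => ?_) fun _ _ => rfl)
    · rw [LinearMap.comp_apply, hg1, hone, hcd]; rfl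
    · change I.act c₃ (g (I.act x t)) = I.act x (I.act c₃ (g t))
      rw [hg, I.act_act_of_central c₃_mem_grade bracket_c₃]

variable {ρ}

theorem range_indModuleOne_le_vacuum
    {hu : IsUnit ((indModule m ρ).act c₃ : Module.End ℂ (Ind (ρ.pullback (trunc m))))} :
    LinearMap.range (indModuleOne ρ) ≤
      (moduleOscillators (indModule m ρ) (outerIdx m) (outerIdx_subset_pos m) hu).vacuum := by
  rintro _ ⟨b, rfl⟩
  exact mem_vacuum.2 fun k hk => act_indModuleOne_outer ρ hk b

theorem generated_range_indModuleOne
    {hu : IsUnit ((indModule m ρ).act c₃ : Module.End ℂ (Ind (ρ.pullback (trunc m))))} :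
    (moduleOscillators (indModule m ρ) (outerIdx m) (outerIdx_subset_pos m) hu).generated
      (LinearMap.range (indModuleOne ρ)) = ⊤ := by
  refine ind_eq_top (fun b => OscillatorSystem.le_generated _ _ ⟨b, rfl⟩) fun x t ht => ?_
  refine act_mem_of_basis (f := (indModule m ρ).act) (fun l _ b hb =>
    act_mem_generated range_indModuleOne_le_vacuum ?_ trivial hb) (mem_spanOf_univ x) ht
  rintro l - h h' _ ⟨b, rfl⟩
  exact ⟨_, (act_indModuleOne ρ (e_mem (finIdx_subset_geIdx m (mem_finIdx h h'))) b).symm⟩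

/-- The vacuum vectors of the induced module are the vectors `1 ⊗ b`. -/
theorem vacuum_indModule
    {hu : IsUnit ((indModule m ρ).act c₃ : Module.End ℂ (Ind (ρ.pullback (trunc m))))} :
    (moduleOscillators (indModule m ρ) (outerIdx m) (outerIdx_subset_pos m) hu).vacuum =
      LinearMap.range (indModuleOne ρ) := by
  refine le_antisymm (fun t ht => ?_) range_indModuleOne_le_vacuum
  refine OscillatorSystem.mem_of_mem_vacuum_of_mem_generated range_indModuleOne_le_vacuum ht ?_
  rw [generated_range_indModuleOne]; trivial

end HC

/-! ### Fock spaces -/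

/-- The fermionic Fock space with modes labelled by `J`: the exterior algebra of the free space on
`J`. -/
abbrev Fock (J : Type u) : Type u := ExteriorAlgebra ℂ (J →₀ ℂ)

namespace Fock

variable {J : Type u}

/-- The creation operator of the mode `j`: multiplication by the generator with label `j`. -/
noncomputable def cre (j : J) : Module.End ℂ (Fock J) :=
  LinearMap.mulLeft ℂ (ExteriorAlgebra.ι ℂ (Finsupp.single j 1))

/-- The annihilation operator of the mode `j`: contraction with the coordinate form of `j`. -/
noncomputable def ann (j : J) : Module.End ℂ (Fock J) :=
  CliffordAlgebra.contractLeft (Q := (0 : QuadraticForm ℂ (J →₀ ℂ))) (Finsupp.lapply j)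

/-- The parity involution, which is `-1` on the generators. -/
noncomputable def invol (J : Type u) : Module.End ℂ (Fock J) :=
  (CliffordAlgebra.involute (Q := (0 : QuadraticForm ℂ (J →₀ ℂ)))).toLinearMap

theorem cre_apply (j : J) (x : Fock J) :
    cre j x = ExteriorAlgebra.ι ℂ (Finsupp.single j 1) * x := rfl

theorem ann_one (j : J) : ann j (1 : Fock J) = 0 := CliffordAlgebra.contractLeft_one ..

theorem ann_ι_mul (j : J) (v : J →₀ ℂ) (x : Fock J) :
    ann j (ExteriorAlgebra.ι ℂ v * x) = v j • x - ExteriorAlgebra.ι ℂ v * ann j x :=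
  CliffordAlgebra.contractLeft_ι_mul ..

theorem invol_one : invol J 1 = 1 := map_one CliffordAlgebra.involute

theorem invol_ι_mul (v : J →₀ ℂ) (x : Fock J) :
    invol J (ExteriorAlgebra.ι ℂ v * x) = -(ExteriorAlgebra.ι ℂ v * invol J x) := by
  change CliffordAlgebra.involute (_ * _) = -(_ * CliffordAlgebra.involute x)
  rw [map_mul, ← neg_mul]
  exact congrArg (· * _) (CliffordAlgebra.involute_ι v)

/-- Induction on the number of generators multiplied to the vacuum vector. -/
theorem induction {P : Fock J → Prop} (one : P 1) (smul : ∀ (c : ℂ) x, P x → P (c • x))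
    (add : ∀ x y, P x → P y → P (x + y))
    (ι_mul : ∀ v x, P x → P (ExteriorAlgebra.ι ℂ v * x)) (x : Fock J) : P x := by
  induction x using CliffordAlgebra.left_induction with
  | algebraMap r => rw [Algebra.algebraMap_eq_smul_one]; exact smul r 1 one
  | add x y hx hy => exact add x y hx hy
  | ι_mul x m hx => exact ι_mul m x hx

theorem cre_mul_cre (i j : J) : cre i * cre j = -(cre j * cre i) := by
  refine LinearMap.ext fun x => ?_
  change ExteriorAlgebra.ι ℂ _ * (ExteriorAlgebra.ι ℂ _ * x) =
    -(ExteriorAlgebra.ι ℂ _ * (ExteriorAlgebra.ι ℂ _ * x))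
  rw [← mul_assoc, ← mul_assoc, ← neg_mul]
  refine congrArg (· * x) (eq_neg_of_add_eq_zero_left ?_)
  exact ExteriorAlgebra.ι_add_mul_swap _ _

theorem ann_mul_ann (i j : J) : ann i * ann j = -(ann j * ann i) :=
  LinearMap.ext fun _ => CliffordAlgebra.contractLeft_comm ..

theorem ann_mul_cre [DecidableEq J] (i j : J) :
    ann i * cre j = (if i = j then 1 else 0 : ℂ) • 1 - cre j * ann i := by
  refine LinearMap.ext fun x => ?_
  change ann i (_ * x) = _
  rw [ann_ι_mul, Finsupp.single_apply]
  simp only [eq_comm (a := j)]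
  rfl

theorem invol_mul_invol : invol J * invol J = 1 :=
  LinearMap.ext fun x => CliffordAlgebra.involute_involute x

theorem invol_mul_cre (j : J) : invol J * cre j = -(cre j * invol J) :=
  LinearMap.ext fun x => invol_ι_mul _ x

theorem invol_mul_ann (j : J) : invol J * ann j = -(ann j * invol J) := by
  refine LinearMap.ext fun x => ?_
  change invol J (ann j x) = -(ann j (invol J x))
  induction x using Fock.induction with
  | one => rw [ann_one, invol_one, ann_one, map_zero, neg_zero]
  | smul c x hx => rw [map_smul, map_smul, map_smul, map_smul, hx, smul_neg]
  | add x y hx hy => rw [map_add, map_add, map_add, map_add, hx, hy, neg_add]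
  | ι_mul v x hx =>
    rw [ann_ι_mul, map_sub, map_smul, invol_ι_mul, invol_ι_mul, hx, map_neg, ann_ι_mul]
    simp

theorem eventually_ann_eq_zero (x : Fock J) : ∃ S : Finset J, ∀ j ∉ S, ann j x = 0 := by
  classical
  induction x using Fock.induction with
  | one => exact ⟨∅, fun j _ => ann_one j⟩
  | smul c x hx =>
    obtain ⟨S, hS⟩ := hx
    exact ⟨S, fun j hj => by rw [map_smul, hS j hj, smul_zero]⟩
  | add x y hx hy =>
    obtain ⟨S, hS⟩ := hx
    obtain ⟨T, hT⟩ := hy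
    refine ⟨S ∪ T, fun j hj => ?_⟩
    rw [Finset.mem_union, not_or] at hj
    rw [map_add, hS j hj.1, hT j hj.2, add_zero]
  | ι_mul v x hx =>
    obtain ⟨S, hS⟩ := hx
    refine ⟨S ∪ v.support, fun j hj => ?_⟩
    rw [Finset.mem_union, not_or] at hj
    rw [ann_ι_mul, hS j hj.1, Finsupp.notMem_support_iff.1 hj.2, zero_smul, mul_zero, sub_zero]

end Fock

namespace HC

open Fock LieSuperModule

/-- Multiplication by `x_i` on `ℂ[x_j, j ∈ ℤ]`, the bosonic Fock space. -/
noncomputable def polyCre (i : ℤ) : Module.End ℂ (MvPolynomial ℤ ℂ) :=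
  LinearMap.mulLeft ℂ (MvPolynomial.X i)

/-- The partial derivative `∂/∂x_i` on `ℂ[x_j, j ∈ ℤ]`. -/
noncomputable def polyAnn (i : ℤ) : Module.End ℂ (MvPolynomial ℤ ℂ) :=
  (MvPolynomial.pderiv i).toLinearMap

theorem polyCre_apply (i : ℤ) (p : MvPolynomial ℤ ℂ) : polyCre i p = MvPolynomial.X i * p := rfl

theorem polyAnn_apply (i : ℤ) (p : MvPolynomial ℤ ℂ) : polyAnn i p = MvPolynomial.pderiv i p := rfl

theorem polyCre_mul_polyCre (i j : ℤ) : polyCre i * polyCre j = polyCre j * polyCre i :=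
  LinearMap.ext fun p => mul_left_comm (MvPolynomial.X i) (MvPolynomial.X j) p

theorem polyAnn_mul_polyAnn (i j : ℤ) : polyAnn i * polyAnn j = polyAnn j * polyAnn i := by
  let D : ℤ → Derivation ℂ (MvPolynomial ℤ ℂ) (MvPolynomial ℤ ℂ) := MvPolynomial.pderiv
  have h : ⁅D i, D j⁆ = 0 := by
    refine MvPolynomial.derivation_ext fun k => ?_
    rw [Derivation.commutator_apply, MvPolynomial.pderiv_X, MvPolynomial.pderiv_X]
    simp only [Pi.single_apply]
    split_ifs <;> simp
  refine LinearMap.ext fun p => sub_eq_zero.1 ?_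
  have hp : ⁅D i, D j⁆ p = 0 := by rw [h]; rfl
  rwa [Derivation.commutator_apply] at hp

theorem polyAnn_mul_polyCre (i j : ℤ) :
    polyAnn i * polyCre j = polyCre j * polyAnn i + (if i = j then 1 else 0 : ℂ) • 1 := by
  refine LinearMap.ext fun p => ?_
  rw [Module.End.mul_apply, LinearMap.add_apply, Module.End.mul_apply, LinearMap.smul_apply,
    Module.End.one_apply, polyCre_apply, polyCre_apply, polyAnn_apply, polyAnn_apply,
    MvPolynomial.pderiv_mul, MvPolynomial.pderiv_X, add_comm]
  by_cases hij : i = j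
  · subst hij; simp
  · rw [if_neg hij, Pi.single_eq_of_ne' hij, zero_mul, zero_smul]

/-- The operators on `MvPolynomial ℤ ℂ` by which the modes `H_i`, `|i| > m`, act up to powers of
`c₃`. -/
noncomputable def bosonOp (m : ℕ) : HCIdx → Module.End ℂ (MvPolynomial ℤ ℂ)
  | .H i => if (m : ℤ) < i then (i : ℂ) • polyAnn i
      else if i < -m then polyCre (-i) else 1
  | _ => 1

/-- The operators on the fermionic Fock space by which the modes `F_{j+1/2}` act; for
`-m ≤ j < m` this is the parity, so as to anticommute with the creation and annihilation
operators. -/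
noncomputable def fermionOp (m : ℕ) : HCIdx → Module.End ℂ (Fock ℤ)
  | .F j => if (m : ℤ) ≤ j then ann j else if j < -m then cre (-j - 1) else invol ℤ
  | _ => 1

variable {m : ℕ} {B : Type v} [AddCommGroup B] [Module ℂ B] [SuperSpace B]
  (ρ : LieSuperModule (fin m) B)

open Classical in
/-- The operators on `B` by which the modes of `𝔥𝔠` act on the tensor product of `B` with the Fock
spaces: `c₃` for annihilation operators outside `𝔥𝔠_{[m]}`, `1` for creation operators. -/
noncomputable def innerOp (k : HCIdx) : Module.End ℂ B :=
  if k ∈ finIdx m then ρ.act (truncLin m (e k))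
  else if k ∈ HCIdx.pos then ρ.act (fin_c₃ m) else 1

/-- The action of the basis vectors of `𝔥𝔠` on `B ⊗ ℂ[x_i] ⊗ Fock`. -/
noncomputable def modelOp (k : HCIdx) :
    Module.End ℂ (B ⊗[ℂ] (MvPolynomial ℤ ℂ ⊗[ℂ] Fock ℤ)) :=
  TensorProduct.map (innerOp ρ k) (TensorProduct.map (bosonOp m k) (fermionOp m k))

theorem innerOp_of_mem {k : HCIdx} (hk : k ∈ finIdx m) :
    innerOp ρ k = ρ.act (truncLin m (e k)) := if_pos hk

theorem truncLin_c₃ (m : ℕ) : truncLin m c₃ = fin_c₃ m :=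
  Subtype.ext (truncLin_of_mem (m := m) (k := .c) trivial)

theorem innerOp_c : innerOp ρ .c = ρ.act (fin_c₃ m) :=
  (innerOp_of_mem ρ (k := .c) trivial).trans (congrArg ρ.act (truncLin_c₃ m))

theorem innerOp_of_mem_outerIdx {k : HCIdx} (hk : k ∈ outerIdx m) :
    innerOp ρ k = ρ.act (fin_c₃ m) := by
  rw [innerOp, if_neg hk.2, if_pos hk.1]

theorem innerOp_of_not_mem_pos {k : HCIdx} (hk : k ∉ finIdx m) (hk' : k ∉ HCIdx.pos) :
    innerOp ρ k = 1 := by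
  rw [innerOp, if_neg hk, if_neg hk']

/-- The modes of `𝔥𝔠_{[m]}` satisfy their defining relations already on `B`. -/
theorem innerOp_mul {k l : HCIdx} (hk : k ∈ finIdx m) (hl : l ∈ finIdx m) :
    innerOp ρ k * innerOp ρ l = superSign k.parity l.parity • (innerOp ρ l * innerOp ρ k) +
      HCIdx.form k l • innerOp ρ .c := by
  have hk' : (truncLin m (e k) : HC) ∈ grade (V := HC) k.parity := by
    rw [truncLin_of_mem hk]; exact e_mem_grade k
  have hl' : (truncLin m (e l) : HC) ∈ grade (V := HC) l.parity := by
    rw [truncLin_of_mem hl]; exact e_mem_grade l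
  have h := ρ.act_mul_act_of_coe (z := HCIdx.form k l • fin_c₃ m) hk' hl' <| by
    rw [truncLin_of_mem hk, truncLin_of_mem hl, bracket_e]; rfl
  rw [map_smul] at h
  rw [innerOp_c, innerOp_of_mem ρ hk, innerOp_of_mem ρ hl, h]

theorem innerOp_c_mul (k : HCIdx) : innerOp ρ .c * innerOp ρ k = innerOp ρ k * innerOp ρ .c := by
  by_cases hk : k ∈ finIdx m
  · rw [innerOp_c, innerOp_of_mem ρ hk]
    exact LinearMap.ext fun b => fin_c₃_act ρ _ b
  · by_cases hk' : k ∈ HCIdx.pos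
    · rw [innerOp_c, innerOp_of_mem_outerIdx ρ ⟨hk', hk⟩]
    · rw [innerOp_of_not_mem_pos ρ hk hk', mul_one, one_mul]

theorem innerOp_mul_comm {k l : HCIdx} (hkl : ¬(k ∈ finIdx m ∧ l ∈ finIdx m)) :
    innerOp ρ k * innerOp ρ l = innerOp ρ l * innerOp ρ k := by
  have key : ∀ {k l : HCIdx}, k ∉ finIdx m →
      innerOp ρ k * innerOp ρ l = innerOp ρ l * innerOp ρ k := by
    intro k l hk
    by_cases hk' : k ∈ HCIdx.pos
    · rw [innerOp_of_mem_outerIdx ρ ⟨hk', hk⟩, ← innerOp_c, innerOp_c_mul]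
    · rw [innerOp_of_not_mem_pos ρ hk hk', mul_one, one_mul]
  rcases not_and_or.1 hkl with h | h
  · exact key h
  · exact (key h).symm

/-- The factors that two modes outside `𝔥𝔠_{[m]}` contribute on `B` multiply to `c₃` whenever their
bracket does not vanish, as one of the two modes is then positive and the other negative. -/
theorem form_smul_innerOp_mul {k l : HCIdx} (hkl : ¬(k ∈ finIdx m ∧ l ∈ finIdx m)) :
    HCIdx.form k l • (innerOp ρ l * innerOp ρ k) = HCIdx.form k l • innerOp ρ .c := by
  classical
  by_cases h0 : HCIdx.form k l = 0
  · rw [h0, zero_smul, zero_smul]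
  · congr 1
    rw [innerOp_c]
    have hk : k = l.dual := by
      by_contra h
      rw [← HCIdx.dual_dual l, HCIdx.form_dual, if_neg h] at h0
      exact h0 rfl
    have hfin : ∀ {k : HCIdx}, k ∈ finIdx m → k.dual ∈ finIdx m := by
      rintro (n | n | _) h <;> simp only [finIdx, HCIdx.dual, Set.mem_ofPred_eq] at * <;> omega
    have hpos : ∀ {k : HCIdx}, k ∉ finIdx m → (k ∈ HCIdx.pos ↔ k.dual ∉ HCIdx.pos) := by
      rintro (n | n | _) h
      · simp only [finIdx, HCIdx.dual, HCIdx.pos, HCIdx.twiceDeg, Set.mem_ofPred_eq] at *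
        omega
      · simp only [finIdx, HCIdx.dual, HCIdx.pos, HCIdx.twiceDeg, Set.mem_ofPred_eq] at *
        omega
      · exact absurd trivial h
    have hl : l ∉ finIdx m := fun hl => hkl ⟨hk ▸ hfin hl, hl⟩
    have hk' : k ∉ finIdx m := fun h => hl (by rw [← HCIdx.dual_dual l, ← hk]; exact hfin h)
    by_cases hl' : l ∈ HCIdx.pos
    · have : k ∉ HCIdx.pos := hk ▸ (hpos hl).1 hl'
      rw [innerOp_of_not_mem_pos ρ hk' this, innerOp_of_mem_outerIdx ρ ⟨hl', hl⟩, mul_one]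
    · have : k ∈ HCIdx.pos := by
        by_contra h
        exact hl' ((hpos hl).2 (hk ▸ h))
      rw [innerOp_of_not_mem_pos ρ hl hl', innerOp_of_mem_outerIdx ρ ⟨this, hk'⟩, one_mul]

theorem bosonOp_of_lt {i : ℤ} (h : (m : ℤ) < i) :
    bosonOp m (.H i) = (i : ℂ) • polyAnn i := if_pos h

theorem bosonOp_of_lt_neg {i : ℤ} (h : i < -m) : bosonOp m (.H i) = polyCre (-i) :=
  (if_neg (by omega)).trans (if_pos h)

theorem bosonOp_of_mem {i : ℤ} (h : HCIdx.H i ∈ finIdx m) : bosonOp m (.H i) = 1 :=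
  (if_neg (not_lt.2 h.2)).trans (if_neg (not_lt.2 h.1))

theorem H_cases (m : ℕ) (i : ℤ) : (m : ℤ) < i ∨ i < -m ∨ HCIdx.H i ∈ finIdx m := by
  by_cases h : (m : ℤ) < i
  · exact Or.inl h
  · by_cases h' : i < -m
    · exact Or.inr (Or.inl h')
    · exact Or.inr (Or.inr ⟨not_lt.1 h', not_lt.1 h⟩)

theorem form_H_of_ne {i j : ℤ} (h : i + j ≠ 0) : HCIdx.form (.H i) (.H j) = 0 := if_neg h

theorem form_F_of_ne {i j : ℤ} (h : i + j + 1 ≠ 0) : HCIdx.form (.F i) (.F j) = 0 := if_neg h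

theorem bosonOp_mul {i j : ℤ} (h : ¬(HCIdx.H i ∈ finIdx m ∧ HCIdx.H j ∈ finIdx m)) :
    bosonOp m (.H i) * bosonOp m (.H j) = bosonOp m (.H j) * bosonOp m (.H i) +
      HCIdx.form (.H i) (.H j) • (1 : Module.End ℂ (MvPolynomial ℤ ℂ)) := by
  obtain hi | hi | hi := H_cases m i <;> obtain hj | hj | hj := H_cases m j
  · rw [bosonOp_of_lt hi, bosonOp_of_lt hj, form_H_of_ne (by omega), zero_smul, add_zero,
      smul_mul_smul_comm, smul_mul_smul_comm, polyAnn_mul_polyAnn, mul_comm (i : ℂ)]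
  · rw [bosonOp_of_lt hi, bosonOp_of_lt_neg hj, smul_mul_assoc, polyAnn_mul_polyCre, smul_add,
      mul_smul_comm, smul_smul]
    congr 2
    by_cases hij : i + j = 0
    · rw [if_pos (by omega), mul_one]; exact (if_pos hij).symm
    · rw [if_neg (by omega), mul_zero, form_H_of_ne hij]
  · rw [bosonOp_of_mem hj, form_H_of_ne (by have := hj.1; omega), zero_smul, add_zero, mul_one,
      one_mul]
  · rw [bosonOp_of_lt hj, bosonOp_of_lt_neg hi, smul_mul_assoc, polyAnn_mul_polyCre, smul_add,
      mul_smul_comm, smul_smul, add_assoc, ← add_smul]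
    convert (add_zero _).symm
    by_cases hij : i + j = 0
    · have : (i : ℂ) = -j := by
        rw [← Int.cast_neg, Int.cast_inj]; omega
      rw [if_pos (by omega), show HCIdx.form (.H i) (.H j) = (i : ℂ) from if_pos hij, this]
      simp
    · rw [if_neg (by omega), form_H_of_ne hij]
      simp
  · rw [bosonOp_of_lt_neg hi, bosonOp_of_lt_neg hj, form_H_of_ne (by omega), zero_smul, add_zero,
      polyCre_mul_polyCre]
  · rw [bosonOp_of_mem hj, form_H_of_ne (by have := hj.2; omega), zero_smul, add_zero, mul_one,
      one_mul]
  · rw [bosonOp_of_mem hi, form_H_of_ne (by have := hi.1; omega), zero_smul, add_zero, mul_one,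
      one_mul]
  · rw [bosonOp_of_mem hi, form_H_of_ne (by have := hi.2; omega), zero_smul, add_zero, mul_one,
      one_mul]
  · exact absurd ⟨hi, hj⟩ h

theorem fermionOp_of_le {j : ℤ} (h : (m : ℤ) ≤ j) : fermionOp m (.F j) = ann j := if_pos h

theorem fermionOp_of_lt_neg {j : ℤ} (h : j < -m) : fermionOp m (.F j) = cre (-j - 1) :=
  (if_neg (by omega)).trans (if_pos h)

theorem fermionOp_of_mem {j : ℤ} (h : HCIdx.F j ∈ finIdx m) : fermionOp m (.F j) = invol ℤ :=
  (if_neg (not_le.2 (by have := h.2; omega))).trans (if_neg (not_lt.2 h.1))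

theorem F_cases (m : ℕ) (j : ℤ) : (m : ℤ) ≤ j ∨ j < -m ∨ HCIdx.F j ∈ finIdx m := by
  by_cases h : (m : ℤ) ≤ j
  · exact Or.inl h
  · by_cases h' : j < -m
    · exact Or.inr (Or.inl h')
    · exact Or.inr (Or.inr ⟨not_lt.1 h', by omega⟩)

/-- The fermionic modes outside `𝔥𝔠_{[m]}` satisfy the Clifford relations of level `1` on the Fock
space, and they anticommute with the operator by which the modes of `𝔥𝔠_{[m]}` act there. -/
theorem fermionOp_mul {i j : ℤ} (h : ¬(HCIdx.F i ∈ finIdx m ∧ HCIdx.F j ∈ finIdx m)) :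
    fermionOp m (.F i) * fermionOp m (.F j) = -(fermionOp m (.F j) * fermionOp m (.F i)) +
      HCIdx.form (.F i) (.F j) • (1 : Module.End ℂ (Fock ℤ)) := by
  obtain hi | hi | hi := F_cases m i <;> obtain hj | hj | hj := F_cases m j
  · rw [fermionOp_of_le hi, fermionOp_of_le hj, form_F_of_ne (by omega), zero_smul, add_zero,
      ann_mul_ann]
  · rw [fermionOp_of_le hi, fermionOp_of_lt_neg hj, ann_mul_cre, sub_eq_neg_add]
    congr 2
    by_cases hij : i + j + 1 = 0
    · rw [if_pos (by omega)]; exact (if_pos hij).symm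
    · rw [if_neg (by omega), form_F_of_ne hij]
  · rw [fermionOp_of_le hi, fermionOp_of_mem hj, form_F_of_ne (by have := hj.1; omega), zero_smul,
      add_zero, invol_mul_ann, neg_neg]
  · rw [fermionOp_of_le hj, fermionOp_of_lt_neg hi, ann_mul_cre, neg_sub, sub_add]
    convert (sub_zero _).symm
    rw [sub_eq_zero]
    congr 1
    by_cases hij : i + j + 1 = 0
    · rw [if_pos (by omega)]; exact (if_pos hij).symm
    · rw [if_neg (by omega), form_F_of_ne hij]
  · rw [fermionOp_of_lt_neg hi, fermionOp_of_lt_neg hj, form_F_of_ne (by omega), zero_smul,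
      add_zero, cre_mul_cre]
  · rw [fermionOp_of_lt_neg hi, fermionOp_of_mem hj, form_F_of_ne (by have := hj.2; omega),
      zero_smul, add_zero, invol_mul_cre, neg_neg]
  · rw [fermionOp_of_le hj, fermionOp_of_mem hi, form_F_of_ne (by have := hi.1; omega), zero_smul,
      add_zero, invol_mul_ann]
  · rw [fermionOp_of_mem hi, fermionOp_of_lt_neg hj, form_F_of_ne (by have := hi.2; omega),
      zero_smul, add_zero, invol_mul_cre]
  · exact absurd ⟨hi, hj⟩ h

theorem satisfiesRelations_modelOp : SatisfiesRelations Set.univ (modelOp ρ) := by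
  have hc : ∀ k, modelOp ρ .c * modelOp ρ k = modelOp ρ k * modelOp ρ .c := fun k => by
    simp only [modelOp, ← TensorProduct.map_mul, innerOp_c_mul]
    simp only [bosonOp, fermionOp, mul_one, one_mul]
  have hHF : ∀ i j, innerOp ρ (.H i) * innerOp ρ (.F j) = innerOp ρ (.F j) * innerOp ρ (.H i) := by
    intro i j
    by_cases h : HCIdx.H i ∈ finIdx m ∧ HCIdx.F j ∈ finIdx m
    · simpa [HCIdx.parity, superSign, HCIdx.form] using innerOp_mul ρ h.1 h.2
    · exact innerOp_mul_comm ρ h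
  rintro (i | i | _) - (j | j | _) -
  · have hs : superSign (HCIdx.H i).parity (HCIdx.H j).parity = 1 := by
      simp [HCIdx.parity, superSign]
    rw [hs, one_smul]
    simp only [modelOp, ← TensorProduct.map_mul]
    by_cases h : HCIdx.H i ∈ finIdx m ∧ HCIdx.H j ∈ finIdx m
    · rw [innerOp_mul ρ h.1 h.2, hs, one_smul, bosonOp_of_mem h.1, bosonOp_of_mem h.2,
        TensorProduct.map_add_left, TensorProduct.map_smul_left]
      simp only [bosonOp, fermionOp, mul_one]
    · rw [innerOp_mul_comm ρ h, bosonOp_mul h, TensorProduct.map_add_left,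
        TensorProduct.map_add_right, TensorProduct.map_smul_left, TensorProduct.map_smul_right,
        ← TensorProduct.map_smul_left, form_smul_innerOp_mul ρ h, TensorProduct.map_smul_left]
      simp only [bosonOp, fermionOp, mul_one]
  · have hs : superSign (HCIdx.H i).parity (HCIdx.F j).parity = 1 := by
      simp [HCIdx.parity, superSign]
    rw [hs, one_smul]
    simp only [modelOp, ← TensorProduct.map_mul, hHF]
    simp only [bosonOp, fermionOp, mul_one, one_mul, HCIdx.form, zero_smul, add_zero]
  · rw [← hc]
    simp [HCIdx.form, superSign, HCIdx.parity]
  · have hs : superSign (HCIdx.F i).parity (HCIdx.H j).parity = 1 := by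
      simp [HCIdx.parity, superSign]
    rw [hs, one_smul]
    simp only [modelOp, ← TensorProduct.map_mul, hHF]
    simp only [bosonOp, fermionOp, mul_one, one_mul, HCIdx.form, zero_smul, add_zero]
  · have hs : superSign (HCIdx.F i).parity (HCIdx.F j).parity = -1 := by
      simp [HCIdx.parity, superSign]
    rw [hs]
    simp only [modelOp, ← TensorProduct.map_mul]
    by_cases h : HCIdx.F i ∈ finIdx m ∧ HCIdx.F j ∈ finIdx m
    · rw [innerOp_mul ρ h.1 h.2, hs, fermionOp_of_mem h.1, fermionOp_of_mem h.2,
        invol_mul_invol, TensorProduct.map_add_left, TensorProduct.map_smul_left,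
        TensorProduct.map_smul_left]
      simp only [bosonOp, fermionOp, mul_one]
    · have hF := fermionOp_mul h
      rw [← neg_one_smul ℂ] at hF
      rw [innerOp_mul_comm ρ h, hF, TensorProduct.map_add_right,
        TensorProduct.map_add_right, TensorProduct.map_smul_right, TensorProduct.map_smul_right,
        TensorProduct.map_smul_right, TensorProduct.map_smul_right,
        ← TensorProduct.map_smul_left (HCIdx.form _ _), form_smul_innerOp_mul ρ h,
        TensorProduct.map_smul_left]
      simp only [bosonOp, fermionOp, mul_one]
  · rw [← hc]
    simp [HCIdx.form, superSign, HCIdx.parity]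
  · rw [hc]
    simp [HCIdx.form, superSign, HCIdx.parity]
  · rw [hc]
    simp [HCIdx.form, superSign, HCIdx.parity]
  · simp [HCIdx.form, superSign, HCIdx.parity]

/-- The canonical map from `B` to the induced module is injective, because the induced module maps
to a module in which the image of `b` is `b ⊗ 1 ⊗ 1`. -/
theorem indModuleOne_injective : Function.Injective (indModuleOne ρ) := by
  let f : HC →ₗ[ℂ] Module.End ℂ (B ⊗[ℂ] (MvPolynomial ℤ ℂ ⊗[ℂ] Fock ℤ)) :=
    Finsupp.linearCombination ℂ (modelOp ρ)
  have hfe : ∀ k, f (e k) = modelOp ρ k := fun k => by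
    simp [f, e, Finsupp.linearCombination_single]
  have hrel : SatisfiesRelations Set.univ fun k => f (e k) := by
    simp only [hfe]; exact satisfiesRelations_modelOp ρ
  let j : B →ₗ[ℂ] B ⊗[ℂ] (MvPolynomial ℤ ℂ ⊗[ℂ] Fock ℤ) :=
    (TensorProduct.mk ℂ B (MvPolynomial ℤ ℂ ⊗[ℂ] Fock ℤ)).flip (1 ⊗ₜ 1)
  have hjapply : ∀ b, j b = b ⊗ₜ (1 ⊗ₜ 1) := fun b => rfl
  have hj : ∀ (s : ge (-m)) b, j ((ρ.pullback (trunc m)).act s b) = f (s : HC) (j b) := by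
    intro s b
    let p : HC →ₗ[ℂ] B ⊗[ℂ] (MvPolynomial ℤ ℂ ⊗[ℂ] Fock ℤ) := j ∘ₗ ρ.act.flip b ∘ₗ truncLin m
    let q : HC →ₗ[ℂ] B ⊗[ℂ] (MvPolynomial ℤ ℂ ⊗[ℂ] Fock ℤ) := LinearMap.applyₗ (j b) ∘ₗ f
    suffices hpq : spanOf (geIdx (-m)) ≤ LinearMap.eqLocus p q from hpq s.2
    rw [spanOf_eq, Submodule.span_le]
    rintro _ ⟨k, hk, rfl⟩
    change j (ρ.act (truncLin m (e k)) b) = f (e k) (j b)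
    have hmap : modelOp ρ k (b ⊗ₜ (1 ⊗ₜ 1)) =
      innerOp ρ k b ⊗ₜ (bosonOp m k 1 ⊗ₜ fermionOp m k 1) := rfl
    rw [hfe, hjapply, hjapply, hmap]
    by_cases hkm : k ∈ finIdx m
    · have hb : bosonOp m k 1 = 1 := by
        rcases k with i | i | _
        · rw [bosonOp_of_mem hkm]; rfl
        · rfl
        · rfl
      have hf : fermionOp m k 1 = 1 := by
        rcases k with i | i | _
        · rfl
        · rw [fermionOp_of_mem hkm, invol_one]
        · rfl
      rw [hb, hf, innerOp_of_mem ρ hkm]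
    · rw [show truncLin m (e k) = 0 from Subtype.ext (truncLin_of_not_mem hkm), map_zero,
        LinearMap.zero_apply, TensorProduct.zero_tmul]
      rcases k with i | i | _
      · obtain h | h | h := H_cases m i
        · rw [bosonOp_of_lt h, LinearMap.smul_apply, polyAnn_apply, MvPolynomial.pderiv_one,
            smul_zero, TensorProduct.zero_tmul, TensorProduct.tmul_zero]
        · exact absurd hk (not_le.2 h)
        · exact absurd h hkm
      · obtain h | h | h := F_cases m i
        · rw [fermionOp_of_le h, ann_one, TensorProduct.tmul_zero, TensorProduct.tmul_zero]
        · exact absurd hk (not_le.2 h)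
        · exact absurd h hkm
      · exact absurd trivial hkm
  have hinj : Function.Injective j := by
    let ψ : MvPolynomial ℤ ℂ ⊗[ℂ] Fock ℤ →ₗ[ℂ] ℂ := LinearMap.mul' ℂ ℂ ∘ₗ TensorProduct.map
      (MvPolynomial.aeval (0 : ℤ → ℂ)).toLinearMap ExteriorAlgebra.algebraMapInv.toLinearMap
    have hψ : ψ (1 ⊗ₜ 1) = 1 := by simp [ψ]
    refine Function.LeftInverse.injective
      (g := TensorProduct.rid ℂ B ∘ₗ LinearMap.lTensor B ψ) fun b => ?_
    simp [hjapply, hψ]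
  refine Function.Injective.of_comp (f := indLift (ρ.pullback (trunc m)) f
    (fun hx hy => hrel.mul_eq (mem_spanOf_univ _) (mem_spanOf_univ _) hx hy) j hj) ?_
  convert hinj using 1
  exact funext fun b => indLift_indOne ..

end HC

/-! ### Induced modules and modules generated by vacuum vectors -/

namespace LieSuperModule

variable {L : Type u} [AddCommGroup L] [Module ℂ L] [LieSuperalgebra L]
variable {V : Type v} [AddCommGroup V] [Module ℂ V] [SuperSpace V]
variable {W : Type w} [AddCommGroup W] [Module ℂ W] [SuperSpace W]

theorem Iso.symm {ρ : LieSuperModule L V} {τ : LieSuperModule L W} (h : ρ.Iso τ) : τ.Iso ρ := by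
  obtain ⟨f, hf, hact⟩ := h
  have hf' := (SuperSpace.even_iff (f := f.toLinearMap)).1 hf
  refine ⟨f.symm, (SuperSpace.even_iff (f := f.symm.toLinearMap)).2 fun x => ?_, fun x a => ?_⟩
  · refine f.injective ((f.apply_symm_apply _).trans (Eq.trans ?_ (hf' _).symm))
    exact congrArg _ (f.apply_symm_apply x).symm
  · refine f.injective ?_
    rw [f.apply_symm_apply, hact, f.apply_symm_apply]

theorem iso_of_bijective {ρ : LieSuperModule L V} {τ : LieSuperModule L W} (f : V →ₗ[ℂ] W)
    (hf : Function.Bijective f) (hp : ∀ a, f (SuperSpace.parity V a) = SuperSpace.parity W (f a))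
    (hact : ∀ x a, f (ρ.act x a) = τ.act x (f a)) : ρ.Iso τ :=
  ⟨LinearEquiv.ofBijective f hf, SuperSpace.even_iff.2 hp, hact⟩

end LieSuperModule

namespace HC

open LieSuperModule

section Simple

variable {m : ℕ} {B : Type v} [AddCommGroup B] [Module ℂ B] [SuperSpace B]
  {ρ : LieSuperModule (fin m) B}

/-- A nonzero submodule of an induced module contains a nonzero vacuum vector `1 ⊗ b`. -/
theorem indModule_isSimple (hρ : ρ.IsSimple) (h0 : ρ.act (fin_c₃ m) ≠ 0) :
    (indModule m ρ).IsSimple := by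
  have hu := isUnit_indModule_act_c₃ ρ (isUnit_fin_c₃ hρ h0)
  have : Nontrivial B := hρ.1
  refine ⟨(indModuleOne_injective ρ).nontrivial, fun N hN hact =>
    or_iff_not_imp_left.2 fun hN0 => ?_⟩
  obtain ⟨t, htN, htv, ht0⟩ := OscillatorSystem.exists_mem_vacuum
    (O := moduleOscillators (indModule m ρ) (outerIdx m) (outerIdx_subset_pos m) hu)
    (range_indModuleOne_le_vacuum (hu := hu))
    (by rintro _ ⟨b, rfl⟩; exact ⟨_, (act_indModuleOne_fin ρ (fin_c₃ m) b).symm⟩)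
    generated_range_indModuleOne hN0 (fun k x hx => hact _ x hx)
  rw [vacuum_indModule] at htv
  obtain ⟨b, rfl⟩ := htv
  have hcomap : N.comap (indModuleOne ρ) = ⊤ := by
    refine (hρ.2 _ (SuperSpace.isGraded_of_parity fun a ha => ?_) fun x a ha => ?_).resolve_left
      fun h => ht0 ?_
    · rw [Submodule.mem_comap] at ha ⊢
      rw [← parity_indOne]
      exact hN.parity_mem ha
    · rw [Submodule.mem_comap] at ha ⊢
      rw [← act_indModuleOne_fin]
      exact hact _ _ ha
    · have hb : b ∈ N.comap (indModuleOne ρ) := htN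
      rw [h, Submodule.mem_bot] at hb
      rw [hb, map_zero]
  refine ind_eq_top (fun b => ?_) hact
  have : b ∈ N.comap (indModuleOne ρ) := by rw [hcomap]; trivial
  exact this

end Simple

section Smooth

variable {V : Type v} [AddCommGroup V] [Module ℂ V] [SuperSpace V] {τ : LieSuperModule HC V}

theorem isSimple_restrict_vacuum {I : Set HCIdx} {hI : I ⊆ HCIdx.pos}
    {hu : IsUnit (τ.act c₃ : Module.End ℂ V)} (hτ : τ.IsSimple) {T : Set HCIdx}
    {hT : HCIdx.c ∈ T} (hTI : ∀ k, k ∉ I → k.dual ∉ I → k ∈ T)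
    (hact : ∀ x ∈ (subalgebra T hT).toSubmodule, ∀ a ∈ (moduleOscillators τ I hI hu).vacuum,
      τ.act x a ∈ (moduleOscillators τ I hI hu).vacuum)
    (h0 : (moduleOscillators τ I hI hu).vacuum ≠ ⊥) :
    letI := SuperSpace.ofGraded (isGraded_vacuum (hI := hI) (hu := hu))
    (τ.restrict (subalgebra T hT) isGraded_vacuum hact).IsSimple := by
  let _ := SuperSpace.ofGraded (isGraded_vacuum (hI := hI) (hu := hu))
  refine ⟨Submodule.nontrivial_iff_ne_bot.2 h0, fun N hN hNact => ?_⟩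
  have hmap := eq_bot_or_eq_vacuum (hI := hI) (hu := hu) hτ
    (W := N.map (moduleOscillators τ I hI hu).vacuum.subtype)
    (SuperSpace.isGraded_of_parity ?_) (Submodule.map_subtype_le _ _) ?_
  · rcases hmap with h | h
    · left
      exact Submodule.map_injective_of_injective (Submodule.injective_subtype _)
        (h.trans (Submodule.map_bot _).symm)
    · right
      rw [eq_top_iff]
      rintro ⟨a, ha⟩ -
      rw [← h] at ha
      obtain ⟨b, hb, hba⟩ := ha
      rwa [show (⟨a, _⟩ : (moduleOscillators τ I hI hu).vacuum) = b from Subtype.ext hba.symm]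
  · rintro _ ⟨a, ha, rfl⟩
    exact ⟨_, hN.parity_mem ha, SuperSpace.coe_parity_ofGraded isGraded_vacuum a⟩
  · rintro l h h' _ ⟨a, ha, rfl⟩
    exact ⟨_, hNact ⟨e l, e_mem (hTI l h h')⟩ a ha, rfl⟩

/-- Every simple smooth module on which `c₃` acts nonzero is induced from the space of its vacuum
vectors for the modes outside `𝔥𝔠_{[m]}`, for `m` large enough. -/
theorem exists_iso_indModule (hτ : τ.IsSimple) (hs : τ.IsSmooth deg) (hc : τ.act c₃ ≠ 0) :
    ∃ (m : ℕ) (B : Type v) (_ : AddCommGroup B) (_ : Module ℂ B) (_ : SuperSpace B)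
      (ρ : LieSuperModule (fin m) B),
      1 ≤ m ∧ ρ.IsSimple ∧ ρ.act (fin_c₃ m) ≠ 0 ∧ τ.Iso (indModule m ρ) := by
  have hu : IsUnit (τ.act c₃ : Module.End ℂ V) :=
    hτ.isUnit_act_of_central c₃_mem_grade bracket_c₃ hc
  have : Nontrivial V := hτ.1
  obtain ⟨a, ha⟩ := exists_ne (0 : V)
  obtain ⟨n, hn⟩ := hs a
  -- The modes of doubled degree greater than `n` kill `a`, and the positive modes outside
  -- `𝔥𝔠_{[m]}` have doubled degree greater than `2 m > n`; the summand `1` ensures `1 ≤ m`.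
  let m := n + 1
  let O := moduleOscillators τ (outerIdx m) (outerIdx_subset_pos m) hu
  have hav : a ∈ O.vacuum := by
    refine mem_vacuum.2 fun k hk => hn k.twiceDeg ?_ _ (e_mem (T := {l | l.twiceDeg = _}) rfl)
    rcases k with i | i | _
    · have : (m : ℤ) < i := by
        obtain h | h | h := H_cases m i
        · exact h
        · have := HCIdx.mem_pos.1 hk.1; simp only [HCIdx.twiceDeg] at this; omega
        · exact absurd h hk.2
      simp only [HCIdx.twiceDeg]; omega
    · have : (m : ℤ) ≤ i := by
        obtain h | h | h := F_cases m i
        · exact h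
        · have := HCIdx.mem_pos.1 hk.1; simp only [HCIdx.twiceDeg] at this; omega
        · exact absurd h hk.2
      simp only [HCIdx.twiceDeg]; omega
    · exact absurd trivial hk.2
  have hO : O.vacuum ≠ ⊥ := fun h => ha (by rw [h] at hav; exact hav)
  have hdual : ∀ {k : HCIdx}, k ∈ finIdx m → k.dual ∉ outerIdx m := by
    rintro (i | i | _) h h'
    · exact h'.2 ⟨neg_le_neg h.2, by have := h.1; omega⟩
    · exact h'.2 ⟨by have := h.2; omega, by have := h.1; omega⟩
    · exact h'.2 trivial
  have hact : ∀ x ∈ (fin m).toSubmodule, ∀ a ∈ O.vacuum, τ.act x a ∈ O.vacuum :=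
    fun x hx a ha => act_mem_of_basis (f := τ.act)
      (fun k hk b hb => act_mem_vacuum (Set.mem_univ k) (hdual hk) hb) hx ha
  let _ : SuperSpace O.vacuum := SuperSpace.ofGraded isGraded_vacuum
  let ρ : LieSuperModule (fin m) O.vacuum := τ.restrict (fin m) isGraded_vacuum hact
  have hρ : ρ.IsSimple := isSimple_restrict_vacuum hτ (fun k => mem_finIdx) hact hO
  have hρc : ρ.act (fin_c₃ m) ≠ 0 := by
    intro h
    have h' : τ.act c₃ a = 0 :=
      congrArg Subtype.val (LinearMap.congr_fun h (⟨a, hav⟩ : O.vacuum))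
    exact ha (((Module.End.isUnit_iff _).1 hu).1 (h'.trans (map_zero _).symm))
  refine ⟨m, O.vacuum, inferInstance, inferInstance, inferInstance, ρ, by omega, hρ, hρc, ?_⟩
  have hj : ∀ (s : ge (-m)) (b : O.vacuum),
      O.vacuum.subtype ((ρ.pullback (trunc m)).act s b) = τ.act (s : HC) (O.vacuum.subtype b) := by
    intro s b
    let p : HC →ₗ[ℂ] V := O.vacuum.subtype ∘ₗ ρ.act.flip b ∘ₗ truncLin m
    let q : HC →ₗ[ℂ] V := τ.act.flip (b : V)
    suffices hpq : spanOf (geIdx (-m)) ≤ LinearMap.eqLocus p q from hpq s.2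
    rw [spanOf_eq, Submodule.span_le]
    rintro _ ⟨k, hk, rfl⟩
    change τ.act (truncLin m (e k) : HC) (b : V) = τ.act (e k) (b : V)
    by_cases hkm : k ∈ finIdx m
    · rw [truncLin_of_mem hkm]
    · rw [truncLin_of_not_mem hkm, map_zero,
        mem_vacuum.1 b.2 k (mem_outerIdx_of_mem_geIdx hk hkm)]
      rfl
  let ψ := indHom (ρ.pullback (trunc m)) τ O.vacuum.subtype hj
  have hψ1 : ∀ b, ψ (indModuleOne ρ b) = b := indHom_indOne _ τ _ hj
  have hψact : ∀ x t, ψ ((indModule m ρ).act x t) = τ.act x (ψ t) := indHom_act _ τ _ hj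
  have hψp : ∀ t, ψ (SuperSpace.parity _ t) = SuperSpace.parity V (ψ t) :=
    indHom_parity _ τ _ hj fun b => SuperSpace.coe_parity_ofGraded isGraded_vacuum b
  have hψa : ψ (indModuleOne ρ ⟨a, hav⟩) ≠ 0 := by rw [hψ1]; exact ha
  refine (iso_of_bijective ψ ⟨?_, ?_⟩ hψp hψact).symm
  · rw [← LinearMap.ker_eq_bot]
    refine ((indModule_isSimple hρ hρc).2 (LinearMap.ker ψ)
      (SuperSpace.isGraded_of_parity fun t ht => ?_) fun x t ht => ?_).resolve_right fun h => ?_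
    · rw [LinearMap.mem_ker] at ht ⊢; rw [hψp, ht, map_zero]
    · rw [LinearMap.mem_ker] at ht ⊢; rw [hψact, ht, map_zero]
    · exact hψa (by rw [LinearMap.ker_eq_top.1 h]; rfl)
  · rw [← LinearMap.range_eq_top]
    refine (hτ.2 (LinearMap.range ψ)
      (SuperSpace.isGraded_of_parity fun t ht => ?_) fun x t ht => ?_).resolve_left fun h => ?_
    · obtain ⟨t, rfl⟩ := ht; exact ⟨_, hψp t⟩
    · obtain ⟨t, rfl⟩ := ht; exact ⟨_, hψact x t⟩
    · exact hψa (by rw [LinearMap.range_eq_bot.1 h]; rfl)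

end Smooth

section Iso

variable {m : ℕ} {B : Type v} [AddCommGroup B] [Module ℂ B] [SuperSpace B]
  {B' : Type w} [AddCommGroup B'] [Module ℂ B'] [SuperSpace B']
  {ρ : LieSuperModule (fin m) B} {ρ' : LieSuperModule (fin m) B'}

/-- Isomorphic modules induce isomorphic modules. -/
theorem indModule_iso (h : ρ.Iso ρ') : (indModule m ρ).Iso (indModule m ρ') := by
  obtain ⟨f, hf, hact⟩ := h
  have hf' : ∀ b, f (SuperSpace.parity B b) = SuperSpace.parity B' (f b) :=
    (SuperSpace.even_iff (f := f.toLinearMap)).1 hf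
  have hact' : ∀ x b, f.symm (ρ'.act x b) = ρ.act x (f.symm b) := fun x b =>
    f.injective (by rw [f.apply_symm_apply, hact, f.apply_symm_apply])
  have hj : ∀ (s : ge (-m)) b, (indModuleOne ρ' ∘ₗ f.toLinearMap) ((ρ.pullback (trunc m)).act s b) =
      (indModule m ρ').act (s : HC) ((indModuleOne ρ' ∘ₗ f.toLinearMap) b) := by
    intro s b
    refine Eq.trans ?_ (ind_act_indOne (ρ'.pullback (trunc m)) s (f b)).symm
    exact congrArg (indModuleOne ρ') (hact _ b)
  have hj' : ∀ (s : ge (-m)) b,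
      (indModuleOne ρ ∘ₗ f.symm.toLinearMap) ((ρ'.pullback (trunc m)).act s b) =
      (indModule m ρ).act (s : HC) ((indModuleOne ρ ∘ₗ f.symm.toLinearMap) b) := by
    intro s b
    refine Eq.trans ?_ (ind_act_indOne (ρ.pullback (trunc m)) s (f.symm b)).symm
    exact congrArg (indModuleOne ρ) (hact' _ b)
  let g := indHom (ρ.pullback (trunc m)) (indModule m ρ') _ hj
  let g' := indHom (ρ'.pullback (trunc m)) (indModule m ρ) _ hj'
  have hg1 : ∀ b, g (indModuleOne ρ b) = indModuleOne ρ' (f b) := indHom_indOne _ _ _ hj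
  have hg1' : ∀ b, g' (indModuleOne ρ' b) = indModuleOne ρ (f.symm b) := indHom_indOne _ _ _ hj'
  have hg : ∀ x t, g ((indModule m ρ).act x t) = (indModule m ρ').act x (g t) :=
    indHom_act _ _ _ hj
  have hg' : ∀ x t, g' ((indModule m ρ').act x t) = (indModule m ρ).act x (g' t) :=
    indHom_act _ _ _ hj'
  refine iso_of_bijective g (Function.bijective_iff_has_inverse.2 ⟨g', ?_, ?_⟩)
    (indHom_parity _ _ _ hj fun b => ?_) hg
  · refine LinearMap.congr_fun (f := g' ∘ₗ g) (g := LinearMap.id)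
      (indHom_ext _ (f := (indModule m ρ).act) (fun b => ?_) (fun x t => ?_) fun _ _ => rfl)
    · rw [LinearMap.comp_apply, hg1, hg1', f.symm_apply_apply]; rfl
    · change g' (g ((indModule m ρ).act x t)) = (indModule m ρ).act x (g' (g t))
      rw [hg, hg']
  · refine LinearMap.congr_fun (f := g ∘ₗ g') (g := LinearMap.id)
      (indHom_ext _ (f := (indModule m ρ').act) (fun b => ?_) (fun x t => ?_) fun _ _ => rfl)
    · rw [LinearMap.comp_apply, hg1', hg1, f.apply_symm_apply]; rfl
    · change g (g' ((indModule m ρ').act x t)) = (indModule m ρ').act x (g (g' t))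
      rw [hg', hg]
  · change indModuleOne ρ' (f _) = SuperSpace.parity _ (indModuleOne ρ' (f b))
    rw [parity_indOne, hf']

/-- An isomorphism of induced modules maps vacuum vectors to vacuum vectors, and these form the
original modules. -/
theorem iso_of_indModule_iso (hu : IsUnit (ρ.act (fin_c₃ m) : Module.End ℂ B))
    (hu' : IsUnit (ρ'.act (fin_c₃ m) : Module.End ℂ B'))
    (h : (indModule m ρ).Iso (indModule m ρ')) : ρ.Iso ρ' := by
  obtain ⟨f, hf, hact⟩ := h
  have hf' : ∀ t, f (SuperSpace.parity _ t) = SuperSpace.parity _ (f t) :=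
    (SuperSpace.even_iff (f := f.toLinearMap)).1 hf
  have hvac : ∀ t, t ∈ LinearMap.range (indModuleOne ρ) ↔
      f t ∈ LinearMap.range (indModuleOne ρ') := by
    intro t
    rw [← vacuum_indModule (hu := isUnit_indModule_act_c₃ ρ hu),
      ← vacuum_indModule (hu := isUnit_indModule_act_c₃ ρ' hu'), mem_vacuum, mem_vacuum]
    simp only [← hact]
    refine forall₂_congr fun k _ => ?_
    exact f.map_eq_zero_iff.symm
  have hex : ∀ b, ∃ b', indModuleOne ρ' b' = f (indModuleOne ρ b) := fun b =>
    (hvac _).1 ⟨b, rfl⟩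
  choose g hg using hex
  have hinj := indModuleOne_injective ρ'
  let G : B →ₗ[ℂ] B' :=
    { toFun := g
      map_add' := fun a b => hinj (by rw [map_add, hg, hg, hg, map_add, map_add])
      map_smul' := fun c b => hinj (by rw [map_smul, hg, hg, map_smul, map_smul]; rfl) }
  have hG : ∀ b, indModuleOne ρ' (G b) = f (indModuleOne ρ b) := hg
  refine iso_of_bijective G ⟨?_, ?_⟩ (fun b => hinj ?_) (fun x b => hinj ?_)
  · intro a b hab
    refine indModuleOne_injective ρ (f.injective ?_)
    rw [← hG, ← hG, hab]
  · intro b'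
    obtain ⟨b, hb⟩ := (hvac (f.symm (indModuleOne ρ' b'))).2 (by
      rw [f.apply_symm_apply]; exact ⟨b', rfl⟩)
    exact ⟨b, hinj (by rw [hG, hb, f.apply_symm_apply])⟩
  · rw [hG, ← parity_indOne, hf', ← hG, parity_indOne]
  · rw [hG, ← act_indModuleOne_fin, hact, ← hG, act_indModuleOne_fin]

end Iso

end HC

/-! ### The central element acts by a scalar -/

section Dixmier

open Polynomial

variable {V : Type v} [AddCommGroup V] [Module ℂ V]

/-- If `T` has empty spectrum, a linear relation between the vectors `(T - μ)⁻¹ v` yields, after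
clearing denominators, a nonzero polynomial `p` such that `p(T)` kills `v`; but `p(T)` is
invertible. -/
theorem linearIndependent_resolvent {T : Module.End ℂ V} (hT : spectrum ℂ T = ∅) {v : V}
    (hv : v ≠ 0) {r : ℂ → V} (hr : ∀ μ, (T - algebraMap ℂ _ μ) (r μ) = v) :
    LinearIndependent ℂ r := by
  classical
  rw [linearIndependent_iff']
  intro s α hα μ hμ
  let q : ℂ → ℂ[X] := fun ν => ∏ κ ∈ s.erase ν, (X - C κ)
  let p : ℂ[X] := ∑ ν ∈ s, C (α ν) * q ν
  have hp : aeval T p v = 0 := by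
    have hq : ∀ ν ∈ s, aeval T (∏ κ ∈ s, (X - C κ)) (r ν) = aeval T (q ν) v := by
      intro ν hν
      rw [← Finset.prod_erase_mul _ _ hν, map_mul, Module.End.mul_apply]
      congr 1
      rw [map_sub, aeval_X, aeval_C]
      exact hr ν
    calc aeval T p v = ∑ ν ∈ s, α ν • aeval T (q ν) v := by
          simp [p, LinearMap.sum_apply, Module.algebraMap_end_apply]
      _ = ∑ ν ∈ s, α ν • aeval T (∏ κ ∈ s, (X - C κ)) (r ν) :=
          Finset.sum_congr rfl fun ν hν => by rw [hq ν hν]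
      _ = aeval T (∏ κ ∈ s, (X - C κ)) (∑ ν ∈ s, α ν • r ν) := by
          rw [map_sum]; simp only [map_smul]
      _ = 0 := by rw [hα, map_zero]
  have hp0 : p = 0 := by
    by_contra h0
    have hunit : IsUnit (aeval T p) := by
      rcases lt_or_ge 0 p.degree with hd | hd
      · rw [← spectrum.zero_notMem_iff ℂ, spectrum.map_polynomial_aeval_of_degree_pos T p hd, hT]
        simp
      · rw [eq_C_of_degree_le_zero hd, aeval_C]
        refine (IsUnit.mk0 _ fun h => h0 ?_).map _
        rw [eq_C_of_degree_le_zero hd, h, map_zero]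
    exact hv (((Module.End.isUnit_iff _).1 hunit).1 (hp.trans (map_zero _).symm))
  have heval : p.eval μ = α μ * ∏ κ ∈ s.erase μ, (μ - κ) := by
    simp only [p, q, eval_finsetSum, eval_mul, eval_C, eval_prod, eval_sub, eval_X]
    refine Finset.sum_eq_single_of_mem μ hμ fun ν _ hνμ => ?_
    rw [Finset.prod_eq_zero (Finset.mem_erase.2 ⟨hνμ.symm, hμ⟩) (sub_self μ), mul_zero]
  rw [hp0, eval_zero] at heval
  refine (mul_eq_zero.1 heval.symm).resolve_right (Finset.prod_ne_zero_iff.2 fun κ hκ => ?_)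
  exact sub_ne_zero.2 (Finset.ne_of_mem_erase hκ).symm

/-- An endomorphism of a nonzero complex vector space of countable dimension has nonempty
spectrum. -/
theorem spectrum_nonempty_of_rank_le_aleph0 [Nontrivial V] (hV : Module.rank ℂ V ≤ Cardinal.aleph0)
    (T : Module.End ℂ V) : (spectrum ℂ T).Nonempty := by
  rw [Set.nonempty_iff_ne_empty]
  intro hT
  obtain ⟨v, hv⟩ := exists_ne (0 : V)
  have hsurj : ∀ μ : ℂ, ∃ w, (T - algebraMap ℂ _ μ) w = v := by
    intro μ
    have : μ ∉ spectrum ℂ T := by rw [hT]; simp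
    rw [spectrum.notMem_iff, ← neg_sub, IsUnit.neg_iff, Module.End.isUnit_iff] at this
    exact this.2 v
  choose r hr using hsurj
  have h := (linearIndependent_resolvent hT hv hr).cardinal_lift_le_rank
  rw [Cardinal.mk_complex, Cardinal.lift_continuum] at h
  refine absurd (h.trans (Cardinal.lift_le.2 hV)) (not_le.2 ?_)
  rw [Cardinal.lift_aleph0]
  exact Cardinal.aleph0_lt_continuum

end Dixmier

namespace HCIdx

instance : Countable HCIdx := by
  let f : HCIdx → ℤ ⊕ ℤ ⊕ Unit
    | H n => Sum.inl n
    | F n => Sum.inr (Sum.inl n)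
    | c => Sum.inr (Sum.inr ())
  refine Function.Injective.countable (f := f) ?_
  rintro (m | m | _) (n | n | _) h <;> simp_all [f]

end HCIdx

namespace HC

variable {V : Type v} [AddCommGroup V] [Module ℂ V] [SuperSpace V] {τ : LieSuperModule HC V}

/-- A simple module is spanned by the images of one vector under the words in the parity involution
and the countably many basis elements of `𝔥𝔠`. -/
theorem rank_le_aleph0 (hτ : τ.IsSimple) : Module.rank ℂ V ≤ Cardinal.aleph0 := by
  have : Nontrivial V := hτ.1
  obtain ⟨v, hv⟩ := exists_ne (0 : V)
  -- The words in the basis vectors and the parity involution, applied to `v`, span `V`.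
  let op : Option HCIdx → Module.End ℂ V := fun k =>
    k.elim (SuperSpace.parity V) fun k => τ.act (e k)
  let word : List (Option HCIdx) → V := fun l => (l.map op).prod v
  let N := Submodule.span ℂ (Set.range word)
  have hop : ∀ k, ∀ a ∈ N, op k a ∈ N := by
    intro k a ha
    have : N ≤ N.comap (op k) := by
      refine Submodule.span_le.2 ?_
      rintro _ ⟨l, rfl⟩
      refine Submodule.subset_span ⟨k :: l, ?_⟩
      simp [word]
    exact this ha
  have hN : N = ⊤ := by
    refine (hτ.2 N (SuperSpace.isGraded_of_parity (hop none)) fun x a ha =>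
      act_mem_of_basis (f := τ.act) (fun k _ => hop (some k)) (mem_spanOf_univ x) ha).resolve_left
        fun h => hv ?_
    have : word [] ∈ N := Submodule.subset_span ⟨[], rfl⟩
    rw [h, Submodule.mem_bot] at this
    exact this
  rw [← rank_top, ← hN]
  refine (rank_span_le _).trans ?_
  exact Cardinal.mk_le_aleph0_iff.2 (Set.countable_range word).to_subtype

/-- On a simple `𝔥𝔠`-module, `c₃` acts by a scalar. -/
theorem exists_act_c₃_eq_smul (hτ : τ.IsSimple) : ∃ μ : ℂ, ∀ a, τ.act c₃ a = μ • a := by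
  have : Nontrivial V := hτ.1
  obtain ⟨μ, hμ⟩ := spectrum_nonempty_of_rank_le_aleph0 (rank_le_aleph0 hτ) (τ.act c₃)
  refine ⟨μ, fun a => ?_⟩
  have h := hτ.eq_zero_or_bijective (f := algebraMap ℂ (Module.End ℂ V) μ - τ.act c₃)
    (fun x b => ?_) (fun b => ?_)
  · have h0 := h.resolve_right fun hb => spectrum.mem_iff.1 hμ ((Module.End.isUnit_iff _).2 hb)
    exact (sub_eq_zero.1 (LinearMap.congr_fun h0 a)).symm
  · simp only [LinearMap.sub_apply, Module.algebraMap_end_apply, map_sub, map_smul]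
    rw [τ.act_act_of_central c₃_mem_grade bracket_c₃]
  · simp only [LinearMap.sub_apply, Module.algebraMap_end_apply, map_sub, map_smul]
    rw [τ.act_parity_of_even c₃_mem_grade]

end HC

/-! ### The fermionic Fock space as a module over the fermion superalgebra -/

namespace Fock

variable {J : Type u}

/-- Induction on the number of creation operators applied to the vacuum vector. -/
theorem induction_cre {P : Fock J → Prop} (one : P 1) (smul : ∀ (c : ℂ) x, P x → P (c • x))
    (add : ∀ x y, P x → P y → P (x + y)) (cre : ∀ j x, P x → P (cre j x)) (x : Fock J) : P x := by
  induction x using Fock.induction with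
  | one => exact one
  | smul c x hx => exact smul c x hx
  | add x y hx hy => exact add x y hx hy
  | ι_mul v x hx =>
    induction v using Finsupp.induction_linear with
    | zero => rw [map_zero, zero_mul, ← zero_smul ℂ (1 : Fock J)]; exact smul 0 1 one
    | add v w hv hw => rw [map_add, add_mul]; exact add _ _ hv hw
    | single j c =>
      rw [← Finsupp.smul_single_one, map_smul, smul_mul_assoc]
      exact smul c _ (cre j x hx)

theorem invol_cre (j : J) (x : Fock J) : invol J (cre j x) = -cre j (invol J x) :=
  LinearMap.congr_fun (invol_mul_cre j) x

theorem invol_ann (j : J) (x : Fock J) : invol J (ann j x) = -ann j (invol J x) :=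
  LinearMap.congr_fun (invol_mul_ann j) x

noncomputable instance : SuperSpace (Fock J) :=
  SuperSpace.ofInvolution (invol J) invol_mul_invol

theorem parity_eq : SuperSpace.parity (Fock J) = invol J :=
  SuperSpace.parity_eq_of_grade_eq_eigen fun _ => rfl

end Fock

namespace HC

open Fock LieSuperModule

/-- The module over a subalgebra of `𝔥𝔠` spanned by basis vectors that is given by operators
satisfying the relations. -/
noncomputable def moduleOfRelations {V : Type v} [AddCommGroup V] [Module ℂ V] [SuperSpace V]
    {T : Set HCIdx} {hT : HCIdx.c ∈ T} (f : HC →ₗ[ℂ] Module.End ℂ V)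
    (hf : SatisfiesRelations T fun k => f (e k))
    (hp : ∀ k ∈ T, ∀ a, SuperSpace.parity V (f (e k) a) =
      SuperSpace.paritySign k.parity • f (e k) (SuperSpace.parity V a)) :
    LieSuperModule (subalgebra T hT) V where
  act := f ∘ₗ (subalgebra T hT).toSubmodule.subtype
  act_mem {i j x a} hx ha := by
    change f (x : HC) a ∈ _
    have hx' : (x : HC) ∈ spanOf (T ∩ {k | k.parity = i}) := by
      rw [spanOf, Finsupp.supported_inter]; exact ⟨x.2, hx⟩
    refine act_mem_of_basis (N := grade j) (fun k hk b hb => ?_) hx' ha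
    rw [SuperSpace.mem_grade_iff, hp k hk.1, SuperSpace.mem_grade_iff.1 hb, map_smul,
      SuperSpace.paritySign_add, smul_smul, show k.parity = i from hk.2]
  act_bracket {i j x y} hx hy a := by
    have h := LinearMap.congr_fun (hf.mul_eq x.2 y.2 hx hy) a
    change f (LieSuperalgebra.bracket (x : HC) (y : HC)) a = f x (f y a) - _ • f y (f x a)
    rw [eq_sub_iff_add_eq, add_comm]
    exact h.symm

/-- The action of the basis vectors of `𝔣` on the Fock space with level `μ`; the basis vectors `H_i`
outside `𝔣` are given the value `0`. The labels `ℕ` of the oscillators are lifted so that the Fock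
space can live in the universe of a given module. -/
noncomputable def fockOp (μ : ℂ) : HCIdx → Module.End ℂ (Fock (ULift.{u} ℕ))
  | .F n => if 0 ≤ n then μ • ann ⟨n.toNat⟩ else cre ⟨(-n - 1).toNat⟩
  | .H _ => 0
  | .c => μ • 1

theorem fockOp_of_nonneg (μ : ℂ) {n : ℤ} (h : 0 ≤ n) :
    fockOp.{u} μ (.F n) = μ • ann ⟨n.toNat⟩ := if_pos h

theorem fockOp_of_neg (μ : ℂ) {n : ℤ} (h : n < 0) :
    fockOp.{u} μ (.F n) = cre ⟨(-n - 1).toNat⟩ := if_neg (not_le.2 h)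

/-- The labels of the basis of `𝔣`. -/
abbrev fermIdx : Set HCIdx := Set.range HCIdx.F ∪ {HCIdx.c}

/-- The labels of the basis of `𝔥`. -/
abbrev heisIdx : Set HCIdx := Set.range HCIdx.H ∪ {HCIdx.c}

/-- The labels of the `F_p` with `p > 0`. -/
def fermPos : Set HCIdx := {k | ∃ n : ℤ, 0 ≤ n ∧ k = HCIdx.F n}

theorem fermPos_subset_pos : fermPos ⊆ HCIdx.pos := by
  rintro _ ⟨n, hn, rfl⟩
  exact HCIdx.mem_pos.2 (by simp only [HCIdx.twiceDeg]; omega)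

theorem fermPos_subset_fermIdx : fermPos ⊆ fermIdx := by
  rintro _ ⟨n, _, rfl⟩
  exact Or.inl ⟨n, rfl⟩

theorem dual_mem_fermIdx : ∀ k ∈ fermPos, k.dual ∈ fermIdx := by
  rintro _ ⟨n, _, rfl⟩
  exact Or.inl ⟨_, rfl⟩

theorem mem_heisIdx {k : HCIdx} (h : k ∉ fermPos) (h' : k.dual ∉ fermPos) : k ∈ heisIdx := by
  rcases k with n | n | _
  · exact Or.inl ⟨n, rfl⟩
  · exfalso
    by_cases hn : 0 ≤ n
    · exact h ⟨n, hn, rfl⟩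
    · exact h' ⟨-n - 1, by omega, rfl⟩
  · exact Or.inr rfl

theorem dual_not_mem_fermPos {k : HCIdx} (h : k ∈ heisIdx) : k.dual ∉ fermPos := by
  rcases h with ⟨n, rfl⟩ | rfl <;> rintro ⟨n, _, h⟩ <;> cases h

theorem satisfiesRelations_fockOp (μ : ℂ) : SatisfiesRelations fermIdx (fockOp.{u} μ) := by
  classical
  have hs : ∀ i j, superSign (HCIdx.F i).parity (HCIdx.F j).parity = -1 := fun i j => by
    simp [HCIdx.parity, superSign]
  have hneg : ∀ x : Module.End ℂ (Fock (ULift.{u} ℕ)), (-1 : ℂ) • x = -x :=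
    fun x => neg_one_smul ℂ x
  have hup : ∀ a b : ℕ, ((⟨a⟩ : ULift.{u} ℕ) = ⟨b⟩) ↔ a = b := fun a b => by simp
  have h1 : ∀ i j : ℤ, 0 ≤ i → j < 0 → fockOp.{u} μ (.F i) * fockOp μ (.F j) =
      (-1 : ℂ) • (fockOp μ (.F j) * fockOp μ (.F i)) +
        HCIdx.form (.F i) (.F j) • fockOp μ .c := by
    intro i j hi hj
    rw [fockOp_of_nonneg μ hi, fockOp_of_neg μ hj, smul_mul_assoc, ann_mul_cre, smul_sub,
      mul_smul_comm, hneg, sub_eq_neg_add]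
    congr 1
    rw [smul_comm]
    refine congrArg (· • (μ • (1 : Module.End ℂ (Fock (ULift.{u} ℕ))))) ?_
    simp only [hup, HCIdx.form]
    refine if_congr ?_ rfl rfl
    omega
  rintro _ (⟨i, rfl⟩ | rfl) _ (⟨j, rfl⟩ | rfl)
  · rw [hs]
    rcases le_or_gt 0 i with hi | hi <;> rcases le_or_gt 0 j with hj | hj
    · rw [fockOp_of_nonneg μ hi, fockOp_of_nonneg μ hj, form_F_of_ne (by omega), zero_smul,
        add_zero, smul_mul_smul_comm, smul_mul_smul_comm, ann_mul_ann, smul_neg, hneg]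
    · exact h1 i j hi hj
    · have h := h1 j i hj hi
      have hform : HCIdx.form (.F i) (.F j) = HCIdx.form (.F j) (.F i) := by
        simp only [HCIdx.form, add_comm i j]
      rw [hform, h, hneg, hneg, neg_add, neg_neg, neg_add_cancel_right]
    · rw [fockOp_of_neg μ hi, fockOp_of_neg μ hj, form_F_of_ne (by omega), zero_smul, add_zero,
        cre_mul_cre, hneg]
  · simp [fockOp, HCIdx.form, superSign, HCIdx.parity]
  · simp [fockOp, HCIdx.form, superSign, HCIdx.parity]
  · simp [fockOp, HCIdx.form, superSign, HCIdx.parity]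

theorem linearCombination_fockOp_e (μ : ℂ) (k : HCIdx) :
    Finsupp.linearCombination ℂ (fockOp.{u} μ) (e k) = fockOp μ k := by
  simp [e, Finsupp.linearCombination_single]

/-- The Fock space as an `𝔣`-module on which `c₃` acts by `μ`. -/
noncomputable def fockModule (μ : ℂ) : LieSuperModule ferm (Fock (ULift.{u} ℕ)) :=
  moduleOfRelations (Finsupp.linearCombination ℂ (fockOp μ))
    (by simpa only [linearCombination_fockOp_e] using satisfiesRelations_fockOp μ) <| by
    simp only [linearCombination_fockOp_e, Fock.parity_eq]
    rintro _ (⟨n, rfl⟩ | rfl) x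
    · rw [show SuperSpace.paritySign (HCIdx.F n).parity = -1 from SuperSpace.paritySign_one,
        neg_one_smul ℂ]
      rcases le_or_gt 0 n with hn | hn
      · rw [fockOp_of_nonneg μ hn, LinearMap.smul_apply, map_smul, invol_ann, LinearMap.smul_apply,
          smul_neg]
      · rw [fockOp_of_neg μ hn, invol_cre]
    · rw [show SuperSpace.paritySign HCIdx.c.parity = 1 from SuperSpace.paritySign_zero, one_smul]
      exact map_smul (invol _) μ x

theorem fockModule_act_e (μ : ℂ) {k : HCIdx} (hk : k ∈ fermIdx) :
    (fockModule.{u} μ).act ⟨e k, e_mem hk⟩ = fockOp μ k :=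
  linearCombination_fockOp_e μ k

theorem isUnit_fockOp_c {μ : ℂ} (hμ : μ ≠ 0) : IsUnit (fockOp.{u} μ .c) := by
  have : fockOp.{u} μ .c = algebraMap ℂ _ μ := (Algebra.algebraMap_eq_smul_one μ).symm
  rw [this]
  exact (IsUnit.mk0 μ hμ).map _

theorem fockModule_isSimple {μ : ℂ} (hμ : μ ≠ 0) : (fockModule.{u} μ).IsSimple := by
  refine ⟨inferInstance, fun N _ hN => or_iff_not_imp_left.2 fun hN0 => ?_⟩
  have hact : ∀ k ∈ fermIdx, ∀ x ∈ N, fockOp μ k x ∈ N := fun k hk x hx => by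
    rw [← fockModule_act_e μ hk]; exact hN _ x hx
  have hcre : ∀ j, ∀ x ∈ N, cre j x ∈ N := fun j x hx => by
    have := hact (.F (-(j.down : ℤ) - 1)) (Or.inl ⟨_, rfl⟩) x hx
    rwa [fockOp_of_neg μ (by omega),
      show (-(-(j.down : ℤ) - 1) - 1).toNat = j.down by omega] at this
  let O := oscillators (satisfiesRelations_fockOp μ) (Or.inr rfl) fermPos fermPos_subset_pos
    fermPos_subset_fermIdx dual_mem_fermIdx (isUnit_fockOp_c hμ)
  let W : Submodule ℂ (Fock (ULift.{u} ℕ)) := ℂ ∙ 1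
  have hW : W ≤ O.vacuum := by
    refine (Submodule.span_singleton_le_iff_mem _ _).2 (mem_vacuum_oscillators.2 ?_)
    rintro _ ⟨n, hn, rfl⟩
    rw [fockOp_of_nonneg μ hn, LinearMap.smul_apply, ann_one, smul_zero]
  have hgen : O.generated W = ⊤ := by
    refine eq_top_iff.2 fun x _ => ?_
    induction x using Fock.induction_cre with
    | one => exact O.le_generated W (Submodule.mem_span_singleton_self 1)
    | smul c x hx => exact Submodule.smul_mem _ c (hx trivial)
    | add x y hx hy => exact Submodule.add_mem _ (hx trivial) (hy trivial)
    | cre j x hx =>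
      have := O.cre_mem_generated ⟨.F j.down, _, Int.natCast_nonneg _, rfl⟩ (hx trivial)
      change fockOp μ (.F (-(j.down : ℤ) - 1)) x ∈ _ at this
      rwa [fockOp_of_neg μ (by omega),
        show (-(-(j.down : ℤ) - 1) - 1).toNat = j.down by omega] at this
  obtain ⟨x, hxN, hxv, hx0⟩ := O.exists_mem_vacuum hW (fun x hx => W.smul_mem μ hx) hgen hN0
    fun k x hx => hact k (fermPos_subset_fermIdx k.2) x hx
  have hxW : x ∈ W := OscillatorSystem.mem_of_mem_vacuum_of_mem_generated hW hxv
    (by rw [hgen]; trivial)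
  obtain ⟨c, rfl⟩ := Submodule.mem_span_singleton.1 hxW
  have h1 : (1 : Fock (ULift.{u} ℕ)) ∈ N :=
    (N.smul_mem_iff fun hc => hx0 (by rw [hc, zero_smul])).1 hxN
  refine eq_top_iff.2 fun x _ => ?_
  induction x using Fock.induction_cre with
  | one => exact h1
  | smul c x hx => exact N.smul_mem c (hx trivial)
  | add x y hx hy => exact N.add_mem (hx trivial) (hy trivial)
  | cre j x hx => exact hcre j x (hx trivial)

theorem fockModule_isSmooth (μ : ℂ) : (fockModule.{u} μ).IsSmooth (subDeg ferm) := by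
  intro a
  obtain ⟨S, hS⟩ := eventually_ann_eq_zero a
  refine ⟨2 * S.sup ULift.down + 1, fun k hk x hx => ?_⟩
  have hx' : (x : HC) ∈ spanOf (fermIdx ∩ {l | l.twiceDeg = k}) := by
    rw [spanOf, Finsupp.supported_inter]; exact ⟨x.2, hx⟩
  have := act_mem_of_basis (f := Finsupp.linearCombination ℂ (fockOp.{u} μ)) (N := ℂ ∙ a) (N' := ⊥)
    ?_ hx' (Submodule.mem_span_singleton_self a)
  · exact (Submodule.mem_bot ℂ).1 this
  rintro _ ⟨⟨n, rfl⟩ | rfl, hl⟩ b hb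
  · have hl' : 2 * n + 1 = k := hl
    obtain ⟨c, rfl⟩ := Submodule.mem_span_singleton.1 hb
    rw [linearCombination_fockOp_e, fockOp_of_nonneg μ (by omega), LinearMap.smul_apply, map_smul,
      hS, smul_zero, smul_zero]
    · exact Submodule.zero_mem _
    · intro hn
      have := Finset.le_sup (f := ULift.down) hn
      simp only at this
      omega
  · have hl' : 0 = k := hl
    omega

end HC

/-! ### The tensor product decomposition -/

namespace HC

open Fock LieSuperModule

variable {V : Type v} [AddCommGroup V] [Module ℂ V] [SuperSpace V] (τ : LieSuperModule HC V)

/-- The combinations of the creation operators `F_{-j-1/2}`, `j ≥ 0`. -/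
noncomputable def fermionCre : (ULift.{v} ℕ →₀ ℂ) →ₗ[ℂ] Module.End ℂ V :=
  Finsupp.linearCombination ℂ fun j => τ.act (e (.F (-(j.down : ℤ) - 1)))

theorem fermionCre_single (j : ULift.{v} ℕ) :
    fermionCre τ (Finsupp.single j 1) = τ.act (e (.F (-(j.down : ℤ) - 1))) := by
  simp [fermionCre, Finsupp.linearCombination_single]

theorem act_F_mul_act_F (i j : ℤ) :
    (τ.act (e (.F i)) * τ.act (e (.F j)) : Module.End ℂ V) =
      HCIdx.form (.F i) (.F j) • τ.act c₃ - τ.act (e (.F j)) * τ.act (e (.F i)) := by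
  have h := satisfiesRelations_act τ (.F i) trivial (.F j) trivial
  rw [show superSign (HCIdx.F i).parity (HCIdx.F j).parity = -1 by simp [HCIdx.parity, superSign],
    neg_one_smul ℂ] at h
  rw [sub_eq_neg_add]
  exact h

theorem act_H_mul_act_F (i j : ℤ) :
    (τ.act (e (.H i)) * τ.act (e (.F j)) : Module.End ℂ V) =
      τ.act (e (.F j)) * τ.act (e (.H i)) := by
  have h := satisfiesRelations_act τ (.H i) trivial (.F j) trivial
  simpa [HCIdx.parity, superSign, HCIdx.form] using h

/-- An identity linear in `v` holds for `fermionCre τ v` if it does for the generators. -/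
theorem fermionCre_induction {M : Type*} [AddCommGroup M] [Module ℂ M]
    {p q : (ULift.{v} ℕ →₀ ℂ) →ₗ[ℂ] M} (h : ∀ j, p (Finsupp.single j 1) = q (Finsupp.single j 1)) :
    p = q :=
  Finsupp.lhom_ext' fun j => LinearMap.ext_ring (h j)

theorem fermionCre_mul_self (v : ULift.{v} ℕ →₀ ℂ) : fermionCre τ v * fermionCre τ v = 0 := by
  let μ := LinearMap.mul ℂ (Module.End ℂ V)
  have h : μ.compl₁₂ (fermionCre τ) (fermionCre τ) =
      -μ.flip.compl₁₂ (fermionCre τ) (fermionCre τ) := by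
    refine fermionCre_induction fun i => fermionCre_induction fun j => ?_
    change fermionCre τ _ * fermionCre τ _ = -(fermionCre τ _ * fermionCre τ _)
    rw [fermionCre_single, fermionCre_single, act_F_mul_act_F, form_F_of_ne (by omega), zero_smul,
      zero_sub]
  have hv : fermionCre τ v * fermionCre τ v = -(fermionCre τ v * fermionCre τ v) :=
    LinearMap.congr_fun (LinearMap.congr_fun h v) v
  have h2 : (2 : ℂ) • (fermionCre τ v * fermionCre τ v) = 0 := by
    rw [two_smul]; nth_rewrite 1 [hv]; exact neg_add_cancel _
  exact (smul_eq_zero.1 h2).resolve_left two_ne_zero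

/-- The action of the exterior algebra generated by the creation operators `F_{-j-1/2}`, `j ≥ 0`. -/
noncomputable def fermionAlg : Fock (ULift.{v} ℕ) →ₐ[ℂ] Module.End ℂ V :=
  ExteriorAlgebra.lift ℂ ⟨fermionCre τ, fermionCre_mul_self τ⟩

theorem fermionAlg_ι_mul (w : ULift.{v} ℕ →₀ ℂ) (x : Fock (ULift.{v} ℕ)) (a : V) :
    fermionAlg τ (ExteriorAlgebra.ι ℂ w * x) a = fermionCre τ w (fermionAlg τ x a) := by
  rw [map_mul, fermionAlg, ExteriorAlgebra.lift_ι_apply]; rfl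

theorem fermionAlg_one (a : V) : fermionAlg τ 1 a = a := by
  rw [map_one]; rfl

theorem fermionAlg_cre (j : ULift.{v} ℕ) (x : Fock (ULift.{v} ℕ)) (a : V) :
    fermionAlg τ (cre j x) a = τ.act (e (.F (-(j.down : ℤ) - 1))) (fermionAlg τ x a) := by
  rw [cre_apply, fermionAlg_ι_mul, fermionCre_single]

theorem act_H_fermionAlg (i : ℤ) (x : Fock (ULift.{v} ℕ)) (a : V) :
    τ.act (e (.H i)) (fermionAlg τ x a) = fermionAlg τ x (τ.act (e (.H i)) a) := by
  induction x using Fock.induction_cre with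
  | one => rw [fermionAlg_one, fermionAlg_one]
  | smul c x hx => simp only [map_smul, LinearMap.smul_apply, hx]
  | add x y hx hy => simp only [map_add, LinearMap.add_apply, hx, hy]
  | cre j x hx =>
    rw [fermionAlg_cre, fermionAlg_cre, ← hx]
    exact LinearMap.congr_fun (act_H_mul_act_F τ i _) _

theorem act_c₃_fermionAlg (x : Fock (ULift.{v} ℕ)) (a : V) :
    τ.act c₃ (fermionAlg τ x a) = fermionAlg τ x (τ.act c₃ a) := by
  induction x using Fock.induction_cre with
  | one => rw [fermionAlg_one, fermionAlg_one]
  | smul c x hx => simp only [map_smul, LinearMap.smul_apply, hx]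
  | add x y hx hy => simp only [map_add, LinearMap.add_apply, hx, hy]
  | cre j x hx =>
    rw [fermionAlg_cre, fermionAlg_cre, ← hx, τ.act_act_of_central c₃_mem_grade bracket_c₃]

theorem parity_fermionAlg (x : Fock (ULift.{v} ℕ)) (a : V) :
    SuperSpace.parity V (fermionAlg τ x a) =
      fermionAlg τ (invol _ x) (SuperSpace.parity V a) := by
  induction x using Fock.induction_cre with
  | one => rw [invol_one, fermionAlg_one, fermionAlg_one]
  | smul c x hx => simp only [map_smul, LinearMap.smul_apply, hx]
  | add x y hx hy => simp only [map_add, LinearMap.add_apply, hx, hy]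
  | cre j x hx =>
    rw [fermionAlg_cre, invol_cre, map_neg, LinearMap.neg_apply, fermionAlg_cre, ← hx, parity_act_e,
      show SuperSpace.paritySign (HCIdx.F _).parity = -1 from SuperSpace.paritySign_one,
      neg_one_smul]

/-- On vectors obtained from a vacuum vector `a`, the annihilation operators act by contraction. -/
theorem act_F_fermionAlg {μ : ℂ} (hμ : ∀ a, τ.act c₃ a = μ • a) {n : ℤ} (hn : 0 ≤ n) {a : V}
    (ha : τ.act (e (.F n)) a = 0) (x : Fock (ULift.{v} ℕ)) :
    τ.act (e (.F n)) (fermionAlg τ x a) = fermionAlg τ (μ • ann ⟨n.toNat⟩ x) a := by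
  classical
  induction x using Fock.induction_cre with
  | one => rw [fermionAlg_one, ann_one, smul_zero, map_zero, ha]; rfl
  | smul c x hx => simp only [map_smul, LinearMap.smul_apply, hx, smul_comm c μ]
  | add x y hx hy => simp only [map_add, LinearMap.add_apply, hx, hy, smul_add]
  | cre j x hx =>
    have h1 := LinearMap.congr_fun (act_F_mul_act_F τ n (-(j.down : ℤ) - 1)) (fermionAlg τ x a)
    have h2 := LinearMap.congr_fun (ann_mul_cre (⟨n.toNat⟩ : ULift.{v} ℕ) j) x
    rw [Module.End.mul_apply, LinearMap.sub_apply, LinearMap.smul_apply, Module.End.mul_apply, hx,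
      hμ] at h1
    rw [Module.End.mul_apply, LinearMap.sub_apply, LinearMap.smul_apply, Module.End.mul_apply,
      Module.End.one_apply] at h2
    have h3 : HCIdx.form (.F n) (.F (-(j.down : ℤ) - 1)) =
        if (⟨n.toNat⟩ : ULift.{v} ℕ) = j then 1 else 0 := by
      simp only [HCIdx.form]
      refine if_congr ?_ rfl rfl
      rw [ULift.ext_iff]
      change _ ↔ n.toNat = j.down
      omega
    rw [fermionAlg_cre, h1, h2, h3, smul_sub, map_sub, LinearMap.sub_apply, map_smul, map_smul]
    simp only [LinearMap.smul_apply, map_smul, fermionAlg_cre]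
    rw [smul_comm μ]

/-- In a nonzero smooth module there are vectors killed by all `F_p` with `p > 0`: if `a` is killed
by all `F_p` with `p > q`, then `a` or `F_q a` is killed by all `F_p` with `p ≥ q`. -/
theorem exists_ne_zero_act_F_eq_zero [Nontrivial V] (hs : τ.IsSmooth deg) :
    ∃ a : V, a ≠ 0 ∧ ∀ n : ℤ, 0 ≤ n → τ.act (e (.F n)) a = 0 := by
  have step : ∀ k : ℕ, (∃ a : V, a ≠ 0 ∧ ∀ n : ℤ, k ≤ n → τ.act (e (.F n)) a = 0) →
      ∃ a : V, a ≠ 0 ∧ ∀ n : ℤ, 0 ≤ n → τ.act (e (.F n)) a = 0 := by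
    intro k
    induction k with
    | zero => exact id
    | succ k ih =>
      rintro ⟨a, ha, hk⟩
      by_cases h : τ.act (e (.F k)) a = 0
      · refine ih ⟨a, ha, fun n hn => ?_⟩
        rcases hn.eq_or_lt with rfl | hn
        · exact h
        · exact hk n (by push_cast; omega)
      · refine ih ⟨_, h, fun n hn => ?_⟩
        have hcomm := LinearMap.congr_fun (act_F_mul_act_F τ n k) a
        rw [form_F_of_ne (by omega), zero_smul, zero_sub] at hcomm
        simp only [LinearMap.neg_apply, Module.End.mul_apply] at hcomm
        rcases hn.eq_or_lt with rfl | hn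
        · have h2 : (2 : ℂ) • τ.act (e (.F k)) (τ.act (e (.F k)) a) = 0 := by
            rw [two_smul]; nth_rewrite 1 [hcomm]; exact neg_add_cancel _
          exact (smul_eq_zero.1 h2).resolve_left two_ne_zero
        · rw [hcomm, hk n (by push_cast; omega), map_zero, neg_zero]
  obtain ⟨a, ha⟩ := exists_ne (0 : V)
  obtain ⟨k, hk⟩ := hs a
  refine step k ⟨a, ha, fun n hn => hk (2 * n + 1) (by omega) _ ?_⟩
  exact e_mem (T := {l | l.twiceDeg = 2 * n + 1}) rfl

variable {H : Type w} [AddCommGroup H] [Module ℂ H]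

theorem lTensor_fockOp_satisfiesRelations (μ : ℂ) :
    SatisfiesRelations fermIdx fun k => LinearMap.lTensor H (fockOp.{u} μ k) := by
  intro k hk l hl
  have h := congrArg (LinearMap.lTensor H) (satisfiesRelations_fockOp.{u} μ k hk l hl)
  rw [LinearMap.lTensor_add, LinearMap.lTensor_smul, LinearMap.lTensor_smul] at h
  simpa only [LinearMap.lTensor_mul] using h

/-- A linear map from `H ⊗ Fock` that is compatible with the annihilation operators is injective if
it is so on the vacuum vectors `h ⊗ 1`. -/
theorem injective_of_fockOp {μ : ℂ} (hμ : μ ≠ 0) {φ : H ⊗[ℂ] Fock (ULift.{u} ℕ) →ₗ[ℂ] V}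
    (hφ : ∀ n : ℤ, 0 ≤ n → ∀ t, φ (LinearMap.lTensor H (fockOp μ (.F n)) t) =
      τ.act (e (.F n)) (φ t))
    (h1 : ∀ h : H, φ (h ⊗ₜ 1) = 0 → h = 0) : Function.Injective φ := by
  have hu : IsUnit (LinearMap.lTensor H (fockOp.{u} μ .c) :
      Module.End ℂ (H ⊗[ℂ] Fock (ULift.{u} ℕ))) := by
    obtain ⟨U, hU⟩ := isUnit_fockOp_c.{u} hμ
    refine ⟨⟨LinearMap.lTensor H (U : Module.End ℂ _), LinearMap.lTensor H (↑U⁻¹ : Module.End ℂ _),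
      ?_, ?_⟩, congrArg (LinearMap.lTensor H) hU⟩
    · rw [← LinearMap.lTensor_mul, Units.mul_inv]; exact LinearMap.lTensor_id ..
    · rw [← LinearMap.lTensor_mul, Units.inv_mul]; exact LinearMap.lTensor_id ..
  let O := oscillators (lTensor_fockOp_satisfiesRelations (H := H) μ) (Or.inr rfl) fermPos
    fermPos_subset_pos fermPos_subset_fermIdx dual_mem_fermIdx hu
  let one : H →ₗ[ℂ] H ⊗[ℂ] Fock (ULift.{u} ℕ) := (TensorProduct.mk ℂ H _).flip 1
  have hW : LinearMap.range one ≤ O.vacuum := by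
    rintro _ ⟨h, rfl⟩
    refine mem_vacuum_oscillators.2 ?_
    rintro _ ⟨n, hn, rfl⟩
    change h ⊗ₜ fockOp μ (.F n) 1 = 0
    rw [fockOp_of_nonneg μ hn, LinearMap.smul_apply, ann_one, smul_zero, TensorProduct.tmul_zero]
  have hgen : O.generated (LinearMap.range one) = ⊤ := by
    refine (Submodule.eq_top_iff').2 fun t => ?_
    induction t using TensorProduct.induction_on with
    | zero => exact Submodule.zero_mem _
    | add x y hx hy => exact Submodule.add_mem _ hx hy
    | tmul h x =>
      induction x using Fock.induction_cre with
      | one => exact O.le_generated _ ⟨h, rfl⟩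
      | smul c x hx => rw [TensorProduct.tmul_smul]; exact Submodule.smul_mem _ c hx
      | add x y hx hy => rw [TensorProduct.tmul_add]; exact Submodule.add_mem _ hx hy
      | cre j x hx =>
        have := O.cre_mem_generated ⟨.F j.down, _, Int.natCast_nonneg _, rfl⟩ hx
        change h ⊗ₜ fockOp μ (.F (-(j.down : ℤ) - 1)) x ∈ _ at this
        rwa [fockOp_of_neg μ (by omega),
          show (-(-(j.down : ℤ) - 1) - 1).toNat = j.down by omega] at this
  have hcen : ∀ t ∈ LinearMap.range one, (O.cen : Module.End ℂ _) t ∈ LinearMap.range one := by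
    rintro _ ⟨h, rfl⟩
    exact ⟨μ • h, TensorProduct.smul_tmul μ h 1⟩
  have hann : ∀ k, ∀ t ∈ LinearMap.ker φ, O.ann k t ∈ LinearMap.ker φ := by
    rintro ⟨_, n, hn, rfl⟩ t ht
    refine LinearMap.mem_ker.2 ((hφ n hn t).trans ?_)
    rw [LinearMap.mem_ker.1 ht, map_zero]
  rw [← LinearMap.ker_eq_bot]
  by_contra hker
  obtain ⟨t, ht, htv, ht0⟩ := O.exists_mem_vacuum hW hcen hgen hker hann
  obtain ⟨h, rfl⟩ := OscillatorSystem.mem_of_mem_vacuum_of_mem_generated hW htv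
    (by rw [hgen]; trivial)
  exact ht0 (by rw [h1 h ht, map_zero])

/-- A simple smooth module on which `c₃` acts nonzero is the tensor product of the space of vectors
killed by all `F_p`, `p > 0`, and the fermionic Fock space. -/
theorem exists_tensor_decomposition (hτ : τ.IsSimple) (hs : τ.IsSmooth deg) (hc : τ.act c₃ ≠ 0) :
    ∃ (H : Type v) (_ : AddCommGroup H) (_ : Module ℂ H) (_ : SuperSpace H)
      (K : Type v) (_ : AddCommGroup K) (_ : Module ℂ K) (_ : SuperSpace K)
      (η : LieSuperModule heis H) (κ : LieSuperModule ferm K),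
      η.IsSimple ∧ η.IsSmooth (subDeg heis) ∧ κ.IsSimple ∧ κ.IsSmooth (subDeg ferm) ∧
      ∃ φ : H ⊗[ℂ] K ≃ₗ[ℂ] V,
        (∀ i j, ∀ h ∈ SuperSpace.grade (V := H) i, ∀ k ∈ SuperSpace.grade (V := K) j,
          φ (h ⊗ₜ k) ∈ SuperSpace.grade (V := V) (i + j)) ∧
        (∀ (x : heis) (h : H) (k : K), φ (η.act x h ⊗ₜ k) = τ.act (x : HC) (φ (h ⊗ₜ k))) ∧
        (∀ (x : ferm) (h : H) (k : K), φ (h ⊗ₜ κ.act x k) = τ.act (x : HC) (φ (h ⊗ₜ k))) := by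
  have hu : IsUnit (τ.act c₃ : Module.End ℂ V) :=
    hτ.isUnit_act_of_central c₃_mem_grade bracket_c₃ hc
  have : Nontrivial V := hτ.1
  obtain ⟨μ, hμ⟩ := exists_act_c₃_eq_smul hτ
  have hμ0 : μ ≠ 0 := by
    rintro rfl
    exact hc (LinearMap.ext fun a => (hμ a).trans (zero_smul ℂ a))
  let O := moduleOscillators τ fermPos fermPos_subset_pos hu
  have hOmem : ∀ {a : V}, a ∈ O.vacuum → ∀ n : ℤ, 0 ≤ n → τ.act (e (.F n)) a = 0 :=
    fun ha n hn => mem_vacuum.1 ha _ ⟨n, hn, rfl⟩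
  have hO : O.vacuum ≠ ⊥ := by
    obtain ⟨a, ha, hav⟩ := exists_ne_zero_act_F_eq_zero τ hs
    have : a ∈ O.vacuum := mem_vacuum.2 (by rintro _ ⟨n, hn, rfl⟩; exact hav n hn)
    exact fun h => ha (by rw [h] at this; exact this)
  have hactl : ∀ l ∈ heisIdx, ∀ a ∈ O.vacuum, τ.act (e l) a ∈ O.vacuum := fun l hl a ha =>
    act_mem_vacuum (Set.mem_univ l) (dual_not_mem_fermPos hl) ha
  have hact : ∀ x ∈ heis.toSubmodule, ∀ a ∈ O.vacuum, τ.act x a ∈ O.vacuum :=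
    fun x hx a ha => act_mem_of_basis (f := τ.act) hactl hx ha
  let _ : SuperSpace O.vacuum := SuperSpace.ofGraded isGraded_vacuum
  let η : LieSuperModule heis O.vacuum := τ.restrict heis isGraded_vacuum hact
  let φ : O.vacuum ⊗[ℂ] Fock (ULift.{v} ℕ) →ₗ[ℂ] V :=
    TensorProduct.lift ((fermionAlg τ).toLinearMap.flip ∘ₗ O.vacuum.subtype)
  have hφ : ∀ (h : O.vacuum) k, φ (h ⊗ₜ k) = fermionAlg τ k (h : V) := fun h k => rfl
  have hferm : ∀ k ∈ fermIdx, ∀ h x, φ (h ⊗ₜ fockOp μ k x) = τ.act (e k) (φ (h ⊗ₜ x)) := by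
    rintro _ (⟨n, rfl⟩ | rfl) h x
    · rw [hφ, hφ]
      rcases le_or_gt 0 n with hn | hn
      · rw [act_F_fermionAlg τ hμ hn (hOmem h.2 n hn), fockOp_of_nonneg μ hn]; rfl
      · rw [fockOp_of_neg μ hn, fermionAlg_cre]
        congr 4
        dsimp only
        omega
    · rw [hφ, hφ]
      exact (congrArg (fun T : Module.End ℂ V => T (h : V)) (map_smul (fermionAlg τ) μ x)).trans
        (hμ _).symm
  have hferm' : ∀ k ∈ fermIdx, ∀ t,
      φ (LinearMap.lTensor _ (fockOp μ k) t) = τ.act (e k) (φ t) := by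
    intro k hk
    refine LinearMap.congr_fun (f := φ ∘ₗ LinearMap.lTensor _ (fockOp μ k)) (g := τ.act (e k) ∘ₗ φ)
      (TensorProduct.ext' fun h x => ?_)
    exact hferm k hk h x
  have hinj : Function.Injective φ := by
    refine injective_of_fockOp τ hμ0 (fun n _ => hferm' _ (Or.inl ⟨n, rfl⟩)) fun h h0 => ?_
    rw [hφ, fermionAlg_one] at h0
    exact Subtype.ext h0
  have hsurj : Function.Surjective φ := by
    rw [← LinearMap.range_eq_top, eq_top_iff,
      ← generated_eq_top (hI := fermPos_subset_pos) (hu := hu) hτ isGraded_vacuum hO le_rfl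
        fun l h h' => hactl l (mem_heisIdx h h')]
    refine OscillatorSystem.generated_le _ (fun a ha => ⟨(⟨a, ha⟩ : O.vacuum) ⊗ₜ 1, ?_⟩) ?_
    · rw [hφ, fermionAlg_one]
    · rintro k _ ⟨t, rfl⟩
      exact ⟨_, hferm' _ (dual_mem_fermIdx k k.2) t⟩
  refine ⟨O.vacuum, inferInstance, inferInstance, inferInstance, Fock (ULift.{v} ℕ), inferInstance,
    inferInstance, inferInstance, η, fockModule μ,
    isSimple_restrict_vacuum hτ (fun k => mem_heisIdx) hact hO, fun a => ?_,
    fockModule_isSimple hμ0, fockModule_isSmooth μ, LinearEquiv.ofBijective φ ⟨hinj, hsurj⟩,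
    fun i j h hh k hk => ?_, fun x h k => ?_, fun x h k => ?_⟩
  · obtain ⟨n, hn⟩ := hs (a : V)
    exact ⟨n, fun k hk x hx => Subtype.ext (hn k hk x hx)⟩
  · change fermionAlg τ k (h : V) ∈ _
    have hh' : (h : V) ∈ grade (V := V) i := hh
    have hk' : invol _ k = SuperSpace.paritySign j • k := SuperSpace.mem_eigen_iff.1 hk
    rw [SuperSpace.mem_grade_iff, parity_fermionAlg, hk', SuperSpace.mem_grade_iff.1 hh', map_smul,
      map_smul, LinearMap.smul_apply, smul_smul, SuperSpace.paritySign_add]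
  · change fermionAlg τ k (τ.act (x : HC) (h : V)) = τ.act (x : HC) (fermionAlg τ k (h : V))
    let p : HC →ₗ[ℂ] V := fermionAlg τ k ∘ₗ τ.act.flip (h : V)
    let q : HC →ₗ[ℂ] V := τ.act.flip (fermionAlg τ k (h : V))
    suffices hpq : spanOf heisIdx ≤ LinearMap.eqLocus p q from hpq x.2
    rw [spanOf_eq, Submodule.span_le]
    rintro _ ⟨_, ⟨n, rfl⟩ | rfl, rfl⟩
    · exact (act_H_fermionAlg τ n k h).symm
    · exact (act_c₃_fermionAlg τ k h).symm
  · let p : HC →ₗ[ℂ] V := (φ ∘ₗ TensorProduct.mk ℂ _ _ h) ∘ₗ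
      (Finsupp.linearCombination ℂ (fockOp.{v} μ)).flip k
    let q : HC →ₗ[ℂ] V := τ.act.flip (φ (h ⊗ₜ k))
    suffices hpq : spanOf fermIdx ≤ LinearMap.eqLocus p q from hpq x.2
    rw [spanOf_eq, Submodule.span_le]
    rintro _ ⟨l, hl, rfl⟩
    change φ (h ⊗ₜ Finsupp.linearCombination ℂ (fockOp.{v} μ) (e l) k) = _
    rw [linearCombination_fockOp_e]
    exact hferm l hl h k

end HC

/-! ### Simple smooth modules of nonzero level -/

theorem theorem3p4 :
    -- simplicity of the induced modules
    (∀ (m : ℕ), 1 ≤ m →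
      ∀ (B : Type u) [AddCommGroup B] [Module ℂ B] [SuperSpace B]
        (ρ : LieSuperModule (HC.fin m) B),
        ρ.IsSimple → ρ.act (HC.fin_c₃ m) ≠ 0 → (HC.indModule m ρ).IsSimple) ∧
    -- every simple smooth module of nonzero level is induced
    (∀ (V : Type u) [AddCommGroup V] [Module ℂ V] [SuperSpace V] (τ : LieSuperModule HC V),
      τ.IsSimple → τ.IsSmooth HC.deg → τ.act HC.c₃ ≠ 0 →
      ∃ (m : ℕ) (B : Type u) (_ : AddCommGroup B) (_ : Module ℂ B) (_ : SuperSpace B)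
        (ρ : LieSuperModule (HC.fin m) B),
        1 ≤ m ∧ ρ.IsSimple ∧ ρ.act (HC.fin_c₃ m) ≠ 0 ∧ τ.Iso (HC.indModule m ρ)) ∧
    -- isomorphism of induced modules
    (∀ (m : ℕ), 1 ≤ m →
      ∀ (B : Type u) [AddCommGroup B] [Module ℂ B] [SuperSpace B]
        (B' : Type v) [AddCommGroup B'] [Module ℂ B'] [SuperSpace B']
        (ρ : LieSuperModule (HC.fin m) B) (ρ' : LieSuperModule (HC.fin m) B'),
        ρ.IsSimple → ρ.act (HC.fin_c₃ m) ≠ 0 → ρ'.IsSimple → ρ'.act (HC.fin_c₃ m) ≠ 0 →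
        ((HC.indModule m ρ).Iso (HC.indModule m ρ') ↔ ρ.Iso ρ')) ∧
    -- tensor product decomposition
    (∀ (V : Type u) [AddCommGroup V] [Module ℂ V] [SuperSpace V] (τ : LieSuperModule HC V),
      τ.IsSimple → τ.IsSmooth HC.deg → τ.act HC.c₃ ≠ 0 →
      ∃ (H : Type u) (_ : AddCommGroup H) (_ : Module ℂ H) (_ : SuperSpace H)
        (K : Type u) (_ : AddCommGroup K) (_ : Module ℂ K) (_ : SuperSpace K)
        (η : LieSuperModule HC.heis H) (κ : LieSuperModule HC.ferm K),
        η.IsSimple ∧ η.IsSmooth (HC.subDeg HC.heis) ∧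
        κ.IsSimple ∧ κ.IsSmooth (HC.subDeg HC.ferm) ∧
        ∃ φ : H ⊗[ℂ] K ≃ₗ[ℂ] V,
          (∀ i j, ∀ h ∈ SuperSpace.grade (V := H) i, ∀ k ∈ SuperSpace.grade (V := K) j,
            φ (h ⊗ₜ k) ∈ SuperSpace.grade (V := V) (i + j)) ∧
          (∀ (x : HC.heis) (h : H) (k : K), φ (η.act x h ⊗ₜ k) = τ.act (x : HC) (φ (h ⊗ₜ k))) ∧
          (∀ (x : HC.ferm) (h : H) (k : K), φ (h ⊗ₜ κ.act x k) = τ.act (x : HC) (φ (h ⊗ₜ k)))) := by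
  refine ⟨fun m _ B _ _ _ ρ => HC.indModule_isSimple, fun V _ _ _ τ => HC.exists_iso_indModule,
    fun m _ B _ _ _ B' _ _ _ ρ ρ' hρ hc hρ' hc' => ⟨fun h => ?_, HC.indModule_iso⟩,
    fun V _ _ _ τ => HC.exists_tensor_decomposition τ⟩
  exact HC.iso_of_indModule_iso (HC.isUnit_fin_c₃ hρ hc) (HC.isUnit_fin_c₃ hρ' hc') h
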